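/- **Notation.** $\lceil z\rfloor^q:=|z|^q\,\mathrm{sign}(z)$ and $\tanh$ act componentwise on vectors, $\|\cdot\|$ is the Euclidean norm of vectors and the spectral norm of matrices, and $\mathcal K_\infty$ is the class of continuous, strictly increasing, unbounded functions $[0,\infty)\to[0,\infty)$ vanishing at $0$. **Plant.** Let $M(q)=\sum_{k\le\imath}\theta_{Mk}M_k(q)\in\mathbb R^{n\times n}$ be symmetric and $\mathcal U_1,\dots,\mathcal U_\jmath:\mathbb R^n\to\mathbb R$, where $M_k$, $\mathcal U_k$ are smooth and bounded and the gradients $\nabla\mathcal U_k$ are bounded. Let $C(q,\dot q)$ be the Coriolis matrix of $M$ defined through the Christoffel symbols of the first kind, and $\Psi(q)=[\nabla\mathcal U_1(q)\cdots\nabla\mathcal U_\jmath(q)]$. Assume that there are $\mu_m,\mu_M,L_c>0$ with $\mu_mI\le M(q)\le\mu_MI$ and $\|C(q,v)-C(q,w)\|\le L_c\|v-w\|$ for all $q,v,w$. **Closed loop.** Let $P,D,D_L\in\mathbb R^{n\times n}$, $\Gamma,\Upsilon\in\mathbb R^{\jmath\times\jmath}$ be diagonal and positive definite, $2r_2>r_1>r_2>0$,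 $a=(2r_2-r_1)/r_1$, $b=(2r_2-r_1)/r_2$, $\gamma_1,\gamma_2,d_1,d>0$ and $q_d\in\mathbb R^n$. Let $\zeta_1(\Delta)=\lceil\Delta\rfloor^d\lceil\Delta\rfloor^b/(1+|\Delta|^{b+d})$. Put $x=(e_1,e_2,\tilde\theta)\in\mathbb R^{2n+\jmath}$, $q=e_1+q_d$, and consider $$\dot e_1=e_2,\qquad \dot e_2=M(q)^{-1}\big[-P\lceil e_1\rfloor^a-D\lceil e_2\rfloor^b-D_Le_2-C(q,e_2)e_2+\Psi(q)\tilde\theta\big],$$ $$\dot{\tilde\theta}=-\Gamma\Psi(q)^\top[\gamma_1d_1\tanh(e_1)+(\gamma_1+\gamma_2)e_2]-(\gamma_1+\gamma_2)\Gamma\Upsilon\zeta_1(\Delta)\lceil\tilde\theta\rfloor^b .\tag{1}$$ Here $\Delta=\det(I-zf_0F)$, where, with $\alpha,\beta_0,f_0>0$ and $\xi\ge1/f_0$, $$\dot F=-\alpha F\Omega^\top\Omega F+\beta F,\quad F(0)=\tfrac1{f_0}I,\qquad \beta=\beta_0(1-\|F\|/\xi),\qquad \dot z=-\beta z,\quad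 z(0)=1 .$$ For $\lambda_0,\lambda_1>0$, the filtered regressor $\Omega$, with $\imath+\jmath$ columns, is one of the following two. * *Power balance:* $\Omega^\top=\mathbf z+\lambda_0\omega$, $\dot{\mathbf z}=-\lambda_1(\mathbf z+\lambda_0\omega)$, where $\omega=\big(\tfrac12e_2^\top M_1(q)e_2,\dots,\tfrac12e_2^\top M_\imath(q)e_2,\ \mathcal U_1(q),\dots,\mathcal U_\jmath(q)\big)^\top$. * *Force balance:* $\Omega=[\mathbf z+\lambda_0\varphi_3\ \ \Omega_2]$, $\dot{\mathbf z}=-\lambda_1(\mathbf z+\varphi_1)$, $\dot\Omega_2=-\lambda_1\Omega_2+\lambda_0\Psi(q)$, where the $k$-th columns of $\varphi_3$ and $\varphi_1$ are $M_k(q)e_2$ and $\lambda_0M_k(q)e_2+\frac{\lambda_0}{2\lambda_1}\nabla_q\{e_2^\top M_k(q)e_2\}$. Let $\xi_\circ$ collect $x(0)$ and the initial state of the filter of $\Omega$ ($\mathbf z$, respectively $\mathbf z$ and $\Omega_2$). Let $\Xi$ be any set of such initial states (all of them, or those with prescribed filter initial values, for instance). We say that $\Omega$ is *exciting on $[t_1,t_1+T]$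 with level $\mu$ on $\{\xi_\circ\in\Xi:\|\xi_\circ\|\le R\}$* if $\int_{t_1}^{t_1+T}\Omega(s)^\top\Omega(s)\,ds\ge\mu I$ for every solution on $[0,\infty)$ with $\xi_\circ\in\Xi$, $\|\xi_\circ\|\le R$. **Claim.** There is $\bar\gamma>0$, depending only on the plant and its bounds $\mu_m,\mu_M,L_c$ and on $P,D,D_L,r_1,r_2$, such that the following holds whenever $\gamma_1/(\gamma_1+\gamma_2)\le\bar\gamma$ and $d_1\le\lambda_{\min}(D_L)\mu_m/\mu_M^2$. 1. The origin $x=0$ of (1) is uniformly globally stable: there is $\kappa\in\mathcal K_\infty$ with $\|x(t)\|\le\kappa(\|x(0)\|)$ for all $t\in[0,\tau)$ and every solution on any interval $[0,\tau)$, $\tau\le\infty$. 2. Suppose that for each $R>0$ there are $t_1\ge0$, $T>0$, $\mu>0$ such that $\Omega$ is exciting on $[t_1,t_1+T]$ with level $\mu$ on $\{\xi_\circ\in\Xi:\|\xi_\circ\|\le R\}$. Then the origin is uniformly attractive in finite time on $\Xi$: for each $R>0$ there is $T_R>0$ such that $x(t)=0$ for all $t\ge T_R$ and every solution on $[0,\infty)$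 with $\xi_\circ\in\Xi$, $\|\xi_\circ\|\le R$. 3. (Settling time.) For $\gamma_3,\gamma_4,d_3>0$ let $$V_0=\tfrac{r_1}{2r_2}e_1^\top P\lceil e_1\rfloor^a+\tfrac12e_2^\top M(q)e_2,\qquad V_1=(\gamma_1+\gamma_2)V_0+\gamma_1d_1\tanh(e_1)^\top M(q)e_2+\gamma_1d_1\sum_iD_{Li}\ln\cosh e_{1i}+\tfrac12\tilde\theta^\top\Gamma^{-1}\tilde\theta,$$ $$V_{A1}=V_1+\big[\gamma_1^{-r_1}V_1^{2r_2+r_1}\big]^{1/(2r_2)},\qquad V_{FT}=(\gamma_3+\gamma_4)\big[V_{A1}^{3/2}+V_{A1}^2\big]+\gamma_3d_3\big(\lceil e_1\rfloor^{2r_2/r_1}\big)^\top M(q)e_2 .$$ There are $\gamma_3,\gamma_4,d_3,c_3>0$ and $\alpha_1,\alpha_2\in\mathcal K_\infty$, independent of $\Xi$, of $R$ and of the excitation, such that $\alpha_1(\|x\|)\le V_{FT}\le\alpha_2(\|x\|)$ for all $x$, such that along all solutions $$\dot V_{FT}\le-\gamma_3c_3\,\zeta_1(\Delta(t))\,\min\{V_{FT}^{\sigma_1},V_{FT}^{\sigma_2}\},\qquad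 \sigma_1=\frac{4r_2-r_1}{3r_2},\quad \sigma_2=\frac{3r_2}{2(2r_2+r_1)},$$ and such that the following holds. Let $\Omega$ be exciting on $[t_1,t_1+T]$ with some level $\mu>0$ on $\{\xi_\circ\in\Xi:\|\xi_\circ\|\le R\}$, where $R>0$, $t_1\ge0$, $T>0$, and put $T_{IE}:=t_1+T$. Then there is $\phi_m>0$ such that $\zeta_1(\Delta(t))\ge\phi_m$ for all $t\ge T_{IE}$ and all solutions on $[0,\infty)$ with $\xi_\circ\in\Xi$, $\|\xi_\circ\|\le R$; and for every such $\phi_m$ these solutions satisfy $$x(t)=0\qquad\text{for all } t\ge T_{IE}+\frac{3r_2\,\alpha_2(R)^{(r_1-r_2)/(3r_2)}}{(r_1-r_2)\gamma_3c_3\phi_m}.$$ -/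

import Mathlib

open Set Filter Topology
open scoped ContDiff Matrix

noncomputable section

namespace ELControl

/-- `ℝᵐ` with the Euclidean norm. -/
abbrev Vec (m : ℕ) : Type := EuclideanSpace ℝ (Fin m)

/-- The signed power `|z|^q sign z`. -/
def spow (z q : ℝ) : ℝ := |z| ^ q * Real.sign z

/-- The signed power of a vector, taken componentwise. -/
def vspow {m : ℕ} (v : Vec m) (q : ℝ) : Fin m → ℝ := fun i => spow (v i) q

/-- Class `K∞` functions on `[0, ∞)`. -/
def IsClassKInf (α : ℝ → ℝ) : Prop :=
  ContinuousOn α (Ici 0) ∧ StrictMonoOn α (Ici 0) ∧ α 0 = 0 ∧ Tendsto α atTop atTop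

/-- The spectral norm of a real square matrix. -/
def specNorm {κ : Type} [Fintype κ] [DecidableEq κ] (A : Matrix κ κ ℝ) : ℝ :=
  ‖Matrix.toEuclideanCLM (n := κ) (𝕜 := ℝ) A‖

/-! ### The plant -/

/-- An Euler-Lagrange plant with `n` degrees of freedom, whose inertia matrix and potential energy
are linear in `k` inertial and `j` potential parameters. -/
structure Plant (n k j : ℕ) where
  /-- the matrices `M₁, …, M_k` -/
  Mpart : Fin k → Vec n → Matrix (Fin n) (Fin n) ℝ
  /-- the potentials `U₁, …, U_j` -/
  Upart : Fin j → Vec n → ℝ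
  /-- the inertial parameters -/
  θM : Fin k → ℝ

namespace Plant

variable {n k j : ℕ} (S : Plant n k j)

/-- The inertia matrix `M(q)`. -/
def inertia (q : Vec n) : Matrix (Fin n) (Fin n) ℝ := ∑ i, S.θM i • S.Mpart i q

/-- The partial derivative `∂M_{ab}/∂q_i`. -/
def dInertia (q : Vec n) (i a b : Fin n) : ℝ :=
  fderiv ℝ (fun q' => S.inertia q' a b) q (EuclideanSpace.single i 1)

/-- The Coriolis matrix `C(q, v)`, from the Christoffel symbols of the first kind of `M`. -/
def coriolis (q v : Vec n) : Matrix (Fin n) (Fin n) ℝ := fun a b =>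
  ∑ i, (1 / 2 : ℝ) * (S.dInertia q i a b + S.dInertia q b a i - S.dInertia q a i b) * v i

/-- The regressor `Ψ(q)`, with columns `∇U₁(q), …, ∇U_j(q)`. -/
def Ψ (q : Vec n) : Matrix (Fin n) (Fin j) ℝ := fun a c => gradient (S.Upart c) q a

/-- The standing assumptions on the plant: smoothness and boundedness of the parts, and the bounds
on the inertia matrix and on the Coriolis matrix. -/
structure Standing (μm μM Lc : ℝ) : Prop where
  smooth_M : ∀ i a b, ContDiff ℝ ∞ (fun q => S.Mpart i q a b)
  smooth_U : ∀ c, ContDiff ℝ ∞ (S.Upart c)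
  bounded_M : ∃ B : ℝ, ∀ i q a b, |S.Mpart i q a b| ≤ B
  bounded_U : ∃ B : ℝ, ∀ c q, |S.Upart c q| ≤ B
  bounded_gradU : ∃ B : ℝ, ∀ c q, ‖gradient (S.Upart c) q‖ ≤ B
  symm : ∀ q, (S.inertia q).IsSymm
  μm_pos : 0 < μm
  μM_pos : 0 < μM
  lower : ∀ q (v : Vec n), μm * ‖v‖ ^ 2 ≤ v.ofLp ⬝ᵥ (S.inertia q *ᵥ v.ofLp)
  upper : ∀ q (v : Vec n), v.ofLp ⬝ᵥ (S.inertia q *ᵥ v.ofLp) ≤ μM * ‖v‖ ^ 2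
  Lc_pos : 0 < Lc
  lip : ∀ q v w, specNorm (S.coriolis q v - S.coriolis q w) ≤ Lc * ‖v - w‖

end Plant

/-! ### Design parameters -/

/-- Gains (the diagonals of the diagonal matrices `P, D, D_L`) and homogeneity weights of the
controller. -/
structure PDGains (n : ℕ) where
  P : Fin n → ℝ
  D : Fin n → ℝ
  DL : Fin n → ℝ
  r₁ : ℝ
  r₂ : ℝ
  P_pos : ∀ i, 0 < P i
  D_pos : ∀ i, 0 < D i
  DL_pos : ∀ i, 0 < DL i
  r₂_pos : 0 < r₂
  r₂_lt : r₂ < r₁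
  r₁_lt : r₁ < 2 * r₂

namespace PDGains

variable {n : ℕ} (G : PDGains n)

/-- The exponent `a = (2r₂ - r₁)/r₁`. -/
def a : ℝ := (2 * G.r₂ - G.r₁) / G.r₁

/-- The exponent `b = (2r₂ - r₁)/r₂`. -/
def b : ℝ := (2 * G.r₂ - G.r₁) / G.r₂

end PDGains

/-- Gains of the adaptation law: the diagonals of `Γ` and `Υ`, the constants `γ₁, γ₂, d₁`, and the
exponent `d` in the saturation function. -/
structure AdaptGains (j : ℕ) where
  Γ : Fin j → ℝ
  Υ : Fin j → ℝ
  γ₁ : ℝ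
  γ₂ : ℝ
  d₁ : ℝ
  d : ℝ
  Γ_pos : ∀ c, 0 < Γ c
  Υ_pos : ∀ c, 0 < Υ c
  γ₁_pos : 0 < γ₁
  γ₂_pos : 0 < γ₂
  d₁_pos : 0 < d₁
  d_pos : 0 < d

/-- Constants of the regressor filter (`lam₀, lam₁`) and of the least-squares dynamic regressor
extension with forgetting factor. -/
structure DREGains where
  lam₀ : ℝ
  lam₁ : ℝ
  α : ℝ
  f₀ : ℝ
  β₀ : ℝ
  ξ : ℝ
  lam₀_pos : 0 < lam₀
  lam₁_pos : 0 < lam₁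
  α_pos : 0 < α
  f₀_pos : 0 < f₀
  β₀_pos : 0 < β₀
  ξ_ge : 1 / f₀ ≤ ξ

/-- The saturation `f(Δ) = ⌈Δ⌋^d / (1 + |Δ|^(c+d))`. -/
def satFun (c d Δ : ℝ) : ℝ := spow Δ d / (1 + |Δ| ^ (c + d))

/-- `ζ₁(Δ) = f(Δ) ⌈Δ⌋^b`, with `c = b` in `f`. -/
def zeta1 (b d Δ : ℝ) : ℝ := satFun b d Δ * spow Δ b

/-! ### The filtered regressor -/

/-- The two parameterizations that generate the filtered regressor `Ω`. -/
inductive Parameterization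
  | powerBalance
  | forceBalance

/-- The number of rows of `Ω`. -/
def Parameterization.rows (n : ℕ) : Parameterization → ℕ
  | .powerBalance => 1
  | .forceBalance => n

/-- Column indices of `Ω`: the `k` inertial parameters, then the `j` potential parameters. -/
abbrev Col (k j : ℕ) : Type := Fin k ⊕ Fin j

/-- Type of `Ω` and of the state of the filter that generates it. -/
abbrev RegMat (n k j : ℕ) (p : Parameterization) : Type :=
  Matrix (Fin (p.rows n)) (Col k j) ℝ

section Regressor

variable {n k j : ℕ} (S : Plant n k j) (L : DREGains)

/-- The vector `ω(q, v)` of unscaled kinetic and potential energies. -/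
def energyReg (q v : Vec n) : Col k j → ℝ
  | .inl i => (1 / 2 : ℝ) * (v.ofLp ⬝ᵥ (S.Mpart i q *ᵥ v.ofLp))
  | .inr c => S.Upart c q

/-- The gradient in `q` of `vᵀ M_i(q) v`. -/
def gradKinetic (i : Fin k) (q v : Vec n) : Vec n :=
  gradient (fun q' : Vec n => v.ofLp ⬝ᵥ (S.Mpart i q' *ᵥ v.ofLp)) q

/-- The vector field of the regressor filter. For the power balance the filter state is `𝐳ᵀ`; for
the force balance it is `[𝐳 Ω₂]`. -/
def filterField (q v : Vec n) : (p : Parameterization) → RegMat n k j p → RegMat n k j p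
  | .powerBalance, w => fun i c => -L.lam₁ * (w i c + L.lam₀ * energyReg S q v c)
  | .forceBalance, w => fun i c =>
      match c with
      | .inl m => -L.lam₁ * (w i (.inl m) + (L.lam₀ * (S.Mpart m q *ᵥ v.ofLp) i
          + L.lam₀ / (2 * L.lam₁) * gradKinetic S m q v i))
      | .inr m => -L.lam₁ * w i (.inr m) + L.lam₀ * gradient (S.Upart m) q i

/-- The filtered regressor `Ω`, as a function of `q`, `v` and the filter state. -/
def regressor (q v : Vec n) : (p : Parameterization) → RegMat n k j p → RegMat n k j p
  | .powerBalance, w => fun i c => w i c + L.lam₀ * energyReg S q v c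
  | .forceBalance, w => fun i c =>
      match c with
      | .inl m => w i (.inl m) + L.lam₀ * (S.Mpart m q *ᵥ v.ofLp) i
      | .inr m => w i (.inr m)

end Regressor

/-! ### The closed loop -/

/-- The signals of the closed loop: position error, velocity, parameter error, filter state, and the
states `F` and `z` of the regressor extension. -/
structure Trajectory (n k j : ℕ) (p : Parameterization) where
  e₁ : ℝ → Vec n
  e₂ : ℝ → Vec n
  θ : ℝ → Vec j
  w : ℝ → RegMat n k j p
  F : ℝ → Matrix (Col k j) (Col k j) ℝ
  z : ℝ → ℝ

/-- Initial states of the closed loop that are not prescribed by the design (those of `F` and `z`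
are fixed): position error, velocity, parameter error and filter state. -/
abbrev InitState (n k j : ℕ) (p : Parameterization) : Type :=
  Vec n × Vec n × Vec j × RegMat n k j p

/-- The norm of `x = (e₁, e₂, θ)`. -/
def stateNorm {n j : ℕ} (e₁ e₂ : Vec n) (θ : Vec j) : ℝ :=
  Real.sqrt (‖e₁‖ ^ 2 + ‖e₂‖ ^ 2 + ‖θ‖ ^ 2)

/-- The Euclidean norm of an initial state. -/
def initNorm {n k j : ℕ} {p : Parameterization} (x : InitState n k j p) : ℝ :=
  Real.sqrt (‖x.1‖ ^ 2 + ‖x.2.1‖ ^ 2 + ‖x.2.2.1‖ ^ 2 + ∑ i, ∑ c, (x.2.2.2 i c) ^ 2)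

namespace Trajectory

variable {n k j : ℕ} {p : Parameterization} (X : Trajectory n k j p)

/-- The initial state. -/
def init : InitState n k j p := (X.e₁ 0, X.e₂ 0, X.θ 0, X.w 0)

/-- The norm of `x(t) = (e₁(t), e₂(t), θ(t))`. -/
def normAt (t : ℝ) : ℝ := stateNorm (X.e₁ t) (X.e₂ t) (X.θ t)

/-- `x(t) = 0`. -/
def AtOrigin (t : ℝ) : Prop := X.e₁ t = 0 ∧ X.e₂ t = 0 ∧ X.θ t = 0

/-- The filtered regressor along the trajectory. -/
def Ω (S : Plant n k j) (L : DREGains) (qd : Vec n) (t : ℝ) : RegMat n k j p :=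
  regressor S L (X.e₁ t + qd) (X.e₂ t) p (X.w t)

/-- The forgetting factor `β = β₀ (1 - ‖F‖/ξ)`. -/
def β (L : DREGains) (t : ℝ) : ℝ := L.β₀ * (1 - specNorm (X.F t) / L.ξ)

/-- `Φ = I - z f₀ F`. -/
def Φ (L : DREGains) (t : ℝ) : Matrix (Col k j) (Col k j) ℝ := 1 - (X.z t * L.f₀) • X.F t

/-- `Δ = det Φ`. -/
def Δ (L : DREGains) (t : ℝ) : ℝ := (X.Φ L t).det

end Trajectory

section ClosedLoop

variable {n k j : ℕ} (S : Plant n k j) (G : PDGains n) (A : AdaptGains j) (L : DREGains)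
  (qd : Vec n)

/-- The right-hand side of the velocity equation. -/
def velField (e₁ e₂ : Vec n) (θ : Vec j) : Vec n :=
  WithLp.toLp 2 ((S.inertia (e₁ + qd))⁻¹ *ᵥ
    (-(Matrix.diagonal G.P *ᵥ vspow e₁ G.a) - Matrix.diagonal G.D *ᵥ vspow e₂ G.b
      - Matrix.diagonal G.DL *ᵥ e₂.ofLp - S.coriolis (e₁ + qd) e₂ *ᵥ e₂.ofLp
      + S.Ψ (e₁ + qd) *ᵥ θ.ofLp))

/-- The right-hand side of the parameter-error equation; `ζ` stands for `ζ₁(Δ)`. -/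
def adaptField (ζ : ℝ) (e₁ e₂ : Vec n) (θ : Vec j) : Vec j :=
  WithLp.toLp 2
    (-(Matrix.diagonal A.Γ *ᵥ ((S.Ψ (e₁ + qd))ᵀ *ᵥ
        ((A.γ₁ * A.d₁) • (fun i => Real.tanh (e₁ i)) + (A.γ₁ + A.γ₂) • e₂.ofLp)))
      - ((A.γ₁ + A.γ₂) * ζ) • (Matrix.diagonal A.Γ *ᵥ (Matrix.diagonal A.Υ *ᵥ vspow θ G.b)))

/-- `X` is a solution of the closed loop on `[0, τ)`; `τ = ⊤` is allowed. -/
structure IsSolution {p : Parameterization} (τ : EReal) (X : Trajectory n k j p) : Prop where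
  F_zero : X.F 0 = (1 / L.f₀) • (1 : Matrix (Col k j) (Col k j) ℝ)
  z_zero : X.z 0 = 1
  deriv_e₁ : ∀ t : ℝ, 0 ≤ t → (t : EReal) < τ → HasDerivWithinAt X.e₁ (X.e₂ t) (Ici 0) t
  deriv_e₂ : ∀ t : ℝ, 0 ≤ t → (t : EReal) < τ →
    HasDerivWithinAt X.e₂ (velField S G qd (X.e₁ t) (X.e₂ t) (X.θ t)) (Ici 0) t
  deriv_θ : ∀ t : ℝ, 0 ≤ t → (t : EReal) < τ →
    HasDerivWithinAt X.θ
      (adaptField S G A qd (zeta1 G.b A.d (X.Δ L t)) (X.e₁ t) (X.e₂ t) (X.θ t)) (Ici 0) t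
  deriv_w : ∀ t : ℝ, 0 ≤ t → (t : EReal) < τ → ∀ i c,
    HasDerivWithinAt (fun s => X.w s i c)
      (filterField S L (X.e₁ t + qd) (X.e₂ t) p (X.w t) i c) (Ici 0) t
  deriv_F : ∀ t : ℝ, 0 ≤ t → (t : EReal) < τ → ∀ c c',
    HasDerivWithinAt (fun s => X.F s c c')
      ((-L.α • (X.F t * (X.Ω S L qd t)ᵀ * X.Ω S L qd t * X.F t) + X.β L t • X.F t) c c')
      (Ici 0) t
  deriv_z : ∀ t : ℝ, 0 ≤ t → (t : EReal) < τ →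
    HasDerivWithinAt X.z (-(X.β L t) * X.z t) (Ici 0) t

/-! ### Stability notions -/

/-- The origin `x = 0` is uniformly globally stable. -/
def UniformlyGloballyStable (p : Parameterization) : Prop :=
  ∃ κ : ℝ → ℝ, IsClassKInf κ ∧
    ∀ (τ : EReal) (X : Trajectory n k j p), IsSolution S G A L qd τ X →
      ∀ t : ℝ, 0 ≤ t → (t : EReal) < τ → X.normAt t ≤ κ (X.normAt 0)

/-- `X` is a solution on `[0, ∞)` that starts in `Ξ`, with initial state of norm at most `R`. -/
def StartsIn {p : Parameterization} (Ξ : Set (InitState n k j p)) (R : ℝ)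
    (X : Trajectory n k j p) : Prop :=
  IsSolution S G A L qd ⊤ X ∧ X.init ∈ Ξ ∧ initNorm X.init ≤ R

/-- `Ω` is exciting on `[t₁, t₁ + T]` with level `μ`, uniformly in the initial states of `Ξ` with
norm at most `R`. -/
def ExcitingOn {p : Parameterization} (Ξ : Set (InitState n k j p)) (R t₁ T μ : ℝ) : Prop :=
  ∀ X : Trajectory n k j p, StartsIn S G A L qd Ξ R X →
    (Matrix.of (fun c c' => ∫ s in t₁..(t₁ + T), ((X.Ω S L qd s)ᵀ * X.Ω S L qd s) c c')
      - μ • (1 : Matrix (Col k j) (Col k j) ℝ)).PosSemidef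

/-- Finite-time attractivity of the origin `x = 0`, uniform on the bounded subsets of `Ξ`. -/
def UniformlyAttractiveInFiniteTime {p : Parameterization} (Ξ : Set (InitState n k j p)) : Prop :=
  ∀ R : ℝ, 0 < R → ∃ TR : ℝ, 0 < TR ∧
    ∀ X : Trajectory n k j p, StartsIn S G A L qd Ξ R X → ∀ t, TR ≤ t → X.AtOrigin t

/-- `φ` is a lower bound of `ζ₁(Δ(t))` for `t ≥ T₀`, uniformly in the initial states of `Ξ` with
norm at most `R`. -/
def ZetaLowerBound {p : Parameterization} (Ξ : Set (InitState n k j p)) (R T₀ φ : ℝ) : Prop :=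
  ∀ X : Trajectory n k j p, StartsIn S G A L qd Ξ R X →
    ∀ t, T₀ ≤ t → φ ≤ zeta1 G.b A.d (X.Δ L t)

end ClosedLoop

/-! ### The Lyapunov function that the settling-time constants refer to -/

section Lyapunov

variable {n k j : ℕ} (S : Plant n k j) (G : PDGains n) (A : AdaptGains j) (qd : Vec n)

/-- `V₀ = (r₁/2r₂) e₁ᵀ P ⌈e₁⌋^a + ½ e₂ᵀ M(q) e₂`. -/
def V0 (e₁ e₂ : Vec n) : ℝ :=
  G.r₁ / (2 * G.r₂) * (e₁.ofLp ⬝ᵥ (Matrix.diagonal G.P *ᵥ vspow e₁ G.a))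
    + (1 / 2 : ℝ) * (e₂.ofLp ⬝ᵥ (S.inertia (e₁ + qd) *ᵥ e₂.ofLp))

/-- `V₁`. -/
def V1 (e₁ e₂ : Vec n) (θ : Vec j) : ℝ :=
  (A.γ₁ + A.γ₂) * V0 S G qd e₁ e₂
    + A.γ₁ * A.d₁ * ((fun i => Real.tanh (e₁ i)) ⬝ᵥ (S.inertia (e₁ + qd) *ᵥ e₂.ofLp))
    + A.γ₁ * A.d₁ * ∑ i, G.DL i * Real.log (Real.cosh (e₁ i))
    + (1 / 2 : ℝ) * ∑ c, (A.Γ c)⁻¹ * θ c ^ 2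

/-- `V_{A1} = V₁ + (γ₁^{-r₁} V₁^{2r₂+r₁})^{1/(2r₂)}`. -/
def VA1 (e₁ e₂ : Vec n) (θ : Vec j) : ℝ :=
  V1 S G A qd e₁ e₂ θ
    + (A.γ₁ ^ (-G.r₁) * V1 S G A qd e₁ e₂ θ ^ (2 * G.r₂ + G.r₁)) ^ (1 / (2 * G.r₂))

/-- `V_FT = (γ₃+γ₄)(V_{A1}^{3/2} + V_{A1}²) + γ₃ d₃ (⌈e₁⌋^{2r₂/r₁})ᵀ M(q) e₂`. -/
def VFT (γ₃ γ₄ d₃ : ℝ) (e₁ e₂ : Vec n) (θ : Vec j) : ℝ :=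
  (γ₃ + γ₄) * (VA1 S G A qd e₁ e₂ θ ^ (3 / 2 : ℝ) + VA1 S G A qd e₁ e₂ θ ^ 2)
    + γ₃ * d₃ * (vspow e₁ (2 * G.r₂ / G.r₁) ⬝ᵥ (S.inertia (e₁ + qd) *ᵥ e₂.ofLp))

/-- `V_FT` lies between two class `K∞` functions of the norm of `x`. -/
def VFTBounds (γ₃ γ₄ d₃ : ℝ) (α₁ α₂ : ℝ → ℝ) : Prop :=
  ∀ (e₁ e₂ : Vec n) (θ : Vec j),
    α₁ (stateNorm e₁ e₂ θ) ≤ VFT S G A qd γ₃ γ₄ d₃ e₁ e₂ θ ∧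
      VFT S G A qd γ₃ γ₄ d₃ e₁ e₂ θ ≤ α₂ (stateNorm e₁ e₂ θ)

/-- Along the solutions, `V_FT' ≤ -γ₃ c₃ ζ₁(Δ) min(V_FT^σ₁, V_FT^σ₂)`, with `σ₁ = (4r₂-r₁)/(3r₂)`
and `σ₂ = 3r₂/(2(2r₂+r₁))`. -/
def VFTDecay (L : DREGains) (p : Parameterization) (γ₃ γ₄ d₃ c₃ : ℝ) : Prop :=
  ∀ (τ : EReal) (X : Trajectory n k j p), IsSolution S G A L qd τ X →
    ∀ t : ℝ, 0 ≤ t → (t : EReal) < τ → ∃ v' : ℝ,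
      HasDerivWithinAt (fun s => VFT S G A qd γ₃ γ₄ d₃ (X.e₁ s) (X.e₂ s) (X.θ s)) v' (Ici 0) t ∧
      v' ≤ -(γ₃ * c₃ * zeta1 G.b A.d (X.Δ L t) *
        min (VFT S G A qd γ₃ γ₄ d₃ (X.e₁ t) (X.e₂ t) (X.θ t) ^ ((4 * G.r₂ - G.r₁) / (3 * G.r₂)))
          (VFT S G A qd γ₃ γ₄ d₃ (X.e₁ t) (X.e₂ t) (X.θ t) ^
            (3 * G.r₂ / (2 * (2 * G.r₂ + G.r₁)))))

end Lyapunov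

end ELControl

end

open ELControl

namespace ELControl

/-! ### Hyperbolic functions -/

/-! Write p = 2r₂/r₁ (`PDGains.pw`), so that 1 < p < 2, a = p - 1 and b p = 2a. The state is
measured by N = ∑|e₁ᵢ|^p + ‖e₂‖² + ‖θ̃‖² (`homSize`).

Stability. V₁ is comparable to N: its cross term is absorbed by the ln cosh terms and by part of the
kinetic energy, which is what the bound on d₁ provides. Along solutions the regressor terms cancel
against the adaptation law, and Ṁ = C + Cᵀ removes the Coriolis force from the energy balance. For a
small ratio γ₁/(γ₁+γ₂) there remains V₁' ≤ -c Z (`exists_V1Deriv_le`), where Z (`dissipation`)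
collects |e₂ᵢ|^(1+b), ‖e₂‖², |tanh e₁ᵢ||e₁ᵢ|^a and ζ₁(Δ)|θ̃ᵢ|^(1+b). As ζ₁ ≥ 0, V₁ never increases,
with or without excitation.

Decay of V_FT. Near the origin the e₂ and θ̃ parts of Z have order N^((1+b)/2), but the e₁ part only
has order N, too weak for finite-time convergence. The cross term (⌈e₁⌋^p)ᵀM e₂, of order N^(3/2),
repairs this: its derivative contains -∑Pᵢ|e₁ᵢ|^(p+a), of order N^(1+b/2) = N^(1/2) N^((1+b)/2).
After half of that term is spent, what else its derivative contains is at most a multiple of W Z,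
where W = (N^(1/2)+N)(1+N^(1/p)) (`exists_crossDeriv_le`). The rest of V_FT is designed so that its
derivative with respect to V₁ dominates W (`exists_dissWeight_le_gainOfV1`): the power 3/2 yields
N^(1/2), the power 2 yields the N that the Coriolis term requires, and the extra power of V₁ in
V_{A1} yields 1+N^(1/p), which undoes the saturation of tanh. For small d₃, V_FT' is then at most a
negative multiple of ζ₁N^(1+b/2) when N ≤ 1 and of ζ₁N^(3/2) when N ≥ 1 (`exists_le_dissipation`),
whereas V_FT is at most a multiple of N^(3/2), respectively N^(2(1+1/p)). The quotients of these
exponents are σ₁ and σ₂, both below 1.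

Excitation. zF is the inverse of H = f₀I + ∫αz⁻¹ΩᵀΩ (`smul_F_mul_infoMatrix`), and 0 < z ≤ 1. After
the exciting interval H ≥ (f₀+αμ)I, so each eigenvalue of I - f₀H⁻¹ is at least αμ/(f₀+αμ). This
bounds Δ, hence ζ₁(Δ), away from zero (`pow_le_det`).

Settling time. Integrating the decay gives a time with one term for each σ
(`eq_zero_of_finite_time_decay`). The stated formula has the σ₁ term only; since α₂ may be any upper
bound of class K∞, it is enlarged until that term covers both (`settlingBound`). -/

lemma hasDerivAt_tanh (x : ℝ) : HasDerivAt Real.tanh (1 - Real.tanh x ^ 2) x := by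
  have h : HasDerivAt (fun y => Real.sinh y / Real.cosh y) (1 - Real.tanh x ^ 2) x := by
    convert! (Real.hasDerivAt_sinh x).div (Real.hasDerivAt_cosh x) (Real.cosh_pos x).ne' using 1
    rw [Real.tanh_eq_sinh_div_cosh]
    have := (Real.cosh_pos x).ne'
    field_simp
  exact h.congr_of_eventuallyEq (Eventually.of_forall fun y => Real.tanh_eq_sinh_div_cosh y)

lemma hasDerivAt_log_cosh (x : ℝ) :
    HasDerivAt (fun y => Real.log (Real.cosh y)) (Real.tanh x) x := by
  rw [Real.tanh_eq_sinh_div_cosh]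
  exact (Real.hasDerivAt_cosh x).log (Real.cosh_pos x).ne'

lemma abs_tanh (x : ℝ) : |Real.tanh x| = Real.tanh |x| := by
  rcases le_total 0 x with h | h
  · rw [abs_of_nonneg h, abs_of_nonneg]
    rw [Real.tanh_eq_sinh_div_cosh]
    exact div_nonneg (Real.sinh_nonneg_iff.2 h) (Real.cosh_pos x).le
  · rw [abs_of_nonpos h, Real.tanh_neg, abs_of_nonpos]
    rw [Real.tanh_eq_sinh_div_cosh]
    exact div_nonpos_of_nonpos_of_nonneg (Real.sinh_nonpos_iff.2 h) (Real.cosh_pos x).le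

lemma abs_tanh_le_abs (x : ℝ) : |Real.tanh x| ≤ |x| := by
  rw [abs_tanh]
  have key : MonotoneOn (fun y => y - Real.tanh y) (Ici 0) := by
    apply monotoneOn_of_hasDerivWithinAt_nonneg (f' := fun y => 1 - (1 - Real.tanh y ^ 2))
      (convex_Ici 0)
    · exact fun y _ => (((hasDerivAt_id y).sub (hasDerivAt_tanh y)).continuousAt).continuousWithinAt
    · exact fun y _ => ((hasDerivAt_id y).sub (hasDerivAt_tanh y)).hasDerivWithinAt
    · intro y _
      nlinarith [sq_nonneg (Real.tanh y)]
  have := key (mem_Ici.2 le_rfl) (mem_Ici.2 (abs_nonneg x)) (abs_nonneg x)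
  simp only [Real.tanh_zero] at this
  linarith

/-- For y = |x| the claim reads y(cosh y - sinh y) ≤ sinh y, and the left side is y e^(-y) ≤ y. The
factor 1 + |x| is the price of undoing the saturation of tanh. -/
lemma abs_le_one_add_mul_abs_tanh (x : ℝ) : |x| ≤ (1 + |x|) * |Real.tanh x| := by
  rw [abs_tanh]
  set y := |x|
  have hy : 0 ≤ y := abs_nonneg x
  have hc := Real.cosh_pos y
  rw [Real.tanh_eq_sinh_div_cosh, ← mul_div_assoc, le_div_iff₀ hc]
  have h1 : y ≤ Real.sinh y := Real.self_le_sinh_iff.2 hy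
  have h2 : Real.cosh y - Real.sinh y = Real.exp (-y) := Real.cosh_sub_sinh y
  have h3 : Real.exp (-y) ≤ 1 := Real.exp_le_one_iff.2 (by linarith)
  nlinarith

lemma log_cosh_nonneg (x : ℝ) : 0 ≤ Real.log (Real.cosh x) := Real.log_nonneg (Real.one_le_cosh x)

/-- This is 1 - 1/u ≤ log u at u = cosh² x. It lets the ln cosh terms of V₁ absorb its cross term.
-/
lemma tanh_sq_le_two_mul_log_cosh (x : ℝ) : Real.tanh x ^ 2 ≤ 2 * Real.log (Real.cosh x) := by
  have hc := Real.cosh_pos x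
  have h := Real.one_sub_inv_le_log_of_pos (pow_pos hc 2)
  rw [Real.log_pow] at h
  have h2 : Real.tanh x ^ 2 = 1 - (Real.cosh x ^ 2)⁻¹ := by
    rw [Real.tanh_eq_sinh_div_cosh, div_pow, Real.sinh_sq]
    field_simp
  rw [h2]
  exact_mod_cast h

lemma log_cosh_le_abs_rpow (x : ℝ) {p : ℝ} (h1 : 1 ≤ p) (h2 : p ≤ 2) :
    Real.log (Real.cosh x) ≤ |x| ^ p := by
  rcases le_total |x| 1 with h | h
  · have h3 : Real.log (Real.cosh x) ≤ x ^ 2 / 2 := by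
      rw [Real.log_le_iff_le_exp (Real.cosh_pos x)]
      exact Real.cosh_le_exp_half_sq x
    have h4 : |x| ^ (2 : ℝ) ≤ |x| ^ p := by
      rcases (abs_nonneg x).eq_or_lt with h0 | h0
      · rw [← h0, Real.zero_rpow (by norm_num), Real.zero_rpow (by linarith)]
      · exact Real.rpow_le_rpow_of_exponent_ge h0 h h2
    rw [Real.rpow_two, sq_abs] at h4
    nlinarith [sq_nonneg x]
  · have h3 : Real.log (Real.cosh x) ≤ |x| := by
      rw [Real.log_le_iff_le_exp (Real.cosh_pos x), ← Real.cosh_abs, Real.cosh_eq]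
      have : Real.exp (-|x|) ≤ Real.exp |x| := Real.exp_le_exp.2 (by linarith)
      linarith
    have h4 : |x| ^ (1 : ℝ) ≤ |x| ^ p := Real.rpow_le_rpow_of_exponent_le h h1
    rw [Real.rpow_one] at h4
    linarith

/-! ### Signed powers -/

lemma spow_zero_left {q : ℝ} : spow 0 q = 0 := by simp [spow]

lemma abs_spow_le (z q : ℝ) : |spow z q| ≤ |z| ^ q := by
  rw [spow, abs_mul, abs_of_nonneg (Real.rpow_nonneg (abs_nonneg z) q)]
  apply mul_le_of_le_one_right (Real.rpow_nonneg (abs_nonneg z) q)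
  rcases Real.sign_apply_eq z with h | h | h <;> simp [h]

lemma sign_mul_abs' (z : ℝ) : Real.sign z * |z| = z := by
  rcases lt_trichotomy z 0 with h | h | h
  · rw [Real.sign_of_neg h, abs_of_neg h]; ring
  · simp [h]
  · rw [Real.sign_of_pos h, abs_of_pos h]; ring

lemma sign_mul_self' (z : ℝ) : Real.sign z * z = |z| := by
  rcases lt_trichotomy z 0 with h | h | h
  · rw [Real.sign_of_neg h, abs_of_neg h]; ring
  · simp [h]
  · rw [Real.sign_of_pos h, abs_of_pos h]; ring

lemma self_mul_spow (z q : ℝ) (hq : 0 ≤ q) : z * spow z q = |z| ^ (1 + q) := by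
  rw [spow, mul_comm, mul_assoc, sign_mul_self', Real.rpow_add' (abs_nonneg z) (by linarith),
    Real.rpow_one, mul_comm]

lemma spow_mul_spow (z p q : ℝ) (hp : 0 < p) (hq : 0 ≤ q) :
    spow z p * spow z q = |z| ^ (p + q) := by
  rw [Real.rpow_add' (abs_nonneg z) (by linarith), spow, spow]
  rcases lt_trichotomy z 0 with h | h | h
  · rw [Real.sign_of_neg h]; ring
  · subst h; simp [Real.zero_rpow hp.ne']
  · rw [Real.sign_of_pos h]; ring

lemma abs_tanh_mul_spow (z q : ℝ) : Real.tanh z * spow z q = |Real.tanh z| * |z| ^ q := by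
  rw [spow]
  rcases lt_trichotomy z 0 with h | h | h
  · have : Real.tanh z ≤ 0 := by
      rw [Real.tanh_eq_sinh_div_cosh]
      exact div_nonpos_of_nonpos_of_nonneg (Real.sinh_nonpos_iff.2 h.le) (Real.cosh_pos z).le
    rw [Real.sign_of_neg h, abs_of_nonpos this]; ring
  · subst h; simp
  · have : 0 ≤ Real.tanh z := by
      rw [Real.tanh_eq_sinh_div_cosh]
      exact div_nonneg (Real.sinh_nonneg_iff.2 h.le) (Real.cosh_pos z).le
    rw [Real.sign_of_pos h, abs_of_nonneg this]; ring

lemma hasDerivAt_abs_rpow_spow (x : ℝ) {q : ℝ} (hq : 1 < q) :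
    HasDerivAt (fun y : ℝ => |y| ^ q) (q * spow x (q - 1)) x := by
  convert! hasDerivAt_abs_rpow x hq using 1
  rw [mul_assoc]
  congr 1
  rcases eq_or_ne x 0 with h | h
  · subst h; simp [spow]
  · have hx : 0 < |x| := abs_pos.2 h
    rw [spow, show q - 1 = (q - 2) + 1 by ring, Real.rpow_add hx, Real.rpow_one, mul_assoc,
      mul_comm |x|, sign_mul_abs']

lemma hasDerivAt_spow (x : ℝ) {q : ℝ} (hq : 1 < q) :
    HasDerivAt (fun y : ℝ => spow y q) (q * |x| ^ (q - 1)) x := by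
  rcases lt_trichotomy x 0 with h | h | h
  · have h1 : HasDerivAt (fun y : ℝ => -(|y| ^ q)) (q * |x| ^ (q - 1)) x := by
      convert! (hasDerivAt_abs_rpow_spow x hq).neg using 1
      rw [spow, Real.sign_of_neg h]; ring
    apply h1.congr_of_eventuallyEq
    filter_upwards [Iio_mem_nhds h] with y hy
    rw [spow, Real.sign_of_neg hy]; ring
  · subst h
    have h0 : HasDerivAt (fun y : ℝ => |y| ^ q) 0 0 := by
      simpa [spow] using hasDerivAt_abs_rpow_spow 0 hq
    have : q * |(0 : ℝ)| ^ (q - 1) = 0 := by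
      rw [abs_zero, Real.zero_rpow (by linarith), mul_zero]
    rw [this]
    rw [hasDerivAt_iff_isLittleO_nhds_zero] at h0 ⊢
    simp only [zero_add, smul_zero, sub_zero, abs_zero, spow_zero_left,
      Real.zero_rpow (show q ≠ 0 by linarith)] at h0 ⊢
    -- At the origin the signed power is dominated by |y|^q, whose derivative there is already known
    -- to vanish.
    refine Asymptotics.IsBigO.trans_isLittleO ?_ h0
    refine Asymptotics.IsBigO.of_bound 1 (Eventually.of_forall fun y => ?_)
    rw [one_mul, Real.norm_eq_abs, Real.norm_eq_abs,
      abs_of_nonneg (Real.rpow_nonneg (abs_nonneg y) q)]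
    exact abs_spow_le y q
  · have h1 : HasDerivAt (fun y : ℝ => (|y| ^ q)) (q * |x| ^ (q - 1)) x := by
      convert! (hasDerivAt_abs_rpow_spow x hq) using 1
      rw [spow, Real.sign_of_pos h]; ring
    apply h1.congr_of_eventuallyEq
    filter_upwards [Ioi_mem_nhds h] with y hy
    rw [spow, Real.sign_of_pos hy]; ring

/-! ### The saturation function -/

lemma zeta1_eq (b d Δ : ℝ) (hb : 0 < b) (hd : 0 < d) :
    zeta1 b d Δ = |Δ| ^ (b + d) / (1 + |Δ| ^ (b + d)) := by
  rw [zeta1, satFun, div_mul_eq_mul_div, spow_mul_spow _ _ _ hd hb.le, add_comm d b]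

lemma zeta1_nonneg (b d Δ : ℝ) (hb : 0 < b) (hd : 0 < d) : 0 ≤ zeta1 b d Δ := by
  rw [zeta1_eq _ _ _ hb hd]
  have := Real.rpow_nonneg (abs_nonneg Δ) (b + d)
  positivity

lemma zeta1_le_one (b d Δ : ℝ) (hb : 0 < b) (hd : 0 < d) : zeta1 b d Δ ≤ 1 := by
  rw [zeta1_eq _ _ _ hb hd]
  have := Real.rpow_nonneg (abs_nonneg Δ) (b + d)
  rw [div_le_one (by linarith)]
  linarith

lemma zeta1_pos (b d Δ : ℝ) (hb : 0 < b) (hd : 0 < d) (hΔ : 0 < Δ) : 0 < zeta1 b d Δ := by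
  rw [zeta1_eq _ _ _ hb hd]
  have := Real.rpow_pos_of_pos (abs_pos.2 hΔ.ne') (b + d)
  positivity

lemma zeta1_mono (b d Δ Δ' : ℝ) (hb : 0 < b) (hd : 0 < d) (h0 : 0 ≤ Δ) (h : Δ ≤ Δ') :
    zeta1 b d Δ ≤ zeta1 b d Δ' := by
  rw [zeta1_eq _ _ _ hb hd, zeta1_eq _ _ _ hb hd, abs_of_nonneg h0, abs_of_nonneg (h0.trans h)]
  have h1 := Real.rpow_nonneg h0 (b + d)
  have h2 := Real.rpow_le_rpow h0 h (show 0 ≤ b + d by linarith)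
  rw [div_le_div_iff₀ (by linarith) (by linarith)]
  nlinarith

/-! ### Class `K∞` functions -/

lemma IsClassKInf.nonneg {f : ℝ → ℝ} (hf : IsClassKInf f) {s : ℝ} (hs : 0 ≤ s) : 0 ≤ f s := by
  have := hf.2.1.monotoneOn (mem_Ici.2 le_rfl) (mem_Ici.2 hs) hs
  rwa [hf.2.2.1] at this

lemma IsClassKInf.le {f : ℝ → ℝ} (hf : IsClassKInf f) {s t : ℝ} (hs : 0 ≤ s) (h : s ≤ t) :
    f s ≤ f t := hf.2.1.monotoneOn (mem_Ici.2 hs) (mem_Ici.2 (hs.trans h)) h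

lemma IsClassKInf.add {f g : ℝ → ℝ} (hf : IsClassKInf f) (hg : IsClassKInf g) :
    IsClassKInf (fun s => f s + g s) :=
  ⟨hf.1.add hg.1, fun _ hx _ hy h => add_lt_add (hf.2.1 hx hy h) (hg.2.1 hx hy h),
    by simp [hf.2.2.1, hg.2.2.1], hf.2.2.2.atTop_add_atTop hg.2.2.2⟩

lemma IsClassKInf.const_mul {f : ℝ → ℝ} (hf : IsClassKInf f) {c : ℝ} (hc : 0 < c) :
    IsClassKInf (fun s => c * f s) :=
  ⟨hf.1.const_mul c, fun _ hx _ hy h => mul_lt_mul_of_pos_left (hf.2.1 hx hy h) hc,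
    by simp [hf.2.2.1], hf.2.2.2.const_mul_atTop hc⟩

lemma IsClassKInf.rpow {f : ℝ → ℝ} (hf : IsClassKInf f) {q : ℝ} (hq : 0 < q) :
    IsClassKInf (fun s => f s ^ q) :=
  ⟨hf.1.rpow_const fun _ _ => Or.inr hq.le,
    fun _ hx _ hy h => Real.rpow_lt_rpow (hf.nonneg hx) (hf.2.1 hx hy h) hq,
    by simp [hf.2.2.1, Real.zero_rpow hq.ne'], (tendsto_rpow_atTop hq).comp hf.2.2.2⟩

lemma IsClassKInf.min {f g : ℝ → ℝ} (hf : IsClassKInf f) (hg : IsClassKInf g) :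
    IsClassKInf (fun s => min (f s) (g s)) :=
  ⟨hf.1.inf hg.1, fun _ hx _ hy h => min_lt_min (hf.2.1 hx hy h) (hg.2.1 hx hy h),
    by simp [hf.2.2.1, hg.2.2.1], by
      rw [tendsto_atTop]
      intro b
      filter_upwards [hf.2.2.2.eventually_ge_atTop b, hg.2.2.2.eventually_ge_atTop b] with s h1 h2
      exact le_min h1 h2⟩

lemma isClassKInf_id : IsClassKInf (fun s => s) :=
  ⟨continuousOn_id, fun _ _ _ _ h => h, rfl, tendsto_id⟩

lemma isClassKInf_rpow {q : ℝ} (hq : 0 < q) : IsClassKInf (fun s => s ^ q) :=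
  isClassKInf_id.rpow hq

/-! ### Finite sums and powers -/

lemma exists_pos_le_of_finite {ι : Type*} [Finite ι] (g : ι → ℝ) (hg : ∀ i, 0 < g i) :
    ∃ c, 0 < c ∧ ∀ i, c ≤ g i := by
  cases isEmpty_or_nonempty ι
  · exact ⟨1, one_pos, fun i => isEmptyElim i⟩
  · obtain ⟨i, hi⟩ := Finite.exists_min g
    exact ⟨g i, hg i, hi⟩

lemma exists_ge_of_finite {ι : Type*} [Finite ι] (g : ι → ℝ) :
    ∃ c, 0 < c ∧ ∀ i, g i ≤ c := by
  cases isEmpty_or_nonempty ι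
  · exact ⟨1, one_pos, fun i => isEmptyElim i⟩
  · obtain ⟨i, hi⟩ := Finite.exists_max g
    exact ⟨max 1 (g i), by positivity, fun k => (hi k).trans (le_max_right _ _)⟩

/-- Bounding every summand by the largest one covers all exponents q > 0 at once, without a
distinction between convex and concave powers. -/
lemma sum_rpow_le {m : ℕ} (x : Fin m → ℝ) (hx : ∀ i, 0 ≤ x i) {q : ℝ} (hq : 0 < q) :
    (∑ i, x i) ^ q ≤ (m : ℝ) ^ q * ∑ i, x i ^ q := by
  cases isEmpty_or_nonempty (Fin m)
  · simp [Real.zero_rpow hq.ne']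
  · obtain ⟨i, hi⟩ := Finite.exists_max x
    have h1 : ∑ k, x k ≤ m * x i := by
      calc ∑ k, x k ≤ ∑ _k : Fin m, x i := Finset.sum_le_sum fun k _ => hi k
        _ = m * x i := by simp
    calc (∑ k, x k) ^ q ≤ (m * x i) ^ q :=
          Real.rpow_le_rpow (Finset.sum_nonneg fun k _ => hx k) h1 hq.le
      _ = (m : ℝ) ^ q * x i ^ q := Real.mul_rpow (Nat.cast_nonneg m) (hx i)
      _ ≤ _ := by
          gcongr
          exact Finset.single_le_sum (f := fun k => x k ^ q)
            (fun k _ => Real.rpow_nonneg (hx k) q) (Finset.mem_univ i)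

/-- A crude Young inequality, obtained by comparing w with δx instead of optimizing. The free δ
makes the coefficient of one term as small as desired. -/
lemma rpow_mul_rpow_le {x w δ p a : ℝ} (hx : 0 ≤ x) (hw : 0 ≤ w) (hδ : 0 < δ) (hp : 0 < p)
    (ha : 0 < a) :
    x ^ p * w ^ a ≤ δ ^ a * x ^ (p + a) + δ ^ (-p) * w ^ (p + a) := by
  have hx' := Real.rpow_nonneg hx (p + a)
  have hw' := Real.rpow_nonneg hw (p + a)
  rcases le_total w (δ * x) with h | h
  · have h1 : w ^ a ≤ δ ^ a * x ^ a := by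
      rw [← Real.mul_rpow hδ.le hx]
      exact Real.rpow_le_rpow hw h ha.le
    calc x ^ p * w ^ a ≤ x ^ p * (δ ^ a * x ^ a) := by gcongr
      _ = δ ^ a * x ^ (p + a) := by
          rw [Real.rpow_add' hx (by linarith)]; ring
      _ ≤ _ := by
          have : 0 ≤ δ ^ (-p) * w ^ (p + a) := by positivity
          linarith
  · have h1 : x ^ p ≤ δ ^ (-p) * w ^ p := by
      rw [Real.rpow_neg hδ.le, ← Real.inv_rpow hδ.le, ← Real.mul_rpow (by positivity) hw]
      apply Real.rpow_le_rpow hx _ hp.le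
      rw [← div_eq_inv_mul, le_div_iff₀ hδ]
      linarith
    calc x ^ p * w ^ a ≤ (δ ^ (-p) * w ^ p) * w ^ a := by gcongr
      _ = δ ^ (-p) * w ^ (p + a) := by
          rw [Real.rpow_add' hw (by linarith)]; ring
      _ ≤ _ := by
          have : 0 ≤ δ ^ a * x ^ (p + a) := by positivity
          linarith

/-! ### Differential inequalities -/

lemma le_of_hasDerivWithinAt_nonpos {f : ℝ → ℝ} {r s : ℝ} (hr : 0 ≤ r) (hrs : r ≤ s)
    (h : ∀ t ∈ Icc r s, ∃ f', HasDerivWithinAt f f' (Ici 0) t ∧ f' ≤ 0) : f s ≤ f r := by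
  have hsub : Icc r s ⊆ Ici 0 := fun t ht => hr.trans ht.1
  choose! f' h1 h2 using h
  have := antitoneOn_of_hasDerivWithinAt_nonpos (f := f) (f' := f') (convex_Icc r s)
    (fun t ht => (h1 t ht).continuousWithinAt.mono hsub)
    (fun t ht => (h1 t (interior_subset ht)).mono (interior_subset.trans hsub))
    (fun t ht => h2 t (interior_subset ht))
  exact this (left_mem_Icc.2 hrs) (right_mem_Icc.2 hrs) hrs

/-- The sum of the two antiderivatives V^(1-σ)/(1-σ) decreases at least at rate c, whichever power
realizes the minimum, so no switching time between the two regimes is needed. -/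
lemma eq_zero_of_finite_time_decay {V : ℝ → ℝ} {c σ₁ σ₂ T₀ t : ℝ} (hc : 0 < c) (h1 : σ₁ < 1)
    (h2 : σ₂ < 1) (hT₀ : 0 ≤ T₀) (hV : ∀ s, 0 ≤ V s)
    (hd : ∀ s, T₀ ≤ s → ∃ v', HasDerivWithinAt V v' (Ici 0) s ∧
      v' ≤ -(c * min (V s ^ σ₁) (V s ^ σ₂)))
    (ht : T₀ + (V T₀ ^ (1 - σ₁) / (1 - σ₁) + V T₀ ^ (1 - σ₂) / (1 - σ₂)) / c ≤ t) : V t = 0 := by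
  by_contra hne
  have hVt : 0 < V t := lt_of_le_of_ne (hV t) (Ne.symm hne)
  have h1' : 0 < 1 - σ₁ := by linarith
  have h2' : 0 < 1 - σ₂ := by linarith
  have hg0 : 0 ≤ (V T₀ ^ (1 - σ₁) / (1 - σ₁) + V T₀ ^ (1 - σ₂) / (1 - σ₂)) / c := by
    have := Real.rpow_nonneg (hV T₀) (1 - σ₁)
    have := Real.rpow_nonneg (hV T₀) (1 - σ₂)
    positivity
  have hTt : T₀ ≤ t := by linarith
  -- V is nonincreasing, so positivity at `t` propagates backwards. This makes the powers of V below
  -- differentiable.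
  have hpos : ∀ s ∈ Icc T₀ t, 0 < V s := by
    intro s hs
    refine hVt.trans_le (le_of_hasDerivWithinAt_nonpos (hT₀.trans hs.1) hs.2 fun u hu => ?_)
    obtain ⟨v', hv, hle⟩ := hd u (hs.1.trans hu.1)
    refine ⟨v', hv, hle.trans ?_⟩
    have : 0 ≤ min (V u ^ σ₁) (V u ^ σ₂) :=
      le_min (Real.rpow_nonneg (hV u) _) (Real.rpow_nonneg (hV u) _)
    have := mul_nonneg hc.le this
    linarith
  have key := le_of_hasDerivWithinAt_nonpos (r := T₀) (s := t)
    (f := fun s => V s ^ (1 - σ₁) / (1 - σ₁) + V s ^ (1 - σ₂) / (1 - σ₂) + c * s) hT₀ hTt ?_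
  · have e1 : 0 < V t ^ (1 - σ₁) / (1 - σ₁) := div_pos (Real.rpow_pos_of_pos hVt _) h1'
    have e2 : 0 < V t ^ (1 - σ₂) / (1 - σ₂) := div_pos (Real.rpow_pos_of_pos hVt _) h2'
    have e3 : (V T₀ ^ (1 - σ₁) / (1 - σ₁) + V T₀ ^ (1 - σ₂) / (1 - σ₂)) ≤ c * (t - T₀) := by
      rw [mul_comm, ← div_le_iff₀ hc]; linarith
    linarith
  · intro s hs
    obtain ⟨v', hv, hle⟩ := hd s hs.1
    have hp := hpos s hs
    have d1 : HasDerivWithinAt (fun s => V s ^ (1 - σ₁) / (1 - σ₁)) (v' * V s ^ (-σ₁)) (Ici 0) s := by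
      convert! (hv.rpow_const (p := 1 - σ₁) (Or.inl hp.ne')).div_const (1 - σ₁) using 1
      rw [show 1 - σ₁ - 1 = -σ₁ by ring]
      field_simp
    have d2 : HasDerivWithinAt (fun s => V s ^ (1 - σ₂) / (1 - σ₂)) (v' * V s ^ (-σ₂)) (Ici 0) s := by
      convert! (hv.rpow_const (p := 1 - σ₂) (Or.inl hp.ne')).div_const (1 - σ₂) using 1
      rw [show 1 - σ₂ - 1 = -σ₂ by ring]
      field_simp
    refine ⟨_, (d1.add d2).add ((hasDerivWithinAt_id s _).const_mul c), ?_⟩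
    have p1 := Real.rpow_pos_of_pos hp σ₁
    have p2 := Real.rpow_pos_of_pos hp σ₂
    have i1 : V s ^ (-σ₁) = (V s ^ σ₁)⁻¹ := Real.rpow_neg hp.le _
    have i2 : V s ^ (-σ₂) = (V s ^ σ₂)⁻¹ := Real.rpow_neg hp.le _
    rw [i1, i2, mul_one, ← mul_add]
    -- The smaller power times its own inverse is already 1; the other inverse only adds.
    have hm : 1 ≤ min (V s ^ σ₁) (V s ^ σ₂) * ((V s ^ σ₁)⁻¹ + (V s ^ σ₂)⁻¹) := by
      rcases le_total (V s ^ σ₁) (V s ^ σ₂) with h | h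
      · rw [min_eq_left h, mul_add, mul_inv_cancel₀ p1.ne']
        have : 0 ≤ V s ^ σ₁ * (V s ^ σ₂)⁻¹ := by positivity
        linarith
      · rw [min_eq_right h, mul_add, mul_inv_cancel₀ p2.ne']
        have : 0 ≤ V s ^ σ₂ * (V s ^ σ₁)⁻¹ := by positivity
        linarith
    have hs' : 0 ≤ (V s ^ σ₁)⁻¹ + (V s ^ σ₂)⁻¹ := by positivity
    have := mul_le_mul_of_nonneg_right hle hs'
    nlinarith

/-! ### Euclidean vectors -/

lemma dotProduct_self_eq {m : ℕ} (u : Vec m) : u.ofLp ⬝ᵥ u.ofLp = ‖u‖ ^ 2 := by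
  rw [EuclideanSpace.real_norm_sq_eq, dotProduct]
  exact Finset.sum_congr rfl fun i _ => by ring

lemma norm_toLp_le_of_abs_le {m : ℕ} {u v : Fin m → ℝ} (h : ∀ i, |u i| ≤ |v i|) :
    ‖(WithLp.toLp 2 u : Vec m)‖ ≤ ‖(WithLp.toLp 2 v : Vec m)‖ := by
  rw [EuclideanSpace.norm_eq, EuclideanSpace.norm_eq]
  apply Real.sqrt_le_sqrt
  apply Finset.sum_le_sum
  intro i _
  simpa using sq_le_sq.2 (by simpa using h i)

lemma norm_toLp_le_sum {m : ℕ} (u : Fin m → ℝ) :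
    ‖(WithLp.toLp 2 u : Vec m)‖ ≤ ∑ i, |u i| := by
  rw [EuclideanSpace.norm_eq]
  apply Real.sqrt_le_iff.2 ⟨Finset.sum_nonneg fun i _ => abs_nonneg _, ?_⟩
  have := Finset.sum_sq_le_sq_sum_of_nonneg (s := Finset.univ) (f := fun i => |u i|)
    (fun i _ => abs_nonneg _)
  simpa using this

lemma norm_toLp_le_sqrt {m : ℕ} {u : Fin m → ℝ} (h : ∀ i, |u i| ≤ 1) :
    ‖(WithLp.toLp 2 u : Vec m)‖ ≤ Real.sqrt m := by
  rw [EuclideanSpace.norm_eq]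
  apply Real.sqrt_le_sqrt
  calc ∑ i, ‖(WithLp.toLp 2 u : Vec m) i‖ ^ 2 ≤ ∑ _i : Fin m, (1 : ℝ) := by
        apply Finset.sum_le_sum
        intro i _
        have : ‖u i‖ ≤ 1 := h i
        exact pow_le_one₀ (norm_nonneg _) this
    _ = m := by simp

lemma abs_apply_le_norm {m : ℕ} (u : Vec m) (i : Fin m) : |u i| ≤ ‖u‖ := by
  simpa using PiLp.norm_apply_le u i

lemma specNorm_dotProduct_le {κ : Type} [Fintype κ] [DecidableEq κ] (A : Matrix κ κ ℝ)
    (u v : EuclideanSpace ℝ κ) :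
    |u.ofLp ⬝ᵥ (A *ᵥ v.ofLp)| ≤ specNorm A * ‖u‖ * ‖v‖ := by
  rw [← Matrix.inner_toEuclideanCLM]
  calc _ ≤ ‖u‖ * ‖Matrix.toEuclideanCLM (𝕜 := ℝ) A v‖ := abs_real_inner_le_norm _ _
    _ ≤ ‖u‖ * (‖Matrix.toEuclideanCLM (𝕜 := ℝ) A‖ * ‖v‖) := by
        gcongr
        exact ContinuousLinearMap.le_opNorm _ _
    _ = _ := by rw [specNorm]; ring

lemma hasDerivWithinAt_apply {m : ℕ} {f : ℝ → Vec m} {f' : Vec m} {s : Set ℝ} {t : ℝ}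
    (h : HasDerivWithinAt f f' s t) (i : Fin m) :
    HasDerivWithinAt (fun r => f r i) (f' i) s t :=
  (EuclideanSpace.proj (𝕜 := ℝ) i).hasFDerivAt.comp_hasDerivWithinAt t h

/-! ### Properties of the plant -/

namespace Plant

variable {n k j : ℕ} {S : Plant n k j} {μm μM Lc : ℝ}

lemma Standing.dotProduct_inertia_comm (hS : S.Standing μm μM Lc) (q : Vec n) (u v : Fin n → ℝ) :
    u ⬝ᵥ (S.inertia q *ᵥ v) = v ⬝ᵥ (S.inertia q *ᵥ u) := by
  rw [Matrix.dotProduct_mulVec, ← Matrix.mulVec_transpose, (hS.symm q).eq, dotProduct_comm]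

/-- Cauchy-Schwarz for the form defined by M(q), so that the upper bound is needed on the diagonal
only. -/
lemma Standing.abs_dotProduct_inertia_le (hS : S.Standing μm μM Lc) (q u v : Vec n) :
    |u.ofLp ⬝ᵥ (S.inertia q *ᵥ v.ofLp)| ≤ μM * ‖u‖ * ‖v‖ := by
  have key := LinearMap.BilinForm.apply_sq_le_of_symm (Matrix.toLinearMap₂' ℝ (S.inertia q))
    (fun x => by
      rw [Matrix.toLinearMap₂'_apply']
      exact le_trans (mul_nonneg hS.μm_pos.le (sq_nonneg _)) (hS.lower q (WithLp.toLp 2 x)))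
    ⟨fun x y => by
      rw [Matrix.toLinearMap₂'_apply', Matrix.toLinearMap₂'_apply']
      exact hS.dotProduct_inertia_comm q x y⟩ u.ofLp v.ofLp
  simp only [Matrix.toLinearMap₂'_apply'] at key
  have hM := hS.μM_pos
  apply abs_le_of_sq_le_sq _ (by positivity)
  have h1 := hS.upper q u
  have h2 := hS.upper q v
  have h3 := (mul_nonneg hS.μm_pos.le (sq_nonneg _)).trans (hS.lower q v)
  calc _ ≤ _ := key
    _ ≤ (μM * ‖u‖ ^ 2) * (μM * ‖v‖ ^ 2) := by gcongr
    _ = _ := by ring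

lemma Standing.norm_inertia_mulVec_le (hS : S.Standing μm μM Lc) (q v : Vec n) :
    ‖(WithLp.toLp 2 (S.inertia q *ᵥ v.ofLp) : Vec n)‖ ≤ μM * ‖v‖ := by
  set w : Vec n := WithLp.toLp 2 (S.inertia q *ᵥ v.ofLp) with hw
  have h := (le_abs_self _).trans (hS.abs_dotProduct_inertia_le q w v)
  have h2 : w.ofLp ⬝ᵥ (S.inertia q *ᵥ v.ofLp) = ‖w‖ ^ 2 := dotProduct_self_eq w
  rw [h2] at h
  rcases (norm_nonneg w).eq_or_lt with h0 | h0
  · rw [← h0]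
    exact mul_nonneg hS.μM_pos.le (norm_nonneg v)
  · nlinarith

lemma Standing.inertia_mul_inv (hS : S.Standing μm μM Lc) (q : Vec n) :
    S.inertia q * (S.inertia q)⁻¹ = 1 := by
  apply Matrix.mul_nonsing_inv
  rw [isUnit_iff_ne_zero]
  intro h0
  obtain ⟨v, hv, hMv⟩ := Matrix.exists_mulVec_eq_zero_iff.2 h0
  have h := hS.lower q (WithLp.toLp 2 v)
  rw [hMv, dotProduct_zero] at h
  have h1 : 0 < ‖(WithLp.toLp 2 v : Vec n)‖ := norm_pos_iff.2 fun h => hv (by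
    simpa using congrArg WithLp.ofLp h)
  have := mul_pos hS.μm_pos (pow_pos h1 2)
  linarith

lemma coriolis_zero (q : Vec n) : S.coriolis q 0 = 0 := by
  ext a b
  simp [coriolis]

lemma Standing.abs_coriolis_dotProduct_le (hS : S.Standing μm μM Lc) (q u v w : Vec n) :
    |(S.coriolis q v *ᵥ u.ofLp) ⬝ᵥ w.ofLp| ≤ Lc * ‖v‖ * ‖u‖ * ‖w‖ := by
  have h := hS.lip q v 0
  rw [coriolis_zero, sub_zero, sub_zero] at h
  rw [dotProduct_comm]
  calc _ ≤ specNorm (S.coriolis q v) * ‖w‖ * ‖u‖ := specNorm_dotProduct_le _ _ _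
    _ ≤ (Lc * ‖v‖) * ‖w‖ * ‖u‖ := by gcongr
    _ = _ := by ring

lemma Standing.exists_abs_Ψ_le (hS : S.Standing μm μM Lc) :
    ∃ B, 0 < B ∧ ∀ (q : Vec n) (θ : Vec j) (i : Fin n), |(S.Ψ q *ᵥ θ.ofLp) i| ≤ B * ‖θ‖ := by
  obtain ⟨B, hB⟩ := hS.bounded_gradU
  refine ⟨j * |B| + 1, by positivity, fun q θ i => ?_⟩
  calc |(S.Ψ q *ᵥ θ.ofLp) i| ≤ ∑ c, |S.Ψ q i c * θ c| := Finset.abs_sum_le_sum_abs (fun c => S.Ψ q i c * θ c) Finset.univ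
    _ ≤ ∑ _c : Fin j, |B| * ‖θ‖ := by
        apply Finset.sum_le_sum
        intro c _
        rw [abs_mul]
        exact mul_le_mul ((abs_apply_le_norm _ i).trans ((hB c q).trans (le_abs_self B)))
          (abs_apply_le_norm θ c) (abs_nonneg _) (abs_nonneg _)
    _ = j * |B| * ‖θ‖ := by simp; ring
    _ ≤ _ := by
        have := norm_nonneg θ
        nlinarith

lemma Standing.contDiff_inertia (hS : S.Standing μm μM Lc) (a b : Fin n) :
    ContDiff ℝ ∞ (fun q => S.inertia q a b) := by
  simp only [inertia, Matrix.sum_apply, Matrix.smul_apply, smul_eq_mul]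
  exact ContDiff.sum fun i _ => contDiff_const.mul (hS.smooth_M i a b)

lemma Standing.dInertia_symm (hS : S.Standing μm μM Lc) (q : Vec n) (i a b : Fin n) :
    S.dInertia q i a b = S.dInertia q i b a := by
  have : (fun q' => S.inertia q' a b) = fun q' => S.inertia q' b a := by
    funext q'
    exact (hS.symm q').apply b a
  rw [dInertia, dInertia, this]

/-- This is Ṁ = C + Cᵀ: in the sum of the two Christoffel expressions the last two terms cancel by
the symmetry of M. -/
lemma Standing.sum_dInertia_eq (hS : S.Standing μm μM Lc) (q v : Vec n) (a b : Fin n) :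
    ∑ i, S.dInertia q i a b * v i = S.coriolis q v a b + S.coriolis q v b a := by
  rw [coriolis, coriolis, ← Finset.sum_add_distrib]
  apply Finset.sum_congr rfl
  intro i _
  rw [hS.dInertia_symm q i b a, hS.dInertia_symm q b i a, hS.dInertia_symm q a i b]
  ring

lemma fderiv_eq_sum {f : Vec n → ℝ} (q v : Vec n) :
    fderiv ℝ f q v = ∑ i, fderiv ℝ f q (EuclideanSpace.single i 1) * v i := by
  have hv : v = ∑ i, v i • (EuclideanSpace.single i (1 : ℝ) : Vec n) := by
    ext a
    simp [Finset.sum_apply, Pi.single_apply]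
  conv_lhs => rw [hv, map_sum]
  exact Finset.sum_congr rfl fun i _ => by rw [map_smul, smul_eq_mul, mul_comm]

lemma Standing.hasDerivWithinAt_inertia (hS : S.Standing μm μM Lc) {q : ℝ → Vec n} {v : Vec n}
    {s : Set ℝ} {t : ℝ} (hq : HasDerivWithinAt q v s t) (a b : Fin n) :
    HasDerivWithinAt (fun r => S.inertia (q r) a b)
      (S.coriolis (q t) v a b + S.coriolis (q t) v b a) s t := by
  rw [← hS.sum_dInertia_eq]
  have hd := ((hS.contDiff_inertia a b).differentiable (by simp)).differentiableAt (x := q t)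
  have := hd.hasFDerivAt.comp_hasDerivWithinAt t hq
  rw [fderiv_eq_sum] at this
  exact this

end Plant

/-! ### Forces -/

section Forces

variable {n k j : ℕ} (S : Plant n k j) (G : PDGains n) (qd : Vec n)

/-- The forces other than the Coriolis force in the velocity equation. -/
noncomputable def force (e₁ e₂ : Vec n) (θ : Vec j) : Fin n → ℝ := fun i =>
  -(G.P i * spow (e₁ i) G.a) - G.D i * spow (e₂ i) G.b - G.DL i * e₂ i
    + (S.Ψ (e₁ + qd) *ᵥ θ.ofLp) i

variable {S} {μm μM Lc : ℝ}

lemma inertia_mulVec_velField (hS : S.Standing μm μM Lc) (e₁ e₂ : Vec n) (θ : Vec j) :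
    S.inertia (e₁ + qd) *ᵥ (velField S G qd e₁ e₂ θ).ofLp
      = force S G qd e₁ e₂ θ - S.coriolis (e₁ + qd) e₂ *ᵥ e₂.ofLp := by
  rw [velField]
  simp only [Matrix.mulVec_mulVec, hS.inertia_mul_inv, Matrix.one_mulVec]
  funext i
  simp only [force, Pi.add_apply, Pi.sub_apply, Pi.neg_apply, Matrix.mulVec_diagonal, vspow]
  ring

/-- The term uᵀṀe₂ = uᵀ(C + Cᵀ)e₂ cancels the Coriolis force -uᵀCe₂ and leaves (Cu)ᵀe₂. The formula
serves three test vectors u: e₂ for the kinetic energy, tanh e₁ for the cross term of V₁, and ⌈e₁⌋^p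
for that of V_FT. -/
lemma hasDerivWithinAt_dotProduct_inertia (hS : S.Standing μm μM Lc) {e₁ e₂ : ℝ → Vec n}
    {θ : Vec j} {s : Set ℝ} {t : ℝ} {u : ℝ → Fin n → ℝ} {u' : Fin n → ℝ}
    (h₁ : HasDerivWithinAt e₁ (e₂ t) s t)
    (h₂ : HasDerivWithinAt e₂ (velField S G qd (e₁ t) (e₂ t) θ) s t)
    (hu : ∀ i, HasDerivWithinAt (fun r => u r i) (u' i) s t) :
    HasDerivWithinAt (fun r => u r ⬝ᵥ (S.inertia (e₁ r + qd) *ᵥ (e₂ r).ofLp))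
      (u' ⬝ᵥ (S.inertia (e₁ t + qd) *ᵥ (e₂ t).ofLp)
        + (S.coriolis (e₁ t + qd) (e₂ t) *ᵥ u t) ⬝ᵥ (e₂ t).ofLp
        + u t ⬝ᵥ force S G qd (e₁ t) (e₂ t) θ) s t := by
  have hM := fun a b => hS.hasDerivWithinAt_inertia (h₁.add_const qd) a b
  have h₂' := fun i => hasDerivWithinAt_apply h₂ i
  have key := HasDerivWithinAt.fun_sum (u := Finset.univ) fun a _ =>
    (hu a).fun_mul (HasDerivWithinAt.fun_sum (u := Finset.univ) fun b _ => (hM a b).fun_mul (h₂' b))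
  convert! key using 1
  have hv := inertia_mulVec_velField G qd hS (e₁ t) (e₂ t) θ
  have hf : force S G qd (e₁ t) (e₂ t) θ
      = S.inertia (e₁ t + qd) *ᵥ (velField S G qd (e₁ t) (e₂ t) θ).ofLp
        + S.coriolis (e₁ t + qd) (e₂ t) *ᵥ (e₂ t).ofLp := by rw [hv]; abel
  rw [hf]
  have hc : (S.coriolis (e₁ t + qd) (e₂ t) *ᵥ u t) ⬝ᵥ (e₂ t).ofLp
      = ∑ a, ∑ b, u t a * (S.coriolis (e₁ t + qd) (e₂ t) b a * e₂ t b) := by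
    rw [Finset.sum_comm]
    simp only [dotProduct, Matrix.mulVec, Finset.sum_mul]
    exact Finset.sum_congr rfl fun i _ => Finset.sum_congr rfl fun l _ => by ring
  rw [hc]
  simp only [dotProduct, Matrix.mulVec, ← Finset.sum_add_distrib, Pi.add_apply, Finset.mul_sum]
  refine Finset.sum_congr rfl fun a _ => Finset.sum_congr rfl fun b _ => ?_
  ring

end Forces

/-! ### Exponents -/

namespace PDGains

variable {n : ℕ} (G : PDGains n)

/-- The exponent `2r₂/r₁ = 1 + a` of the potential energy of the controller. -/
noncomputable def pw : ℝ := 2 * G.r₂ / G.r₁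

lemma r₁_pos : 0 < G.r₁ := G.r₂_pos.trans G.r₂_lt

lemma one_lt_pw : 1 < G.pw := by
  rw [pw, one_lt_div G.r₁_pos]; exact G.r₁_lt

lemma pw_lt_two : G.pw < 2 := by
  rw [pw, div_lt_iff₀ G.r₁_pos]; linarith [G.r₂_lt]

lemma pw_pos : 0 < G.pw := zero_lt_one.trans G.one_lt_pw

lemma a_eq : G.a = G.pw - 1 := by
  have := G.r₁_pos.ne'
  rw [a, pw]; field_simp

lemma a_pos : 0 < G.a := by rw [a_eq]; linarith [G.one_lt_pw]

lemma b_pos : 0 < G.b := div_pos (by linarith [G.r₁_lt]) G.r₂_pos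

lemma b_lt_one : G.b < 1 := by
  rw [b, div_lt_one G.r₂_pos]; linarith [G.r₂_lt]

/-- The compatibility of the weights behind all homogeneity counts: |e₁ᵢ|^a is at most N^(a/p) =
N^(b/2). -/
lemma b_mul_pw : G.b * G.pw = 2 * G.a := by
  have := G.r₁_pos.ne'
  have := G.r₂_pos.ne'
  rw [a, b, pw]; field_simp

lemma a_le_b : G.a ≤ G.b := by
  have h1 := G.b_mul_pw
  have h2 := G.pw_lt_two
  have h3 := G.b_pos
  nlinarith

lemma inv_pw : G.r₁ / (2 * G.r₂) = G.pw⁻¹ := by rw [pw, inv_div]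

end PDGains

/-! ### The function `V₁` -/

section

variable {n k j : ℕ} (S : Plant n k j) (G : PDGains n) (A : AdaptGains j) (qd : Vec n)

/-- The vector `tanh v`. -/
noncomputable def vtanh {m : ℕ} (v : Vec m) : Vec m := WithLp.toLp 2 fun i => Real.tanh (v i)

/-- A measure of the size of the state that is homogeneous for the weights `r₁` and `r₂`. -/
noncomputable def homSize (e₁ e₂ : Vec n) (θ : Vec j) : ℝ :=
  ∑ i, |e₁ i| ^ G.pw + ‖e₂‖ ^ 2 + ‖θ‖ ^ 2

/-- The terms that bound the decay of `V₁`. -/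
noncomputable def dissipation (ζ : ℝ) (e₁ e₂ : Vec n) (θ : Vec j) : ℝ :=
  ∑ i, |e₂ i| ^ (1 + G.b) + ‖e₂‖ ^ 2 + ∑ i, |Real.tanh (e₁ i)| * |e₁ i| ^ G.a
    + ζ * ∑ c, |θ c| ^ (1 + G.b)

variable {S} {μm μM Lc : ℝ}

lemma homSize_nonneg (e₁ e₂ : Vec n) (θ : Vec j) : 0 ≤ homSize G e₁ e₂ θ := by
  rw [homSize]; positivity

lemma dissipation_nonneg {ζ : ℝ} (hζ : 0 ≤ ζ) (e₁ e₂ : Vec n) (θ : Vec j) :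
    0 ≤ dissipation G ζ e₁ e₂ θ := by
  rw [dissipation]; positivity

lemma V0_eq (e₁ e₂ : Vec n) : V0 S G qd e₁ e₂ = G.pw⁻¹ * ∑ i, G.P i * |e₁ i| ^ G.pw
    + 1 / 2 * (e₂.ofLp ⬝ᵥ (S.inertia (e₁ + qd) *ᵥ e₂.ofLp)) := by
  rw [V0, G.inv_pw]
  congr 2
  refine Finset.sum_congr rfl fun i _ => ?_
  rw [Matrix.mulVec_diagonal, vspow]
  have := self_mul_spow (e₁ i) G.a G.a_pos.le
  rw [show 1 + G.a = G.pw by rw [G.a_eq]; ring] at this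
  rw [← this]; ring

lemma V1_eq (e₁ e₂ : Vec n) (θ : Vec j) : V1 S G A qd e₁ e₂ θ =
    (A.γ₁ + A.γ₂) * (G.pw⁻¹ * ∑ i, G.P i * |e₁ i| ^ G.pw
      + 1 / 2 * (e₂.ofLp ⬝ᵥ (S.inertia (e₁ + qd) *ᵥ e₂.ofLp)))
    + A.γ₁ * A.d₁ * ((vtanh e₁).ofLp ⬝ᵥ (S.inertia (e₁ + qd) *ᵥ e₂.ofLp))
    + A.γ₁ * A.d₁ * ∑ i, G.DL i * Real.log (Real.cosh (e₁ i))
    + (1 / 2 : ℝ) * ∑ c, (A.Γ c)⁻¹ * θ c ^ 2 := by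
  rw [V1, V0_eq, vtanh]

/-- The cross term is bounded below by completing a square componentwise; the cost is at most
(μm/2)‖e₂‖² by the bound on d₁. The γ₁ share of the kinetic energy pays for it, and the γ₂ share
survives. -/
lemma exists_mul_homSize_le_V1 (hS : S.Standing μm μM Lc)
    (hd : ∀ i, A.d₁ ≤ G.DL i * μm / μM ^ 2) :
    ∃ c, 0 < c ∧ ∀ e₁ e₂ θ, c * homSize G e₁ e₂ θ ≤ V1 S G A qd e₁ e₂ θ := by
  have hγ₁ := A.γ₁_pos
  have hγ₂ := A.γ₂_pos
  have hμ := hS.μm_pos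
  obtain ⟨cP, hcP, hP⟩ := exists_pos_le_of_finite G.P G.P_pos
  obtain ⟨cΓ, hcΓ, hΓ⟩ := exists_pos_le_of_finite (fun c => (A.Γ c)⁻¹)
    (fun c => inv_pos.2 (A.Γ_pos c))
  have hpw := G.pw_pos
  refine ⟨min ((A.γ₁ + A.γ₂) * (G.pw⁻¹ * cP)) (min (A.γ₂ * μm / 2) (cΓ / 2)), by positivity,
    fun e₁ e₂ θ => ?_⟩
  set c := min ((A.γ₁ + A.γ₂) * (G.pw⁻¹ * cP)) (min (A.γ₂ * μm / 2) (cΓ / 2)) with hc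
  have c1 : c ≤ (A.γ₁ + A.γ₂) * (G.pw⁻¹ * cP) := min_le_left _ _
  have c2 : c ≤ A.γ₂ * μm / 2 := (min_le_right _ _).trans (min_le_left _ _)
  have c3 : c ≤ cΓ / 2 := (min_le_right _ _).trans (min_le_right _ _)
  rw [V1_eq, homSize]
  have hE : cP * ∑ i, |e₁ i| ^ G.pw ≤ ∑ i, G.P i * |e₁ i| ^ G.pw := by
    rw [Finset.mul_sum]
    exact Finset.sum_le_sum fun i _ =>
      mul_le_mul_of_nonneg_right (hP i) (Real.rpow_nonneg (abs_nonneg _) _)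
  have hE0 : 0 ≤ ∑ i, |e₁ i| ^ G.pw := by positivity
  have hΘ : cΓ * ‖θ‖ ^ 2 ≤ ∑ c, (A.Γ c)⁻¹ * θ c ^ 2 := by
    rw [EuclideanSpace.real_norm_sq_eq, Finset.mul_sum]
    exact Finset.sum_le_sum fun i _ => mul_le_mul_of_nonneg_right (hΓ i) (sq_nonneg _)
  have hK := hS.lower (e₁ + qd) e₂
  set w : Vec n := WithLp.toLp 2 (S.inertia (e₁ + qd) *ᵥ e₂.ofLp) with hw
  have hwn := hS.norm_inertia_mulVec_le (e₁ + qd) e₂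
  rw [← hw] at hwn
  have hcross : -(μm / 2 * ‖e₂‖ ^ 2) ≤ A.d₁ * ((vtanh e₁).ofLp ⬝ᵥ (S.inertia (e₁ + qd) *ᵥ e₂.ofLp))
      + A.d₁ * ∑ i, G.DL i * Real.log (Real.cosh (e₁ i)) := by
    have h1 : -(μm / (2 * μM ^ 2) * ‖w‖ ^ 2) ≤
        A.d₁ * ((vtanh e₁).ofLp ⬝ᵥ (S.inertia (e₁ + qd) *ᵥ e₂.ofLp))
        + A.d₁ * ∑ i, G.DL i * Real.log (Real.cosh (e₁ i)) := by
      rw [EuclideanSpace.real_norm_sq_eq, dotProduct, Finset.mul_sum, Finset.mul_sum,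
        Finset.mul_sum, ← Finset.sum_add_distrib, ← Finset.sum_neg_distrib]
      refine Finset.sum_le_sum fun i _ => ?_
      change -(μm / (2 * μM ^ 2) * (w i) ^ 2) ≤ A.d₁ * (Real.tanh (e₁ i) * w i) + _
      have hDL := G.DL_pos i
      have t1 := tanh_sq_le_two_mul_log_cosh (e₁ i)
      have t2 : A.d₁ / (2 * G.DL i) ≤ μm / (2 * μM ^ 2) := by
        have hM := hS.μM_pos
        have := hd i
        rw [le_div_iff₀ (by positivity)] at this
        rw [div_le_div_iff₀ (by positivity) (by positivity)]
        nlinarith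
      have t3 : A.d₁ / (2 * G.DL i) * w i ^ 2 ≤ μm / (2 * μM ^ 2) * w i ^ 2 := by gcongr
      have hd₁ := A.d₁_pos
      -- The completed square in tanh e₁ᵢ and (M e₂)ᵢ, with half of tanh² available from ln cosh.
      have t4 : A.d₁ * (Real.tanh (e₁ i) * w i) + A.d₁ * (G.DL i * (Real.tanh (e₁ i) ^ 2 / 2))
          + A.d₁ / (2 * G.DL i) * w i ^ 2
          = A.d₁ / (2 * G.DL i) * (G.DL i * Real.tanh (e₁ i) + w i) ^ 2 := by
        field_simp; ring
      have t5 : 0 ≤ A.d₁ / (2 * G.DL i) * (G.DL i * Real.tanh (e₁ i) + w i) ^ 2 := by positivity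
      have t6 : A.d₁ * (G.DL i * (Real.tanh (e₁ i) ^ 2 / 2)) ≤
          A.d₁ * (G.DL i * Real.log (Real.cosh (e₁ i))) := by
        gcongr; linarith
      linarith
    have h2 : μm / (2 * μM ^ 2) * ‖w‖ ^ 2 ≤ μm / 2 * ‖e₂‖ ^ 2 := by
      have hM := hS.μM_pos
      calc μm / (2 * μM ^ 2) * ‖w‖ ^ 2 ≤ μm / (2 * μM ^ 2) * (μM * ‖e₂‖) ^ 2 := by gcongr
        _ = _ := by field_simp
    linarith
  have hcross' := mul_le_mul_of_nonneg_left hcross hγ₁.le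
  have hE' := mul_le_mul_of_nonneg_left hE (show 0 ≤ (A.γ₁ + A.γ₂) * G.pw⁻¹ by positivity)
  have hK' := mul_le_mul_of_nonneg_left hK (show 0 ≤ (A.γ₁ + A.γ₂) * (1 / 2) by positivity)
  have f1 := mul_le_mul_of_nonneg_right c1 hE0
  have f2 := mul_le_mul_of_nonneg_right c2 (sq_nonneg ‖e₂‖)
  have f3 := mul_le_mul_of_nonneg_right c3 (sq_nonneg ‖θ‖)
  nlinarith

lemma sum_log_cosh_le (e₁ : Vec n) :
    ∑ i, Real.log (Real.cosh (e₁ i)) ≤ ∑ i, |e₁ i| ^ G.pw :=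
  Finset.sum_le_sum fun _ _ => log_cosh_le_abs_rpow _ G.one_lt_pw.le G.pw_lt_two.le

lemma norm_vtanh_sq_le (e₁ : Vec n) : ‖vtanh e₁‖ ^ 2 ≤ 2 * ∑ i, |e₁ i| ^ G.pw := by
  refine le_trans ?_ (mul_le_mul_of_nonneg_left (sum_log_cosh_le G e₁) zero_le_two)
  rw [EuclideanSpace.real_norm_sq_eq, Finset.mul_sum]
  exact Finset.sum_le_sum fun i _ => tanh_sq_le_two_mul_log_cosh _

lemma exists_V1_le_mul_homSize (hS : S.Standing μm μM Lc) :
    ∃ C, 0 < C ∧ ∀ e₁ e₂ θ, V1 S G A qd e₁ e₂ θ ≤ C * homSize G e₁ e₂ θ := by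
  have hγ₁ := A.γ₁_pos
  have hγ₂ := A.γ₂_pos
  have hd₁ := A.d₁_pos
  have hμM := hS.μM_pos
  obtain ⟨cP, hcP, hP⟩ := exists_ge_of_finite G.P
  obtain ⟨cD, hcD, hD⟩ := exists_ge_of_finite G.DL
  obtain ⟨cΓ, hcΓ, hΓ⟩ := exists_ge_of_finite (fun c => (A.Γ c)⁻¹)
  have hpw := G.pw_pos
  refine ⟨(A.γ₁ + A.γ₂) * (G.pw⁻¹ * cP + μM) + A.γ₁ * A.d₁ * (μM + cD) + cΓ, by positivity,
    fun e₁ e₂ θ => ?_⟩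
  rw [V1_eq, homSize]
  have hE : ∑ i, G.P i * |e₁ i| ^ G.pw ≤ cP * ∑ i, |e₁ i| ^ G.pw := by
    rw [Finset.mul_sum]
    exact Finset.sum_le_sum fun i _ =>
      mul_le_mul_of_nonneg_right (hP i) (Real.rpow_nonneg (abs_nonneg _) _)
  have hL : ∑ i, G.DL i * Real.log (Real.cosh (e₁ i)) ≤ cD * ∑ i, |e₁ i| ^ G.pw := by
    refine le_trans ?_ (mul_le_mul_of_nonneg_left (sum_log_cosh_le G e₁) hcD.le)
    rw [Finset.mul_sum]
    exact Finset.sum_le_sum fun i _ => mul_le_mul_of_nonneg_right (hD i) (log_cosh_nonneg _)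
  have hE0 : 0 ≤ ∑ i, |e₁ i| ^ G.pw := by positivity
  have hΘ : ∑ c, (A.Γ c)⁻¹ * θ c ^ 2 ≤ cΓ * ‖θ‖ ^ 2 := by
    rw [EuclideanSpace.real_norm_sq_eq, Finset.mul_sum]
    exact Finset.sum_le_sum fun i _ => mul_le_mul_of_nonneg_right (hΓ i) (sq_nonneg _)
  have hK := hS.upper (e₁ + qd) e₂
  have hX := (le_abs_self _).trans (hS.abs_dotProduct_inertia_le (e₁ + qd) (vtanh e₁) e₂)
  have hX' : μM * ‖vtanh e₁‖ * ‖e₂‖ ≤ μM * (∑ i, |e₁ i| ^ G.pw + ‖e₂‖ ^ 2) := by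
    have := norm_vtanh_sq_le G e₁
    rw [mul_assoc]
    gcongr
    nlinarith [sq_nonneg (‖vtanh e₁‖ - ‖e₂‖)]
  have g1 := mul_le_mul_of_nonneg_left hE (show 0 ≤ (A.γ₁ + A.γ₂) * G.pw⁻¹ by positivity)
  have g2 := mul_le_mul_of_nonneg_left hK (show 0 ≤ (A.γ₁ + A.γ₂) * (1 / 2) by positivity)
  have g3 := mul_le_mul_of_nonneg_left (hX.trans hX') (show 0 ≤ A.γ₁ * A.d₁ by positivity)
  have g4 := mul_le_mul_of_nonneg_left hL (show 0 ≤ A.γ₁ * A.d₁ by positivity)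
  set E := ∑ i, |e₁ i| ^ G.pw
  have q1 : 0 ≤ (A.γ₁ + A.γ₂) * (G.pw⁻¹ * cP) * (‖e₂‖ ^ 2 + ‖θ‖ ^ 2) := by positivity
  have q2 : 0 ≤ (A.γ₁ + A.γ₂) * μM * (E + ‖e₂‖ ^ 2 / 2 + ‖θ‖ ^ 2) := by positivity
  have q3 : 0 ≤ A.γ₁ * A.d₁ * μM * ‖θ‖ ^ 2 := by positivity
  have q4 : 0 ≤ A.γ₁ * A.d₁ * cD * (‖e₂‖ ^ 2 + ‖θ‖ ^ 2) := by positivity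
  have q5 : 0 ≤ cΓ * (E + ‖e₂‖ ^ 2 + ‖θ‖ ^ 2 / 2) := by positivity
  linarith

/-! ### The derivative of `V₁` -/

lemma dotProduct_force (u : Fin n → ℝ) (e₁ e₂ : Vec n) (θ : Vec j) :
    u ⬝ᵥ force S G qd e₁ e₂ θ = -(∑ i, G.P i * (u i * spow (e₁ i) G.a))
      - ∑ i, G.D i * (u i * spow (e₂ i) G.b) - ∑ i, G.DL i * (u i * e₂ i)
      + u ⬝ᵥ (S.Ψ (e₁ + qd) *ᵥ θ.ofLp) := by
  simp only [dotProduct, force]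
  rw [← Finset.sum_neg_distrib, ← Finset.sum_sub_distrib, ← Finset.sum_sub_distrib,
    ← Finset.sum_add_distrib]
  exact Finset.sum_congr rfl fun i _ => by ring

/-- The derivative of `V₁` along the closed loop, where `u'` is the derivative of `tanh e₁`. -/
noncomputable def V1Deriv (S : Plant n k j) (ζ : ℝ) (u' : Fin n → ℝ) (e₁ e₂ : Vec n)
    (θ : Vec j) : ℝ :=
  -(A.γ₁ + A.γ₂) * (∑ i, G.D i * |e₂ i| ^ (1 + G.b) + ∑ i, G.DL i * (e₂ i * e₂ i))
    + A.γ₁ * A.d₁ * (u' ⬝ᵥ (S.inertia (e₁ + qd) *ᵥ e₂.ofLp)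
      + (S.coriolis (e₁ + qd) e₂ *ᵥ (vtanh e₁).ofLp) ⬝ᵥ e₂.ofLp
      - ∑ i, G.P i * (|Real.tanh (e₁ i)| * |e₁ i| ^ G.a)
      - ∑ i, G.D i * (Real.tanh (e₁ i) * spow (e₂ i) G.b))
    - (A.γ₁ + A.γ₂) * ζ * ∑ c, A.Υ c * |θ c| ^ (1 + G.b)

/-- The first group on the right is the negative of the work of Ψθ̃ along γ₁d₁ tanh e₁ + (γ₁+γ₂)e₂,
the combination that occurs in V₁'. The regressor thus disappears from V₁'. -/
lemma sum_inv_mul_adaptField (ζ : ℝ) (e₁ e₂ : Vec n) (θ : Vec j) :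
    ∑ c, (A.Γ c)⁻¹ * (θ c * adaptField S G A qd ζ e₁ e₂ θ c) =
      -(A.γ₁ * A.d₁ * ((vtanh e₁).ofLp ⬝ᵥ (S.Ψ (e₁ + qd) *ᵥ θ.ofLp))
        + (A.γ₁ + A.γ₂) * (e₂.ofLp ⬝ᵥ (S.Ψ (e₁ + qd) *ᵥ θ.ofLp)))
      - (A.γ₁ + A.γ₂) * ζ * ∑ c, A.Υ c * |θ c| ^ (1 + G.b) := by
  have h1 : A.γ₁ * A.d₁ * ((vtanh e₁).ofLp ⬝ᵥ (S.Ψ (e₁ + qd) *ᵥ θ.ofLp))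
        + (A.γ₁ + A.γ₂) * (e₂.ofLp ⬝ᵥ (S.Ψ (e₁ + qd) *ᵥ θ.ofLp))
      = ∑ c, θ c * ((S.Ψ (e₁ + qd))ᵀ *ᵥ ((A.γ₁ * A.d₁) • (vtanh e₁).ofLp
          + (A.γ₁ + A.γ₂) • e₂.ofLp)) c := by
    change _ = θ.ofLp ⬝ᵥ _
    rw [Matrix.mulVec_transpose, dotProduct_comm θ.ofLp, ← Matrix.dotProduct_mulVec, add_dotProduct,
      smul_dotProduct, smul_dotProduct, smul_eq_mul, smul_eq_mul]
  rw [h1, Finset.mul_sum, ← Finset.sum_neg_distrib, ← Finset.sum_sub_distrib]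
  refine Finset.sum_congr rfl fun c _ => ?_
  rw [← self_mul_spow _ _ G.b_pos.le]
  have hΓ := (A.Γ_pos c).ne'
  simp only [adaptField, Pi.sub_apply, Pi.neg_apply, Pi.smul_apply, Matrix.mulVec_diagonal, vspow,
    smul_eq_mul, vtanh]
  field_simp

lemma hasDerivWithinAt_V1 (hS : S.Standing μm μM Lc) {e₁ e₂ : ℝ → Vec n} {θ : ℝ → Vec j} {ζ : ℝ}
    {s : Set ℝ} {t : ℝ} (h₁ : HasDerivWithinAt e₁ (e₂ t) s t)
    (h₂ : HasDerivWithinAt e₂ (velField S G qd (e₁ t) (e₂ t) (θ t)) s t)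
    (h₃ : HasDerivWithinAt θ (adaptField S G A qd ζ (e₁ t) (e₂ t) (θ t)) s t) :
    HasDerivWithinAt (fun r => V1 S G A qd (e₁ r) (e₂ r) (θ r))
      (V1Deriv G A qd S ζ (fun i => (1 - Real.tanh (e₁ t i) ^ 2) * e₂ t i) (e₁ t) (e₂ t) (θ t))
      s t := by
  have h₁' := fun i => hasDerivWithinAt_apply h₁ i
  have h₂' := fun i => hasDerivWithinAt_apply h₂ i
  have h₃' := fun i => hasDerivWithinAt_apply h₃ i
  simp only [V1_eq]
  have dE := HasDerivWithinAt.fun_sum (u := Finset.univ) fun i _ =>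
    ((hasDerivAt_abs_rpow_spow (e₁ t i) G.one_lt_pw).comp_hasDerivWithinAt t (h₁' i)).const_mul
      (G.P i)
  have dK := hasDerivWithinAt_dotProduct_inertia G qd hS h₁ h₂ (u := fun r => (e₂ r).ofLp)
    (u' := (velField S G qd (e₁ t) (e₂ t) (θ t)).ofLp) h₂'
  have dT := hasDerivWithinAt_dotProduct_inertia G qd hS h₁ h₂ (u := fun r => (vtanh (e₁ r)).ofLp)
    (u' := fun i => (1 - Real.tanh (e₁ t i) ^ 2) * e₂ t i)
    (fun i => HasDerivAt.comp_hasDerivWithinAt (h₂ := Real.tanh) t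
      (hasDerivAt_tanh (e₁ t i)) (h₁' i))
  have dL := HasDerivWithinAt.fun_sum (u := Finset.univ) fun i _ =>
    ((hasDerivAt_log_cosh (e₁ t i)).comp_hasDerivWithinAt t (h₁' i)).const_mul (G.DL i)
  have dΘ := HasDerivWithinAt.fun_sum (u := Finset.univ) fun c _ =>
    ((h₃' c).fun_pow 2).const_mul ((A.Γ c)⁻¹)
  have key := ((((dE.const_mul G.pw⁻¹).add (dK.const_mul (1 / 2))).const_mul (A.γ₁ + A.γ₂)).add
    (dT.const_mul (A.γ₁ * A.d₁)) |>.add (dL.const_mul (A.γ₁ * A.d₁))).add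
    (dΘ.const_mul (1 / 2 : ℝ))
  refine HasDerivWithinAt.congr_deriv key ?_
  have eE : G.pw⁻¹ * ∑ i, G.P i * (G.pw * spow (e₁ t i) (G.pw - 1) * e₂ t i)
      = ∑ i, G.P i * (e₂ t i * spow (e₁ t i) G.a) := by
    rw [Finset.mul_sum, G.a_eq]
    refine Finset.sum_congr rfl fun i _ => ?_
    have := G.pw_pos.ne'
    field_simp
  -- The Coriolis force does no work beyond the change of M, so the kinetic energy changes by
  -- e₂ᵀ`force` alone.
  have eK : (velField S G qd (e₁ t) (e₂ t) (θ t)).ofLp ⬝ᵥ (S.inertia (e₁ t + qd) *ᵥ (e₂ t).ofLp)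
      + (S.coriolis (e₁ t + qd) (e₂ t) *ᵥ (e₂ t).ofLp) ⬝ᵥ (e₂ t).ofLp
      = (e₂ t).ofLp ⬝ᵥ force S G qd (e₁ t) (e₂ t) (θ t) := by
    rw [hS.dotProduct_inertia_comm, inertia_mulVec_velField G qd hS, dotProduct_sub,
      dotProduct_comm _ (e₂ t).ofLp]
    ring
  have eΘ : 1 / 2 * ∑ c, (A.Γ c)⁻¹ * (((2 : ℕ) : ℝ) * θ t c ^ (2 - 1) *
        adaptField S G A qd ζ (e₁ t) (e₂ t) (θ t) c)
      = ∑ c, (A.Γ c)⁻¹ * (θ t c * adaptField S G A qd ζ (e₁ t) (e₂ t) (θ t) c) := by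
    rw [Finset.mul_sum]
    refine Finset.sum_congr rfl fun c _ => ?_
    push_cast
    ring
  rw [eE, eK, eΘ, sum_inv_mul_adaptField, dotProduct_force, dotProduct_force, V1Deriv]
  have eB : ∑ i, G.D i * (e₂ t i * spow (e₂ t i) G.b) = ∑ i, G.D i * |e₂ t i| ^ (1 + G.b) :=
    Finset.sum_congr rfl fun i _ => by rw [self_mul_spow _ _ G.b_pos.le]
  have eT : ∑ i, G.P i * ((vtanh (e₁ t)).ofLp i * spow (e₁ t i) G.a)
      = ∑ i, G.P i * (|Real.tanh (e₁ t i)| * |e₁ t i| ^ G.a) :=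
    Finset.sum_congr rfl fun i _ => by rw [← abs_tanh_mul_spow]; rfl
  have eV : ∀ i, (vtanh (e₁ t)).ofLp i = Real.tanh (e₁ t i) := fun _ => rfl
  rw [eB, eT]
  simp only [eV]
  ring

/-- The constant of Young's inequality for the product of `tanh e₁` and `⌈e₂⌋^b`. -/
noncomputable def youngConst (i : Fin n) : ℝ :=
  G.D i * ((G.P i / (2 * G.D i)) ^ (1 / G.b)) ^ (-1 : ℝ)

lemma youngConst_pos (i : Fin n) : 0 < youngConst G i := by
  have := G.P_pos i
  have := G.D_pos i
  rw [youngConst]; positivity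

/-- Young's inequality produces |tanh x|^(1+b). Since |tanh x| ≤ 1, a ≤ b and |tanh x| ≤ |x|, this
is at most |tanh x||x|^a, the quantity that P dissipates; half of P is spent. -/
lemma D_mul_tanh_le (i : Fin n) (x y : ℝ) :
    -(G.D i * (Real.tanh x * spow y G.b)) ≤
      G.P i / 2 * (|Real.tanh x| * |x| ^ G.a) + youngConst G i * |y| ^ (1 + G.b) := by
  have hP := G.P_pos i
  have hD := G.D_pos i
  have hb := G.b_pos
  -- Chosen so that Dᵢ δ^b = Pᵢ/2.
  set δ := (G.P i / (2 * G.D i)) ^ (1 / G.b) with hδ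
  have hδ0 : 0 < δ := by positivity
  have hδb : G.D i * δ ^ G.b = G.P i / 2 := by
    rw [hδ, ← Real.rpow_mul (by positivity), one_div_mul_cancel hb.ne', Real.rpow_one]
    field_simp
  have h1 := rpow_mul_rpow_le (abs_nonneg (Real.tanh x)) (abs_nonneg y) hδ0 one_pos hb
  rw [Real.rpow_one] at h1
  have h2 : |Real.tanh x| ^ (1 + G.b) ≤ |Real.tanh x| * |x| ^ G.a := by
    rw [Real.rpow_add' (abs_nonneg _) (by linarith), Real.rpow_one]
    gcongr
    have ht : |Real.tanh x| ≤ 1 := (Real.abs_tanh_lt_one x).le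
    calc |Real.tanh x| ^ G.b ≤ |Real.tanh x| ^ G.a := by
          rcases (abs_nonneg (Real.tanh x)).eq_or_lt with h0 | h0
          · rw [← h0, Real.zero_rpow hb.ne', Real.zero_rpow G.a_pos.ne']
          · exact Real.rpow_le_rpow_of_exponent_ge h0 ht G.a_le_b
      _ ≤ |x| ^ G.a := Real.rpow_le_rpow (abs_nonneg _) (abs_tanh_le_abs x) G.a_pos.le
  have h3 : -(Real.tanh x * spow y G.b) ≤ |Real.tanh x| * |y| ^ G.b := by
    refine (neg_le_abs _).trans ?_
    rw [abs_mul]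
    gcongr
    exact abs_spow_le _ _
  have h4 := mul_le_mul_of_nonneg_left (h3.trans h1) hD.le
  have h5 := mul_le_mul_of_nonneg_left h2 (show 0 ≤ G.P i / 2 by positivity)
  have h6 : G.D i * (δ ^ G.b * |Real.tanh x| ^ (1 + G.b)) = G.P i / 2 * |Real.tanh x| ^ (1 + G.b) := by
    rw [← mul_assoc, hδb]
  have h7 : G.D i * (δ ^ (-1 : ℝ) * |y| ^ (1 + G.b)) = youngConst G i * |y| ^ (1 + G.b) := by
    rw [youngConst]; ring
  linarith

/-- All terms of indefinite sign carry the factor γ₁d₁. Half of the D_L damping pays for the inertia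
and Coriolis terms, half of the D damping and half of the P term pay for the product of tanh e₁ and
⌈e₂⌋^b. -/
lemma exists_V1Deriv_le (hS : S.Standing μm μM Lc)
    (h1 : ∀ i, A.γ₁ * A.d₁ * (μM + Lc * Real.sqrt n) ≤ (A.γ₁ + A.γ₂) * (G.DL i / 2))
    (h2 : ∀ i, A.γ₁ * A.d₁ * youngConst G i ≤ (A.γ₁ + A.γ₂) * (G.D i / 2)) :
    ∃ c, 0 < c ∧ ∀ ζ e₁ e₂ θ, 0 ≤ ζ →
      V1Deriv G A qd S ζ (fun i => (1 - Real.tanh (e₁ i) ^ 2) * e₂ i) e₁ e₂ θ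
        ≤ -(c * dissipation G ζ e₁ e₂ θ) := by
  have hγ₁ := A.γ₁_pos
  have hγ₂ := A.γ₂_pos
  have hd₁ := A.d₁_pos
  obtain ⟨cD, hcD, hD⟩ := exists_pos_le_of_finite G.D G.D_pos
  obtain ⟨cL, hcL, hL⟩ := exists_pos_le_of_finite G.DL G.DL_pos
  obtain ⟨cP, hcP, hP⟩ := exists_pos_le_of_finite G.P G.P_pos
  obtain ⟨cΥ, hcΥ, hΥ⟩ := exists_pos_le_of_finite A.Υ A.Υ_pos
  set c := min (min ((A.γ₁ + A.γ₂) * (cD / 2)) ((A.γ₁ + A.γ₂) * (cL / 2)))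
    (min (A.γ₁ * A.d₁ * (cP / 2)) ((A.γ₁ + A.γ₂) * cΥ)) with hc
  have c1 : c ≤ (A.γ₁ + A.γ₂) * (cD / 2) := (min_le_left _ _).trans (min_le_left _ _)
  have c2 : c ≤ (A.γ₁ + A.γ₂) * (cL / 2) := (min_le_left _ _).trans (min_le_right _ _)
  have c3 : c ≤ A.γ₁ * A.d₁ * (cP / 2) := (min_le_right _ _).trans (min_le_left _ _)
  have c4 : c ≤ (A.γ₁ + A.γ₂) * cΥ := (min_le_right _ _).trans (min_le_right _ _)
  refine ⟨c, by positivity, fun ζ e₁ e₂ θ hζ => ?_⟩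
  have hM : (fun i => (1 - Real.tanh (e₁ i) ^ 2) * e₂ i) ⬝ᵥ (S.inertia (e₁ + qd) *ᵥ e₂.ofLp)
      ≤ μM * ‖e₂‖ ^ 2 := by
    have := (le_abs_self _).trans (hS.abs_dotProduct_inertia_le (e₁ + qd)
      (WithLp.toLp 2 fun i => (1 - Real.tanh (e₁ i) ^ 2) * e₂ i) e₂)
    refine this.trans ?_
    rw [mul_assoc, sq]
    have hμ := hS.μM_pos
    gcongr
    refine norm_toLp_le_of_abs_le (v := e₂.ofLp) fun i => ?_
    rw [abs_mul]
    apply mul_le_of_le_one_left (abs_nonneg _)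
    have := Real.tanh_sq_lt_one (e₁ i)
    rw [abs_le]
    constructor <;> nlinarith [sq_nonneg (Real.tanh (e₁ i))]
  -- The saturation matters here: ‖tanh e₁‖ ≤ √n keeps this term quadratic in e₂, uniformly in e₁.
  have hC : (S.coriolis (e₁ + qd) e₂ *ᵥ (vtanh e₁).ofLp) ⬝ᵥ e₂.ofLp
      ≤ Lc * Real.sqrt n * ‖e₂‖ ^ 2 := by
    refine (le_abs_self _).trans ((hS.abs_coriolis_dotProduct_le _ _ _ _).trans ?_)
    have h : ‖vtanh e₁‖ ≤ Real.sqrt n := norm_toLp_le_sqrt fun i => (Real.abs_tanh_lt_one _).le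
    have hL := hS.Lc_pos
    calc Lc * ‖e₂‖ * ‖vtanh e₁‖ * ‖e₂‖ ≤ Lc * ‖e₂‖ * Real.sqrt n * ‖e₂‖ := by gcongr
      _ = _ := by ring
  have hMC : A.γ₁ * A.d₁ * ((fun i => (1 - Real.tanh (e₁ i) ^ 2) * e₂ i) ⬝ᵥ
        (S.inertia (e₁ + qd) *ᵥ e₂.ofLp) + (S.coriolis (e₁ + qd) e₂ *ᵥ (vtanh e₁).ofLp) ⬝ᵥ e₂.ofLp)
      ≤ (A.γ₁ + A.γ₂) * ∑ i, G.DL i * (e₂ i * e₂ i) - c * ‖e₂‖ ^ 2 := by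
    calc _ ≤ A.γ₁ * A.d₁ * (μM * ‖e₂‖ ^ 2 + Lc * Real.sqrt n * ‖e₂‖ ^ 2) := by gcongr
      _ = ∑ i, A.γ₁ * A.d₁ * (μM + Lc * Real.sqrt n) * (e₂ i * e₂ i) := by
          rw [← Finset.mul_sum, EuclideanSpace.real_norm_sq_eq]
          simp only [sq]; ring
      _ ≤ ∑ i, ((A.γ₁ + A.γ₂) * (G.DL i * (e₂ i * e₂ i)) - c * (e₂ i * e₂ i)) := by
          refine Finset.sum_le_sum fun i _ => ?_
          have a1 := mul_le_mul_of_nonneg_right (h1 i) (mul_self_nonneg (e₂ i))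
          have a2 : c ≤ (A.γ₁ + A.γ₂) * (G.DL i / 2) := c2.trans (by gcongr; exact hL i)
          have a3 := mul_le_mul_of_nonneg_right a2 (mul_self_nonneg (e₂ i))
          linarith
      _ = _ := by
          rw [Finset.sum_sub_distrib, ← Finset.mul_sum, ← Finset.mul_sum,
            EuclideanSpace.real_norm_sq_eq]
          simp only [sq]
  have hY : -(A.γ₁ * A.d₁ * (∑ i, G.P i * (|Real.tanh (e₁ i)| * |e₁ i| ^ G.a)
        + ∑ i, G.D i * (Real.tanh (e₁ i) * spow (e₂ i) G.b)))
      ≤ (A.γ₁ + A.γ₂) * ∑ i, G.D i * |e₂ i| ^ (1 + G.b)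
        - c * ∑ i, |Real.tanh (e₁ i)| * |e₁ i| ^ G.a - c * ∑ i, |e₂ i| ^ (1 + G.b) := by
    rw [← Finset.sum_add_distrib, Finset.mul_sum, ← Finset.sum_neg_distrib, Finset.mul_sum,
      Finset.mul_sum, Finset.mul_sum, ← Finset.sum_sub_distrib, ← Finset.sum_sub_distrib]
    refine Finset.sum_le_sum fun i _ => ?_
    have y1 : 0 ≤ |Real.tanh (e₁ i)| * |e₁ i| ^ G.a := by positivity
    have y2 : 0 ≤ |e₂ i| ^ (1 + G.b) := by positivity
    have a1 := mul_le_mul_of_nonneg_left (D_mul_tanh_le G i (e₁ i) (e₂ i))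
      (show 0 ≤ A.γ₁ * A.d₁ by positivity)
    have a2 := mul_le_mul_of_nonneg_right (h2 i) y2
    have a3 : c ≤ A.γ₁ * A.d₁ * (G.P i / 2) := c3.trans (by gcongr; exact hP i)
    have a4 : c ≤ (A.γ₁ + A.γ₂) * (G.D i / 2) := c1.trans (by gcongr; exact hD i)
    have a5 := mul_le_mul_of_nonneg_right a3 y1
    have a6 := mul_le_mul_of_nonneg_right a4 y2
    linarith
  have hΘ : c * (ζ * ∑ c, |θ c| ^ (1 + G.b)) ≤
      (A.γ₁ + A.γ₂) * ζ * ∑ c, A.Υ c * |θ c| ^ (1 + G.b) := by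
    have : c * ∑ c, |θ c| ^ (1 + G.b) ≤ (A.γ₁ + A.γ₂) * ∑ c, A.Υ c * |θ c| ^ (1 + G.b) := by
      rw [Finset.mul_sum, Finset.mul_sum]
      refine Finset.sum_le_sum fun i _ => ?_
      rw [← mul_assoc]
      gcongr
      exact c4.trans (by gcongr; exact hΥ i)
    calc _ = ζ * (c * ∑ c, |θ c| ^ (1 + G.b)) := by ring
      _ ≤ ζ * ((A.γ₁ + A.γ₂) * ∑ c, A.Υ c * |θ c| ^ (1 + G.b)) := by gcongr
      _ = _ := by ring
  rw [V1Deriv, dissipation]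
  linarith

end

section

variable {n k j : ℕ} {S : Plant n k j} (G : PDGains n) (qd : Vec n) {μm μM Lc : ℝ}

/-! ### Components of the state and its size -/

lemma sum_le_homSize (e₁ e₂ : Vec n) (θ : Vec j) : ∑ i, |e₁ i| ^ G.pw ≤ homSize G e₁ e₂ θ := by
  rw [homSize]; nlinarith [sq_nonneg ‖e₂‖, sq_nonneg ‖θ‖]

lemma abs_rpow_le_homSize (e₁ e₂ : Vec n) (θ : Vec j) (i : Fin n) :
    |e₁ i| ^ G.pw ≤ homSize G e₁ e₂ θ :=
  (Finset.single_le_sum (f := fun i => |e₁ i| ^ G.pw)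
    (fun _ _ => Real.rpow_nonneg (abs_nonneg _) _) (Finset.mem_univ i)).trans
    (sum_le_homSize G e₁ e₂ θ)

lemma norm_sq_le_homSize (e₁ e₂ : Vec n) (θ : Vec j) : ‖e₂‖ ^ 2 ≤ homSize G e₁ e₂ θ := by
  rw [homSize]
  have : 0 ≤ ∑ i, |e₁ i| ^ G.pw := by positivity
  nlinarith [sq_nonneg ‖e₂‖, sq_nonneg ‖θ‖]

lemma norm_sq_le_homSize' (e₁ e₂ : Vec n) (θ : Vec j) : ‖θ‖ ^ 2 ≤ homSize G e₁ e₂ θ := by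
  rw [homSize]
  have : 0 ≤ ∑ i, |e₁ i| ^ G.pw := by positivity
  nlinarith [sq_nonneg ‖e₂‖, sq_nonneg ‖θ‖]

lemma abs_le_homSize_rpow (e₁ e₂ : Vec n) (θ : Vec j) (i : Fin n) :
    |e₁ i| ≤ homSize G e₁ e₂ θ ^ G.pw⁻¹ := by
  have h := Real.rpow_le_rpow (Real.rpow_nonneg (abs_nonneg _) _) (abs_rpow_le_homSize G e₁ e₂ θ i)
    (inv_nonneg.2 G.pw_pos.le)
  rwa [Real.rpow_rpow_inv (abs_nonneg _) G.pw_pos.ne'] at h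

lemma le_rpow_half_of_sq_le {x y : ℝ} (h : x ^ 2 ≤ y) : x ≤ y ^ (1 / 2 : ℝ) := by
  rw [← Real.sqrt_eq_rpow]
  exact Real.le_sqrt_of_sq_le h

lemma norm_le_homSize_rpow (e₁ e₂ : Vec n) (θ : Vec j) :
    ‖e₂‖ ≤ homSize G e₁ e₂ θ ^ (1 / 2 : ℝ) := le_rpow_half_of_sq_le (norm_sq_le_homSize G e₁ e₂ θ)

lemma norm_le_homSize_rpow' (e₁ e₂ : Vec n) (θ : Vec j) :
    ‖θ‖ ≤ homSize G e₁ e₂ θ ^ (1 / 2 : ℝ) := le_rpow_half_of_sq_le (norm_sq_le_homSize' G e₁ e₂ θ)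

lemma norm_vspow_le (e₁ e₂ : Vec n) (θ : Vec j) :
    ‖(WithLp.toLp 2 (vspow e₁ G.pw) : Vec n)‖ ≤ homSize G e₁ e₂ θ :=
  (norm_toLp_le_sum _).trans ((Finset.sum_le_sum fun _ _ => abs_spow_le _ _).trans
    (sum_le_homSize G e₁ e₂ θ))

/-! ### The cross term of `V_FT` -/

lemma abs_cross_le (hS : S.Standing μm μM Lc) (e₁ e₂ : Vec n) (θ : Vec j) :
    |vspow e₁ G.pw ⬝ᵥ (S.inertia (e₁ + qd) *ᵥ e₂.ofLp)| ≤
      μM * homSize G e₁ e₂ θ ^ (3 / 2 : ℝ) := by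
  have h := hS.abs_dotProduct_inertia_le (e₁ + qd) (WithLp.toLp 2 (vspow e₁ G.pw)) e₂
  have hN := homSize_nonneg G e₁ e₂ θ
  have hM := hS.μM_pos
  calc _ ≤ _ := h
    _ ≤ μM * homSize G e₁ e₂ θ * homSize G e₁ e₂ θ ^ (1 / 2 : ℝ) := by
        gcongr
        · exact norm_vspow_le G e₁ e₂ θ
        · exact norm_le_homSize_rpow G e₁ e₂ θ
    _ = _ := by
        rw [show (3 / 2 : ℝ) = 1 + 1 / 2 by norm_num, Real.rpow_add_of_nonneg hN (by norm_num)
          (by norm_num), Real.rpow_one]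
        ring

/-- The derivative of the cross term of `V_FT` along the closed loop. -/
noncomputable def crossDeriv (S : Plant n k j) (e₁ e₂ : Vec n) (θ : Vec j) : ℝ :=
  (fun i => G.pw * |e₁ i| ^ (G.pw - 1) * e₂ i) ⬝ᵥ (S.inertia (e₁ + qd) *ᵥ e₂.ofLp)
    + (S.coriolis (e₁ + qd) e₂ *ᵥ vspow e₁ G.pw) ⬝ᵥ e₂.ofLp
    + vspow e₁ G.pw ⬝ᵥ force S G qd e₁ e₂ θ

lemma hasDerivWithinAt_cross (hS : S.Standing μm μM Lc) {e₁ e₂ : ℝ → Vec n} {θ : Vec j}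
    {s : Set ℝ} {t : ℝ} (h₁ : HasDerivWithinAt e₁ (e₂ t) s t)
    (h₂ : HasDerivWithinAt e₂ (velField S G qd (e₁ t) (e₂ t) θ) s t) :
    HasDerivWithinAt
      (fun r => vspow (e₁ r) G.pw ⬝ᵥ (S.inertia (e₁ r + qd) *ᵥ (e₂ r).ofLp))
      (crossDeriv G qd S (e₁ t) (e₂ t) θ) s t :=
  hasDerivWithinAt_dotProduct_inertia G qd hS h₁ h₂ (u := fun r => vspow (e₁ r) G.pw) fun i =>
    HasDerivAt.comp_hasDerivWithinAt (h₂ := fun y => spow y G.pw) t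
      (hasDerivAt_spow (e₁ t i) G.one_lt_pw) (hasDerivWithinAt_apply h₁ i)

/-- Young's inequality for x and y^(b/a), with δ = ε^(1/a). The resulting power of y is (b/a)(p+a) =
2 + b because b p = 2a. -/
lemma exists_rpow_mul_rpow_le {ε : ℝ} (hε : 0 < ε) : ∃ C, 0 < C ∧ ∀ x y : ℝ, 0 ≤ x → 0 ≤ y →
    x ^ G.pw * y ^ G.b ≤ ε * x ^ (G.pw + G.a) + C * y ^ (2 + G.b) := by
  have ha := G.a_pos
  have hb := G.b_pos
  refine ⟨(ε ^ (1 / G.a)) ^ (-G.pw), by positivity, fun x y hx hy => ?_⟩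
  have h := rpow_mul_rpow_le hx (Real.rpow_nonneg hy (G.b / G.a))
    (Real.rpow_pos_of_pos hε (1 / G.a)) G.pw_pos ha
  rw [← Real.rpow_mul hy, ← Real.rpow_mul hy, ← Real.rpow_mul hε.le, one_div_mul_cancel ha.ne',
    Real.rpow_one, div_mul_cancel₀ _ ha.ne'] at h
  have e : G.b / G.a * (G.pw + G.a) = 2 + G.b := by
    have := G.b_mul_pw
    field_simp
    linarith
  rwa [e] at h

/-- The weight of the dissipation of `V₁` in that of `V_FT`. -/
noncomputable def dissWeight (N : ℝ) : ℝ := (N ^ (1 / 2 : ℝ) + N) * (1 + N ^ G.pw⁻¹)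

lemma dissWeight_nonneg {N : ℝ} (hN : 0 ≤ N) : 0 ≤ dissWeight G N := by
  rw [dissWeight]; positivity

lemma half_le_dissWeight {N : ℝ} (hN : 0 ≤ N) :
    N ^ (1 / 2 : ℝ) * (1 + N ^ G.pw⁻¹) ≤ dissWeight G N := by
  rw [dissWeight]; gcongr; linarith

lemma self_le_dissWeight {N : ℝ} (hN : 0 ≤ N) : N * (1 + N ^ G.pw⁻¹) ≤ dissWeight G N := by
  rw [dissWeight]; gcongr
  have := Real.rpow_nonneg hN (1 / 2)
  linarith

lemma half_le_dissWeight' {N : ℝ} (hN : 0 ≤ N) : N ^ (1 / 2 : ℝ) ≤ dissWeight G N := by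
  refine le_trans ?_ (half_le_dissWeight G hN)
  have := Real.rpow_nonneg hN G.pw⁻¹
  exact le_mul_of_one_le_right (Real.rpow_nonneg hN _) (by linarith)

lemma self_le_dissWeight' {N : ℝ} (hN : 0 ≤ N) : N ≤ dissWeight G N := by
  refine le_trans ?_ (self_le_dissWeight G hN)
  have := Real.rpow_nonneg hN G.pw⁻¹
  exact le_mul_of_one_le_right hN (by linarith)

/-- Split |e₁ᵢ|^p = |e₁ᵢ||e₁ᵢ|^a and trade the first factor for its tanh; the loss 1 + |e₁ᵢ| is at
most 1 + N^(1/p). This is where the last factor of `dissWeight` comes from. -/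
lemma rpow_pw_le (e₁ e₂ : Vec n) (θ : Vec j) (i : Fin n) : |e₁ i| ^ G.pw ≤
    (1 + homSize G e₁ e₂ θ ^ G.pw⁻¹) * (|Real.tanh (e₁ i)| * |e₁ i| ^ G.a) := by
  have h1 := abs_le_homSize_rpow G e₁ e₂ θ i
  have h2 := abs_le_one_add_mul_abs_tanh (e₁ i)
  have h3 : |e₁ i| ^ G.pw = |e₁ i| * |e₁ i| ^ G.a := by
    rw [show G.pw = 1 + G.a by rw [G.a_eq]; ring, Real.rpow_add_of_nonneg (abs_nonneg _)
      zero_le_one G.a_pos.le, Real.rpow_one]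
  rw [h3, ← mul_assoc]
  gcongr
  exact h2.trans (by gcongr)

lemma sum_rpow_pw_le (e₁ e₂ : Vec n) (θ : Vec j) : ∑ i, |e₁ i| ^ G.pw ≤
    (1 + homSize G e₁ e₂ θ ^ G.pw⁻¹) * ∑ i, |Real.tanh (e₁ i)| * |e₁ i| ^ G.a := by
  rw [Finset.mul_sum]
  exact Finset.sum_le_sum fun i _ => rpow_pw_le G e₁ e₂ θ i

/-- Homogeneity: |e₁ᵢ|^a ≤ N^(b/2) and |e₂ᵢ|^(1-b) ≤ N^((1-b)/2), which together leave N^(1/2). -/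
lemma cross_inertia_le (hS : S.Standing μm μM Lc) (e₁ e₂ : Vec n) (θ : Vec j) :
    (fun i => G.pw * |e₁ i| ^ (G.pw - 1) * e₂ i) ⬝ᵥ (S.inertia (e₁ + qd) *ᵥ e₂.ofLp) ≤
      G.pw * μM * (homSize G e₁ e₂ θ ^ (1 / 2 : ℝ) * ∑ i, |e₂ i| ^ (1 + G.b)) := by
  set N := homSize G e₁ e₂ θ
  have hN : 0 ≤ N := homSize_nonneg G e₁ e₂ θ
  have hM := hS.μM_pos
  have hp := G.pw_pos
  rw [← G.a_eq]
  have h1 : ‖(WithLp.toLp 2 (fun i => G.pw * |e₁ i| ^ G.a * e₂ i) : Vec n)‖ ≤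
      G.pw * N ^ (G.b / 2) * ‖e₂‖ := by
    have h0 : 0 ≤ G.pw * N ^ (G.b / 2) := by positivity
    have h2 : ‖(G.pw * N ^ (G.b / 2)) • e₂‖ = G.pw * N ^ (G.b / 2) * ‖e₂‖ := by
      rw [norm_smul, Real.norm_of_nonneg h0]
    rw [← h2]
    refine norm_toLp_le_of_abs_le (v := ((G.pw * N ^ (G.b / 2)) • e₂).ofLp) fun i => ?_
    have h3 : |e₁ i| ^ G.a ≤ N ^ (G.b / 2) := by
      have := Real.rpow_le_rpow (abs_nonneg _) (abs_le_homSize_rpow G e₁ e₂ θ i) G.a_pos.le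
      rw [← Real.rpow_mul hN] at this
      convert this using 2
      have := G.b_mul_pw
      field_simp
      linarith
    rw [abs_mul, PiLp.smul_apply, smul_eq_mul, abs_mul (G.pw * N ^ (G.b / 2)), abs_of_nonneg h0,
      abs_of_nonneg (show 0 ≤ G.pw * |e₁ i| ^ G.a by positivity)]
    gcongr
  have h2 : ‖e₂‖ ^ 2 ≤ N ^ ((1 - G.b) / 2) * ∑ i, |e₂ i| ^ (1 + G.b) := by
    rw [EuclideanSpace.real_norm_sq_eq, Finset.mul_sum]
    refine Finset.sum_le_sum fun i _ => ?_
    have h4 : |e₂ i| ^ (1 - G.b) ≤ N ^ ((1 - G.b) / 2) := by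
      have := Real.rpow_le_rpow (abs_nonneg _)
        ((abs_apply_le_norm e₂ i).trans (norm_le_homSize_rpow G e₁ e₂ θ))
        (show 0 ≤ 1 - G.b by linarith [G.b_lt_one])
      rw [← Real.rpow_mul hN] at this
      convert this using 2
      ring
    calc e₂ i ^ 2 = |e₂ i| ^ (1 - G.b) * |e₂ i| ^ (1 + G.b) := by
          rw [← Real.rpow_add_of_nonneg (abs_nonneg _) (by linarith [G.b_lt_one])
            (by linarith [G.b_pos]), show 1 - G.b + (1 + G.b) = 2 by ring, Real.rpow_two, sq_abs]
      _ ≤ _ := by gcongr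
  have hB : 0 ≤ ∑ i, |e₂ i| ^ (1 + G.b) := by positivity
  calc _ ≤ μM * ‖(WithLp.toLp 2 (fun i => G.pw * |e₁ i| ^ G.a * e₂ i) : Vec n)‖ * ‖e₂‖ :=
        (le_abs_self _).trans (hS.abs_dotProduct_inertia_le (e₁ + qd) (WithLp.toLp 2 _) e₂)
    _ ≤ μM * (G.pw * N ^ (G.b / 2) * ‖e₂‖) * ‖e₂‖ := by gcongr
    _ = G.pw * μM * N ^ (G.b / 2) * ‖e₂‖ ^ 2 := by ring
    _ ≤ G.pw * μM * N ^ (G.b / 2) * (N ^ ((1 - G.b) / 2) * ∑ i, |e₂ i| ^ (1 + G.b)) := by gcongr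
    _ = G.pw * μM * ((N ^ (G.b / 2) * N ^ ((1 - G.b) / 2)) * ∑ i, |e₂ i| ^ (1 + G.b)) := by ring
    _ = _ := by
        rw [← Real.rpow_add_of_nonneg hN (by linarith [G.b_pos]) (by linarith [G.b_lt_one])]
        congr 4
        ring

lemma cross_coriolis_le (hS : S.Standing μm μM Lc) (e₁ e₂ : Vec n) (θ : Vec j) :
    (S.coriolis (e₁ + qd) e₂ *ᵥ vspow e₁ G.pw) ⬝ᵥ e₂.ofLp ≤
      Lc * (homSize G e₁ e₂ θ * ‖e₂‖ ^ 2) := by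
  have hL := hS.Lc_pos
  calc _ ≤ Lc * ‖e₂‖ * ‖(WithLp.toLp 2 (vspow e₁ G.pw) : Vec n)‖ * ‖e₂‖ :=
        (le_abs_self _).trans
          (hS.abs_coriolis_dotProduct_le (e₁ + qd) (WithLp.toLp 2 (vspow e₁ G.pw)) e₂ e₂)
    _ ≤ Lc * ‖e₂‖ * homSize G e₁ e₂ θ * ‖e₂‖ := by
        gcongr
        exact norm_vspow_le G e₁ e₂ θ
    _ = _ := by ring

/-- The P term is the gain that motivates the cross term. The damping terms are traded for half of
it and for quantities in e₂ that V₁ dissipates. -/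
lemma exists_cross_damping_le : ∃ C, 0 < C ∧ ∀ (e₁ e₂ : Vec n) (θ : Vec j),
    -(∑ i, G.P i * (vspow e₁ G.pw i * spow (e₁ i) G.a))
      - ∑ i, G.D i * (vspow e₁ G.pw i * spow (e₂ i) G.b)
      - ∑ i, G.DL i * (vspow e₁ G.pw i * e₂ i) ≤
    -(∑ i, G.P i / 2 * |e₁ i| ^ (G.pw + G.a))
      + C * (homSize G e₁ e₂ θ ^ (1 / 2 : ℝ) * ∑ i, |e₂ i| ^ (1 + G.b)
        + homSize G e₁ e₂ θ * ‖e₂‖ ^ 2) := by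
  -- Both the D and the D_L terms produce |e₁ᵢ|^p|e₂ᵢ|^b, hence the sum of the two gains in ε.
  have hy := fun i => exists_rpow_mul_rpow_le G
    (ε := G.P i / (2 * (G.D i + G.DL i))) (by
      have := G.P_pos i; have := G.D_pos i; have := G.DL_pos i; positivity)
  choose Y hY0 hY using hy
  obtain ⟨C, hC, hCle⟩ := exists_ge_of_finite (fun i => max ((G.D i + G.DL i) * Y i) (G.DL i))
  refine ⟨C, hC, fun e₁ e₂ θ => ?_⟩
  set N := homSize G e₁ e₂ θ with hNdef
  have hN : 0 ≤ N := homSize_nonneg G e₁ e₂ θ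
  rw [EuclideanSpace.real_norm_sq_eq, Finset.mul_sum, Finset.mul_sum, ← Finset.sum_add_distrib,
    Finset.mul_sum, ← Finset.sum_neg_distrib, ← Finset.sum_neg_distrib, ← Finset.sum_sub_distrib,
    ← Finset.sum_sub_distrib, ← Finset.sum_add_distrib]
  refine Finset.sum_le_sum fun i _ => ?_
  have hP := G.P_pos i
  have hD := G.D_pos i
  have hDL := G.DL_pos i
  have hb := G.b_pos
  set x := |e₁ i| with hx
  set y := |e₂ i| with hy
  have hx0 : 0 ≤ x := abs_nonneg _
  have hy0 : 0 ≤ y := abs_nonneg _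
  have c1 : (G.D i + G.DL i) * Y i ≤ C := (le_max_left _ _).trans (hCle i)
  have c2 : G.DL i ≤ C := (le_max_right _ _).trans (hCle i)
  have p1 : vspow e₁ G.pw i * spow (e₁ i) G.a = x ^ (G.pw + G.a) :=
    spow_mul_spow _ _ _ G.pw_pos G.a_pos.le
  have p2 : -(vspow e₁ G.pw i * spow (e₂ i) G.b) ≤ x ^ G.pw * y ^ G.b := by
    refine (neg_le_abs _).trans ?_
    rw [abs_mul]
    exact mul_le_mul (abs_spow_le _ _) (abs_spow_le _ _) (abs_nonneg _) (by positivity)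
  have hy1 : y ≤ y ^ G.b + y ^ 2 := by
    rcases le_total y 1 with h | h
    · have : y ≤ y ^ G.b := by
        rcases hy0.eq_or_lt with h0 | h0
        · rw [← h0, Real.zero_rpow hb.ne']
        · simpa using Real.rpow_le_rpow_of_exponent_ge h0 h G.b_lt_one.le
      nlinarith [sq_nonneg y]
    · have := Real.rpow_nonneg hy0 G.b
      nlinarith
  have p3 : -(vspow e₁ G.pw i * e₂ i) ≤ x ^ G.pw * y ^ G.b + x ^ G.pw * y ^ 2 := by
    refine (neg_le_abs _).trans ?_
    rw [abs_mul, ← mul_add]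
    exact mul_le_mul (abs_spow_le _ _) hy1 (abs_nonneg _) (by positivity)
  have q1 := hY i x y hx0 hy0
  have q2 : x ^ G.pw * y ^ 2 ≤ N * y ^ 2 := by
    gcongr
    exact abs_rpow_le_homSize G e₁ e₂ θ i
  have q3 : y ^ (2 + G.b) ≤ N ^ (1 / 2 : ℝ) * y ^ (1 + G.b) := by
    rw [show 2 + G.b = 1 + (1 + G.b) by ring, Real.rpow_add_of_nonneg hy0 zero_le_one (by linarith),
      Real.rpow_one]
    gcongr
    exact (abs_apply_le_norm e₂ i).trans (norm_le_homSize_rpow G e₁ e₂ θ)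
  have r1 := mul_le_mul_of_nonneg_left p2 hD.le
  have r2 := mul_le_mul_of_nonneg_left p3 hDL.le
  have r3 := mul_le_mul_of_nonneg_left q1 (show 0 ≤ G.D i + G.DL i by positivity)
  have r4 : (G.D i + G.DL i) * (G.P i / (2 * (G.D i + G.DL i)) * x ^ (G.pw + G.a))
      = G.P i / 2 * x ^ (G.pw + G.a) := by field_simp
  have r5 : (G.D i + G.DL i) * (Y i * y ^ (2 + G.b)) ≤ C * (N ^ (1 / 2 : ℝ) * y ^ (1 + G.b)) := by
    rw [← mul_assoc]
    gcongr
  have r6 : G.DL i * (x ^ G.pw * y ^ 2) ≤ C * (N * y ^ 2) := by gcongr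
  have e2 : e₂ i ^ 2 = y ^ 2 := (sq_abs _).symm
  rw [p1, e2]
  linarith

/-- Here nothing cancels. The bounded regressor gives |(Ψθ̃)ᵢ| at most a multiple of N^(1/2), and
∑|e₁ᵢ|^p is recovered from the saturated dissipation. -/
lemma exists_cross_regressor_le (hS : S.Standing μm μM Lc) :
    ∃ C, 0 < C ∧ ∀ (e₁ e₂ : Vec n) (θ : Vec j),
      vspow e₁ G.pw ⬝ᵥ (S.Ψ (e₁ + qd) *ᵥ θ.ofLp) ≤
        C * (homSize G e₁ e₂ θ ^ (1 / 2 : ℝ) * (1 + homSize G e₁ e₂ θ ^ G.pw⁻¹)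
          * ∑ i, |Real.tanh (e₁ i)| * |e₁ i| ^ G.a) := by
  obtain ⟨B, hB, hΨ⟩ := hS.exists_abs_Ψ_le
  refine ⟨B, hB, fun e₁ e₂ θ => ?_⟩
  set N := homSize G e₁ e₂ θ
  have hN : 0 ≤ N := homSize_nonneg G e₁ e₂ θ
  calc _ ≤ ∑ i, |e₁ i| ^ G.pw * (B * N ^ (1 / 2 : ℝ)) := by
        refine Finset.sum_le_sum fun i _ => (le_abs_self _).trans ?_
        rw [abs_mul]
        refine mul_le_mul (abs_spow_le _ _) ((hΨ _ θ i).trans ?_) (abs_nonneg _) (by positivity)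
        gcongr
        exact norm_le_homSize_rpow' G e₁ e₂ θ
    _ = B * N ^ (1 / 2 : ℝ) * ∑ i, |e₁ i| ^ G.pw := by rw [← Finset.sum_mul]; ring
    _ ≤ B * N ^ (1 / 2 : ℝ) * ((1 + N ^ G.pw⁻¹) * ∑ i, |Real.tanh (e₁ i)| * |e₁ i| ^ G.a) := by
        gcongr
        exact sum_rpow_pw_le G e₁ e₂ θ
    _ = _ := by ring

lemma exists_crossDeriv_le (hS : S.Standing μm μM Lc) :
    ∃ c C, 0 < c ∧ 0 < C ∧ ∀ (ζ : ℝ) (e₁ e₂ : Vec n) (θ : Vec j), 0 ≤ ζ →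
      crossDeriv G qd S e₁ e₂ θ ≤ -(c * ∑ i, |e₁ i| ^ (G.pw + G.a))
        + C * (dissWeight G (homSize G e₁ e₂ θ) * dissipation G ζ e₁ e₂ θ) := by
  obtain ⟨cP, hcP, hP⟩ := exists_pos_le_of_finite G.P G.P_pos
  obtain ⟨C₁, hC₁, h₁⟩ := exists_cross_damping_le (j := j) G
  obtain ⟨C₂, hC₂, h₂⟩ := exists_cross_regressor_le (S := S) G qd hS
  have hM := hS.μM_pos
  have hL := hS.Lc_pos
  have hp := G.pw_pos
  refine ⟨cP / 2, G.pw * μM + Lc + C₁ + C₂, by positivity, by positivity, fun ζ e₁ e₂ θ hζ => ?_⟩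
  have h₁ := h₁ e₁ e₂ θ
  have h₂ := h₂ e₁ e₂ θ
  have h₃ := cross_inertia_le G qd hS e₁ e₂ θ
  have h₄ := cross_coriolis_le G qd hS e₁ e₂ θ
  have hN : 0 ≤ homSize G e₁ e₂ θ := homSize_nonneg G e₁ e₂ θ
  have w₁ := half_le_dissWeight' G hN
  have w₂ := self_le_dissWeight' G hN
  have w₃ := half_le_dissWeight G hN
  have w₀ := dissWeight_nonneg G hN
  rw [crossDeriv, dotProduct_force, dissipation]
  set W := dissWeight G (homSize G e₁ e₂ θ)
  set B := ∑ i, |e₂ i| ^ (1 + G.b)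
  set T := ∑ i, |Real.tanh (e₁ i)| * |e₁ i| ^ G.a
  have hB : 0 ≤ B := by positivity
  have hT : 0 ≤ T := by positivity
  have hΘ : 0 ≤ ζ * ∑ c, |θ c| ^ (1 + G.b) := by positivity
  have hQ : cP / 2 * ∑ i, |e₁ i| ^ (G.pw + G.a) ≤ ∑ i, G.P i / 2 * |e₁ i| ^ (G.pw + G.a) := by
    rw [Finset.mul_sum]
    refine Finset.sum_le_sum fun i _ => ?_
    gcongr
    exact hP i
  have hK : 0 ≤ ‖e₂‖ ^ 2 := sq_nonneg _
  set Y := ζ * ∑ c, |θ c| ^ (1 + G.b)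
  have u₁ : homSize G e₁ e₂ θ ^ (1 / 2 : ℝ) * B ≤ W * B := by gcongr
  have u₂ : homSize G e₁ e₂ θ * ‖e₂‖ ^ 2 ≤ W * ‖e₂‖ ^ 2 := by gcongr
  have u₃ := mul_le_mul_of_nonneg_right w₃ hT
  have z₁ : W * B ≤ W * (B + ‖e₂‖ ^ 2 + T + Y) :=
    mul_le_mul_of_nonneg_left (by linarith) w₀
  have z₂ : W * ‖e₂‖ ^ 2 ≤ W * (B + ‖e₂‖ ^ 2 + T + Y) :=
    mul_le_mul_of_nonneg_left (by linarith) w₀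
  have z₃ : W * T ≤ W * (B + ‖e₂‖ ^ 2 + T + Y) :=
    mul_le_mul_of_nonneg_left (by linarith) w₀
  have z₄ : W * B + W * ‖e₂‖ ^ 2 ≤ W * (B + ‖e₂‖ ^ 2 + T + Y) := by
    rw [← mul_add]; exact mul_le_mul_of_nonneg_left (by linarith) w₀
  have v₁ := mul_le_mul_of_nonneg_left (u₁.trans z₁) (show 0 ≤ G.pw * μM by positivity)
  have v₂ := mul_le_mul_of_nonneg_left (u₂.trans z₂) hL.le
  have v₃ := mul_le_mul_of_nonneg_left ((add_le_add u₁ u₂).trans z₄) hC₁.le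
  have v₄ := mul_le_mul_of_nonneg_left (u₃.trans z₃) hC₂.le
  linarith

end

section

variable {n k j : ℕ} {S : Plant n k j} (G : PDGains n) (qd : Vec n) {μm μM Lc : ℝ}

/-! ### The dissipation dominates a power of the size of the state -/

lemma norm_sq_rpow_le {m : ℕ} (v : Vec m) :
    (‖v‖ ^ 2) ^ ((1 + G.b) / 2) ≤ (m : ℝ) ^ ((1 + G.b) / 2) * ∑ i, |v i| ^ (1 + G.b) := by
  have hb := G.b_pos
  have h := sum_rpow_le (fun i => v i ^ 2) (fun i => sq_nonneg _)
    (show 0 < (1 + G.b) / 2 by linarith)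
  rw [EuclideanSpace.real_norm_sq_eq]
  convert h using 3 with i
  rw [← sq_abs, ← Real.rpow_two, ← Real.rpow_mul (abs_nonneg _)]
  congr 1
  ring

lemma sum_rpow_pw_rpow_le (e₁ : Vec n) :
    (∑ i, |e₁ i| ^ G.pw) ^ (1 + G.b / 2) ≤
      (n : ℝ) ^ (1 + G.b / 2) * ∑ i, |e₁ i| ^ (G.pw + G.a) := by
  have hb := G.b_pos
  have h := sum_rpow_le (fun i => |e₁ i| ^ G.pw) (fun i => Real.rpow_nonneg (abs_nonneg _) _)
    (show 0 < 1 + G.b / 2 by linarith)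
  convert h using 3 with i
  rw [← Real.rpow_mul (abs_nonneg _)]
  congr 1
  have := G.b_mul_pw
  linarith

lemma homSize_le_three_mul (e₁ e₂ : Vec n) (θ : Vec j) :
    homSize G e₁ e₂ θ ≤ 3 * ∑ i, |e₁ i| ^ G.pw ∨ homSize G e₁ e₂ θ ≤ 3 * ‖e₂‖ ^ 2 ∨
      homSize G e₁ e₂ θ ≤ 3 * ‖θ‖ ^ 2 := by
  rw [homSize]
  by_contra! h
  linarith [h.1, h.2.1, h.2.2]

/-- One of the three parts of N is at least N/3, and each part has its own source of decay. For N ≤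
1 these are the new term |e₁|^(p+a) and the powers 1 + b of e₂ and θ̃; for N ≥ 1 they are the
saturated term in e₁, ‖e₂‖², and again the power of θ̃. -/
lemma exists_le_dissipation : ∃ c, 0 < c ∧ ∀ (ζ : ℝ) (e₁ e₂ : Vec n) (θ : Vec j), 0 ≤ ζ → ζ ≤ 1 →
    (homSize G e₁ e₂ θ ≤ 1 → c * (ζ * homSize G e₁ e₂ θ ^ (1 + G.b / 2)) ≤
      dissWeight G (homSize G e₁ e₂ θ) * dissipation G ζ e₁ e₂ θ
        + ∑ i, |e₁ i| ^ (G.pw + G.a)) ∧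
    (1 ≤ homSize G e₁ e₂ θ → c * (ζ * homSize G e₁ e₂ θ ^ (3 / 2 : ℝ)) ≤
      dissWeight G (homSize G e₁ e₂ θ) * dissipation G ζ e₁ e₂ θ
        + ∑ i, |e₁ i| ^ (G.pw + G.a)) := by
  have hb := G.b_pos
  set η := (1 + G.b) / 2 with hη
  have hη0 : 0 < η := by positivity
  set C : ℝ := 3 ^ (1 + G.b / 2) * (n : ℝ) ^ (1 + G.b / 2) + 3 ^ η * (n : ℝ) ^ η
    + 3 ^ η * (j : ℝ) ^ η + 3 with hC
  have t₁ : 0 ≤ (3 : ℝ) ^ (1 + G.b / 2) * (n : ℝ) ^ (1 + G.b / 2) := by positivity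
  have t₂ : 0 ≤ (3 : ℝ) ^ η * (n : ℝ) ^ η := by positivity
  have t₃ : 0 ≤ (3 : ℝ) ^ η * (j : ℝ) ^ η := by positivity
  have hC0 : 0 < C := by linarith
  refine ⟨C⁻¹, inv_pos.2 hC0, fun ζ e₁ e₂ θ hζ hζ1 => ?_⟩
  have hN : 0 ≤ homSize G e₁ e₂ θ := homSize_nonneg G e₁ e₂ θ
  have hcases := homSize_le_three_mul G e₁ e₂ θ
  have hE := sum_rpow_pw_rpow_le G e₁
  have hE' := sum_rpow_pw_le G e₁ e₂ θ
  have hK := norm_sq_rpow_le G e₂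
  have hΘ := norm_sq_rpow_le G θ
  have w₁ := half_le_dissWeight' G hN
  have w₂ := self_le_dissWeight' G hN
  have w₃ := self_le_dissWeight G hN
  have w₀ := dissWeight_nonneg G hN
  rw [← hη] at hK hΘ
  set N := homSize G e₁ e₂ θ
  set W := dissWeight G N with hW
  set Q := ∑ i, |e₁ i| ^ (G.pw + G.a)
  set E := ∑ i, |e₁ i| ^ G.pw
  rw [dissipation]
  set B := ∑ i, |e₂ i| ^ (1 + G.b)
  set T := ∑ i, |Real.tanh (e₁ i)| * |e₁ i| ^ G.a
  set Y := ∑ c, |θ c| ^ (1 + G.b)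
  have hQ : 0 ≤ Q := by positivity
  have hE0 : 0 ≤ E := by positivity
  have hB : 0 ≤ B := by positivity
  have hT : 0 ≤ T := by positivity
  have hY : 0 ≤ Y := by positivity
  have hζY : 0 ≤ ζ * Y := by positivity
  have hK0 : 0 ≤ ‖e₂‖ ^ 2 := sq_nonneg _
  set Z := B + ‖e₂‖ ^ 2 + T + ζ * Y with hZ
  have hZ0 : 0 ≤ Z := by positivity
  have hWZ : 0 ≤ W * Z := by positivity
  have fin : ∀ {X C' : ℝ}, C' ≤ C → X ≤ C' * (W * Z + Q) → C⁻¹ * X ≤ W * Z + Q := by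
    intro X C' h1 h2
    rw [inv_mul_le_iff₀ hC0]
    exact h2.trans (by gcongr)
  have pw3 : ∀ {x q : ℝ}, 0 ≤ x → N ≤ 3 * x → 0 ≤ q → N ^ q ≤ 3 ^ q * x ^ q := by
    intro x q hx h hq
    rw [← Real.mul_rpow (by norm_num) hx]
    exact Real.rpow_le_rpow hN h hq
  constructor
  · intro hN1
    -- The factor N^(1/2) is paid by the weight W, the factor N^((1+b)/2) by the dissipation of e₂
    -- or θ̃.
    have hsplit : N ^ (1 + G.b / 2) = N ^ (1 / 2 : ℝ) * N ^ η := by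
      rw [← Real.rpow_add_of_nonneg hN (by norm_num) hη0.le]
      congr 1
      rw [hη]; ring
    rcases hcases with h | h | h
    · refine fin (C' := 3 ^ (1 + G.b / 2) * (n : ℝ) ^ (1 + G.b / 2)) (by linarith) ?_
      have h1 := pw3 hE0 h (show 0 ≤ 1 + G.b / 2 by linarith)
      calc ζ * N ^ (1 + G.b / 2) ≤ 1 * (3 ^ (1 + G.b / 2) * E ^ (1 + G.b / 2)) := by gcongr
        _ ≤ 1 * (3 ^ (1 + G.b / 2) * ((n : ℝ) ^ (1 + G.b / 2) * Q)) := by gcongr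
        _ = 3 ^ (1 + G.b / 2) * (n : ℝ) ^ (1 + G.b / 2) * Q := by ring
        _ ≤ _ := by gcongr; linarith
    · refine fin (C' := 3 ^ η * (n : ℝ) ^ η) (by linarith) ?_
      have h1 := pw3 hK0 h hη0.le
      rw [hsplit]
      calc ζ * (N ^ (1 / 2 : ℝ) * N ^ η) ≤ 1 * (W * (3 ^ η * (‖e₂‖ ^ 2) ^ η)) := by gcongr
        _ ≤ 1 * (W * (3 ^ η * ((n : ℝ) ^ η * B))) := by gcongr
        _ = 3 ^ η * (n : ℝ) ^ η * (W * B) := by ring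
        _ ≤ 3 ^ η * (n : ℝ) ^ η * (W * Z) := by
            gcongr
            rw [hZ]; linarith
        _ ≤ _ := by gcongr; linarith
    · refine fin (C' := 3 ^ η * (j : ℝ) ^ η) (by linarith) ?_
      have h1 := pw3 (sq_nonneg _) h hη0.le
      rw [hsplit]
      calc ζ * (N ^ (1 / 2 : ℝ) * N ^ η) ≤ ζ * (W * (3 ^ η * (‖θ‖ ^ 2) ^ η)) := by gcongr
        _ ≤ ζ * (W * (3 ^ η * ((j : ℝ) ^ η * Y))) := by gcongr
        _ = 3 ^ η * (j : ℝ) ^ η * (W * (ζ * Y)) := by ring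
        _ ≤ 3 ^ η * (j : ℝ) ^ η * (W * Z) := by
            gcongr
            rw [hZ]; linarith
        _ ≤ _ := by gcongr; linarith
  · intro hN1
    have h32 : N ^ (3 / 2 : ℝ) ≤ N * N := by
      rw [← sq, ← Real.rpow_two]
      exact Real.rpow_le_rpow_of_exponent_le hN1 (by norm_num)
    rcases hcases with h | h | h
    · refine fin (C' := 3) (by linarith) ?_
      have p0 := Real.rpow_nonneg hN G.pw⁻¹
      calc ζ * N ^ (3 / 2 : ℝ) ≤ 1 * (N * N) := by gcongr
        _ ≤ 1 * (N * (3 * ((1 + N ^ G.pw⁻¹) * T))) := by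
            gcongr
            exact h.trans (by gcongr)
        _ = 3 * (N * (1 + N ^ G.pw⁻¹) * T) := by ring
        _ ≤ 3 * (W * Z) := by
            gcongr
            rw [hZ]; linarith
        _ ≤ _ := by linarith
    · refine fin (C' := 3) (by linarith) ?_
      calc ζ * N ^ (3 / 2 : ℝ) ≤ 1 * (N * N) := by gcongr
        _ ≤ 1 * (W * (3 * ‖e₂‖ ^ 2)) := by gcongr
        _ = 3 * (W * ‖e₂‖ ^ 2) := by ring
        _ ≤ 3 * (W * Z) := by
            gcongr
            rw [hZ]; linarith
        _ ≤ _ := by linarith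
    -- Here the sum of the |θ̃ᵢ|^(1+b) is only used as bounded below; the growth comes from W ≥
    -- N^(1+1/p) ≥ N^(3/2), as 1/p > 1/2.
    · refine fin (C' := 3 ^ η * (j : ℝ) ^ η) (by linarith) ?_
      have h1 := (Real.one_le_rpow hN1 hη0.le).trans (pw3 (sq_nonneg _) h hη0.le)
      have h2 : N ^ (3 / 2 : ℝ) ≤ W := by
        refine le_trans ?_ w₃
        have : N ^ (1 / 2 : ℝ) ≤ N ^ G.pw⁻¹ := by
          apply Real.rpow_le_rpow_of_exponent_le hN1
          rw [one_div]
          exact inv_anti₀ G.pw_pos G.pw_lt_two.le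
        rw [show (3 / 2 : ℝ) = 1 + 1 / 2 by norm_num, Real.rpow_add_of_nonneg hN (by norm_num)
          (by norm_num), Real.rpow_one]
        gcongr
        linarith
      calc ζ * N ^ (3 / 2 : ℝ) ≤ ζ * (W * 1) := by rw [mul_one]; gcongr
        _ ≤ ζ * (W * (3 ^ η * (‖θ‖ ^ 2) ^ η)) := by gcongr
        _ ≤ ζ * (W * (3 ^ η * ((j : ℝ) ^ η * Y))) := by gcongr
        _ = 3 ^ η * (j : ℝ) ^ η * (W * (ζ * Y)) := by ring
        _ ≤ 3 ^ η * (j : ℝ) ^ η * (W * Z) := by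
            gcongr
            rw [hZ]; linarith
        _ ≤ _ := by gcongr; linarith

/-! ### The function `V_FT` -/

variable (A : AdaptGains j)

/-- The constant in `V_{A1}`. -/
noncomputable def adaptConst : ℝ := (A.γ₁ ^ (-G.r₁)) ^ (1 / (2 * G.r₂))

lemma adaptConst_pos : 0 < adaptConst G A := by
  have := A.γ₁_pos
  rw [adaptConst]; positivity

lemma exponent_eq : (2 * G.r₂ + G.r₁) * (1 / (2 * G.r₂)) = 1 + G.pw⁻¹ := by
  have := G.r₂_pos.ne'
  rw [← G.inv_pw]; field_simp

lemma VA1_eq {e₁ e₂ : Vec n} {θ : Vec j} (h : 0 ≤ V1 S G A qd e₁ e₂ θ) :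
    VA1 S G A qd e₁ e₂ θ = V1 S G A qd e₁ e₂ θ
      + adaptConst G A * V1 S G A qd e₁ e₂ θ ^ (1 + G.pw⁻¹) := by
  have := A.γ₁_pos
  rw [VA1, Real.mul_rpow (by positivity) (by positivity), ← Real.rpow_mul h, exponent_eq,
    adaptConst]

lemma V1_nonneg {c : ℝ} (hc : 0 < c)
    (hlow : ∀ e₁ e₂ θ, c * homSize G e₁ e₂ θ ≤ V1 S G A qd e₁ e₂ θ) (e₁ e₂ : Vec n) (θ : Vec j) :
    0 ≤ V1 S G A qd e₁ e₂ θ :=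
  (mul_nonneg hc.le (homSize_nonneg G e₁ e₂ θ)).trans (hlow e₁ e₂ θ)

/-- The derivative of the terms of `V_FT` in `V_{A1}` with respect to `V₁`. -/
noncomputable def gainOfV1 (v : ℝ) : ℝ :=
  (3 * (v + adaptConst G A * v ^ (1 + G.pw⁻¹)) ^ (1 / 2 : ℝ)
    + 4 * (v + adaptConst G A * v ^ (1 + G.pw⁻¹)))
    * (1 + adaptConst G A * (1 + G.pw⁻¹) * v ^ G.pw⁻¹)

lemma hasDerivWithinAt_VFT {c d₃ : ℝ} (hc : 0 < c)
    (hlow : ∀ e₁ e₂ θ, c * homSize G e₁ e₂ θ ≤ V1 S G A qd e₁ e₂ θ)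
    {e₁ e₂ : ℝ → Vec n} {θ : ℝ → Vec j} {s : Set ℝ} {t v' u' : ℝ}
    (hV : HasDerivWithinAt (fun r => V1 S G A qd (e₁ r) (e₂ r) (θ r)) v' s t)
    (hU : HasDerivWithinAt
      (fun r => vspow (e₁ r) G.pw ⬝ᵥ (S.inertia (e₁ r + qd) *ᵥ (e₂ r).ofLp)) u' s t) :
    HasDerivWithinAt (fun r => VFT S G A qd 1 1 d₃ (e₁ r) (e₂ r) (θ r))
      (gainOfV1 G A (V1 S G A qd (e₁ t) (e₂ t) (θ t)) * v' + d₃ * u') s t := by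
  have hp := inv_pos.2 G.pw_pos
  have h0 := fun r => V1_nonneg G qd A hc hlow (e₁ r) (e₂ r) (θ r)
  simp only [VFT, VA1_eq G qd A (h0 _)]
  have dA := hV.add ((hV.rpow_const (p := 1 + G.pw⁻¹) (Or.inr (by linarith))).const_mul
    (adaptConst G A))
  have key := (((dA.rpow_const (p := 3 / 2) (Or.inr (by norm_num))).add (dA.fun_pow 2)).const_mul
    ((1 : ℝ) + 1)).add (hU.const_mul (1 * d₃))
  refine HasDerivWithinAt.congr_deriv key ?_
  rw [gainOfV1]
  simp only [Pi.add_apply]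
  rw [show 1 + G.pw⁻¹ - 1 = G.pw⁻¹ by ring, show (3 / 2 - 1 : ℝ) = 1 / 2 by norm_num]
  push_cast
  ring

/-- The terms of `gainOfV1` match those of `dissWeight` one by one once v is bounded below by cN. -/
lemma exists_dissWeight_le_gainOfV1 {c : ℝ} (hc : 0 < c) :
    ∃ m, 0 < m ∧ ∀ N v, 0 ≤ N → c * N ≤ v → m * dissWeight G N ≤ gainOfV1 G A v := by
  have hp := inv_pos.2 G.pw_pos
  have hκ := adaptConst_pos G A
  set κ := adaptConst G A with hκdef
  set m₁ := min (c ^ (1 / 2 : ℝ)) c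
  set m₂ := min 1 (κ * c ^ G.pw⁻¹)
  refine ⟨m₁ * m₂, by positivity, fun N v hN hv => ?_⟩
  have hv0 : 0 ≤ v := (mul_nonneg hc.le hN).trans hv
  rw [gainOfV1, dissWeight, ← hκdef]
  have hA : v ≤ v + κ * v ^ (1 + G.pw⁻¹) := by
    have : 0 ≤ κ * v ^ (1 + G.pw⁻¹) := by positivity
    linarith
  have b₁ : m₁ * N ^ (1 / 2 : ℝ) ≤ (v + κ * v ^ (1 + G.pw⁻¹)) ^ (1 / 2 : ℝ) := by
    calc m₁ * N ^ (1 / 2 : ℝ) ≤ c ^ (1 / 2 : ℝ) * N ^ (1 / 2 : ℝ) := by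
          gcongr; exact min_le_left _ _
      _ = (c * N) ^ (1 / 2 : ℝ) := (Real.mul_rpow hc.le hN).symm
      _ ≤ _ := Real.rpow_le_rpow (by positivity) (hv.trans hA) (by norm_num)
  have b₂ : m₁ * N ≤ v + κ * v ^ (1 + G.pw⁻¹) := by
    calc m₁ * N ≤ c * N := by gcongr; exact min_le_right _ _
      _ ≤ _ := hv.trans hA
  have b₃ : m₂ * (1 + N ^ G.pw⁻¹) ≤ 1 + κ * (1 + G.pw⁻¹) * v ^ G.pw⁻¹ := by
    have e₁ : m₂ * N ^ G.pw⁻¹ ≤ κ * (1 + G.pw⁻¹) * v ^ G.pw⁻¹ := by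
      calc m₂ * N ^ G.pw⁻¹ ≤ κ * c ^ G.pw⁻¹ * N ^ G.pw⁻¹ := by gcongr; exact min_le_right _ _
        _ = κ * 1 * (c * N) ^ G.pw⁻¹ := by rw [Real.mul_rpow hc.le hN]; ring
        _ ≤ _ := by
            gcongr
            linarith
    have e₂ : m₂ ≤ 1 := min_le_left _ _
    linarith
  have hA0 : 0 ≤ v + κ * v ^ (1 + G.pw⁻¹) := by positivity
  have hA1 : 0 ≤ (v + κ * v ^ (1 + G.pw⁻¹)) ^ (1 / 2 : ℝ) := by positivity
  calc m₁ * m₂ * ((N ^ (1 / 2 : ℝ) + N) * (1 + N ^ G.pw⁻¹))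
      = (m₁ * N ^ (1 / 2 : ℝ) + m₁ * N) * (m₂ * (1 + N ^ G.pw⁻¹)) := by ring
    _ ≤ _ := mul_le_mul (by linarith) b₃ (by positivity) (by positivity)

/-- The cross term is of order N^(3/2), like V_{A1}^(3/2). With γ₃ = γ₄ = 1 the latter has
coefficient 2, so one copy can be given up. -/
lemma mul_le_VFT (hS : S.Standing μm μM Lc) {c d₃ : ℝ} (hc : 0 < c) (hd : 0 ≤ d₃)
    (hd₃ : d₃ * μM ≤ c ^ (3 / 2 : ℝ))
    (hlow : ∀ e₁ e₂ θ, c * homSize G e₁ e₂ θ ≤ V1 S G A qd e₁ e₂ θ) (e₁ e₂ : Vec n) (θ : Vec j) :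
    c ^ (3 / 2 : ℝ) * homSize G e₁ e₂ θ ^ (3 / 2 : ℝ) ≤ VFT S G A qd 1 1 d₃ e₁ e₂ θ := by
  have hN := homSize_nonneg G e₁ e₂ θ
  have h0 := V1_nonneg G qd A hc hlow e₁ e₂ θ
  have hU := (neg_le_of_abs_le (abs_cross_le G qd hS e₁ e₂ θ))
  have hκ := adaptConst_pos G A
  have hA : c * homSize G e₁ e₂ θ ≤ VA1 S G A qd e₁ e₂ θ := by
    rw [VA1_eq G qd A h0]
    have : 0 ≤ adaptConst G A * V1 S G A qd e₁ e₂ θ ^ (1 + G.pw⁻¹) := by positivity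
    linarith [hlow e₁ e₂ θ]
  have h1 := Real.rpow_le_rpow (by positivity) hA (show (0 : ℝ) ≤ 3 / 2 by norm_num)
  rw [Real.mul_rpow hc.le hN] at h1
  have hUd := mul_le_mul_of_nonneg_left hU hd
  have h2 := mul_le_mul_of_nonneg_right hd₃ (Real.rpow_nonneg hN (3 / 2))
  have h3 := sq_nonneg (VA1 S G A qd e₁ e₂ θ)
  have h4 : 0 ≤ c ^ (3 / 2 : ℝ) * homSize G e₁ e₂ θ ^ (3 / 2 : ℝ) := by positivity
  rw [VFT]
  change _ ≤ (1 + 1) * _ + 1 * d₃ * (vspow e₁ G.pw ⬝ᵥ (S.inertia (e₁ + qd) *ᵥ e₂.ofLp))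
  linarith

/-- The smallest power, N^(3/2), rules for N ≤ 1 and the largest, the square of N^(1+1/p), for N ≥
1. -/
lemma exists_VFT_le (hS : S.Standing μm μM Lc) {c C d₃ : ℝ} (hc : 0 < c) (hC : 0 < C)
    (hd : 0 ≤ d₃)
    (hlow : ∀ e₁ e₂ θ, c * homSize G e₁ e₂ θ ≤ V1 S G A qd e₁ e₂ θ)
    (hupp : ∀ e₁ e₂ θ, V1 S G A qd e₁ e₂ θ ≤ C * homSize G e₁ e₂ θ) :
    ∃ K, 0 < K ∧ ∀ e₁ e₂ θ,
      (homSize G e₁ e₂ θ ≤ 1 →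
        VFT S G A qd 1 1 d₃ e₁ e₂ θ ≤ K * homSize G e₁ e₂ θ ^ (3 / 2 : ℝ)) ∧
      (1 ≤ homSize G e₁ e₂ θ →
        VFT S G A qd 1 1 d₃ e₁ e₂ θ ≤ K * homSize G e₁ e₂ θ ^ (2 * (1 + G.pw⁻¹))) := by
  have hp := inv_pos.2 G.pw_pos
  have hκ := adaptConst_pos G A
  have hM := hS.μM_pos
  set κ := adaptConst G A with hκdef
  set q := 1 + G.pw⁻¹ with hq
  have hq1 : 1 ≤ q := by linarith
  set C₂ := C + κ * C ^ q with hC₂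
  have hC₂0 : 0 < C₂ := by positivity
  refine ⟨2 * (C₂ ^ (3 / 2 : ℝ) + C₂ ^ 2) + d₃ * μM, by positivity, fun e₁ e₂ θ => ?_⟩
  have hN := homSize_nonneg G e₁ e₂ θ
  have h0 := V1_nonneg G qd A hc hlow e₁ e₂ θ
  have hU := mul_le_mul_of_nonneg_left ((le_abs_self _).trans (abs_cross_le G qd hS e₁ e₂ θ)) hd
  have hVA := VA1_eq G qd A h0
  rw [← hκdef, ← hq] at hVA
  have hA0 : 0 ≤ VA1 S G A qd e₁ e₂ θ := by rw [hVA]; positivity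
  have hVFT : VFT S G A qd 1 1 d₃ e₁ e₂ θ
      = 2 * (VA1 S G A qd e₁ e₂ θ ^ (3 / 2 : ℝ) + VA1 S G A qd e₁ e₂ θ ^ 2)
        + d₃ * (vspow e₁ G.pw ⬝ᵥ (S.inertia (e₁ + qd) *ᵥ e₂.ofLp)) := by
    rw [VFT, PDGains.pw]; ring
  have hA : VA1 S G A qd e₁ e₂ θ ≤ C * homSize G e₁ e₂ θ
      + κ * C ^ q * homSize G e₁ e₂ θ ^ q := by
    rw [hVA]
    have h1 := Real.rpow_le_rpow h0 (hupp e₁ e₂ θ) (by linarith : 0 ≤ q)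
    rw [Real.mul_rpow hC.le hN] at h1
    have h2 := mul_le_mul_of_nonneg_left h1 hκ.le
    linarith [hupp e₁ e₂ θ]
  rw [hVFT]
  set N := homSize G e₁ e₂ θ
  set v := VA1 S G A qd e₁ e₂ θ
  constructor
  · intro h
    have g1 : v ≤ C₂ * N := by
      refine hA.trans ?_
      rw [hC₂, add_mul]
      gcongr
      rcases hN.eq_or_lt with h0 | h0
      · rw [← h0, Real.zero_rpow (by linarith)]
      · simpa using Real.rpow_le_rpow_of_exponent_ge h0 h hq1
    have g2 : v ^ (3 / 2 : ℝ) ≤ C₂ ^ (3 / 2 : ℝ) * N ^ (3 / 2 : ℝ) := by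
      rw [← Real.mul_rpow hC₂0.le hN]
      exact Real.rpow_le_rpow hA0 g1 (by norm_num)
    have g3 : v ^ 2 ≤ C₂ ^ 2 * N ^ (3 / 2 : ℝ) := by
      have : N ^ 2 ≤ N ^ (3 / 2 : ℝ) := by
        rcases hN.eq_or_lt with h0 | h0
        · rw [← h0, Real.zero_rpow (by norm_num)]; simp
        · rw [← Real.rpow_two]
          exact Real.rpow_le_rpow_of_exponent_ge h0 h (by norm_num)
      calc v ^ 2 ≤ (C₂ * N) ^ 2 := by gcongr
        _ = C₂ ^ 2 * N ^ 2 := by ring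
        _ ≤ _ := by gcongr
    linarith
  · intro h
    have g1 : v ≤ C₂ * N ^ q := by
      refine hA.trans ?_
      rw [hC₂, add_mul]
      gcongr
      simpa using Real.rpow_le_rpow_of_exponent_le h hq1
    have hN0 : 0 ≤ N ^ q := by positivity
    have g2 : v ^ (3 / 2 : ℝ) ≤ C₂ ^ (3 / 2 : ℝ) * N ^ (2 * q) := by
      calc v ^ (3 / 2 : ℝ) ≤ (C₂ * N ^ q) ^ (3 / 2 : ℝ) := Real.rpow_le_rpow hA0 g1 (by norm_num)
        _ = C₂ ^ (3 / 2 : ℝ) * N ^ (q * (3 / 2)) := by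
            rw [Real.mul_rpow hC₂0.le hN0, ← Real.rpow_mul hN]
        _ ≤ _ := mul_le_mul_of_nonneg_left
            (Real.rpow_le_rpow_of_exponent_le h (by linarith)) (by positivity)
    have g3 : v ^ 2 ≤ C₂ ^ 2 * N ^ (2 * q) := by
      calc v ^ 2 ≤ (C₂ * N ^ q) ^ 2 := by gcongr
        _ = C₂ ^ 2 * N ^ (2 * q) := by
            rw [mul_pow, ← Real.rpow_natCast (N ^ q), ← Real.rpow_mul hN]
            push_cast
            rw [mul_comm q]
    have g4 : N ^ (3 / 2 : ℝ) ≤ N ^ (2 * q) :=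
      Real.rpow_le_rpow_of_exponent_le h (by linarith)
    have g5 := mul_le_mul_of_nonneg_left g4 (show 0 ≤ d₃ * μM by positivity)
    linarith

end

section

variable {n k j : ℕ} {S : Plant n k j} (G : PDGains n) (qd : Vec n) {μm μM Lc : ℝ}
  (A : AdaptGains j)

/-! ### The decay of `V_FT` -/

namespace PDGains

/-- The exponent `σ₁` of the decay of `V_FT` near the origin. -/
noncomputable def σ₁ : ℝ := (4 * G.r₂ - G.r₁) / (3 * G.r₂)

/-- The exponent `σ₂` of the decay of `V_FT` far from the origin. -/
noncomputable def σ₂ : ℝ := 3 * G.r₂ / (2 * (2 * G.r₂ + G.r₁))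

lemma one_sub_σ₁ : 1 - G.σ₁ = (G.r₁ - G.r₂) / (3 * G.r₂) := by
  have := G.r₂_pos.ne'
  rw [σ₁]; field_simp; ring

lemma σ₁_lt_one : G.σ₁ < 1 := by
  have h := G.one_sub_σ₁
  have : 0 < (G.r₁ - G.r₂) / (3 * G.r₂) :=
    div_pos (by linarith [G.r₂_lt]) (by linarith [G.r₂_pos])
  linarith

lemma σ₁_pos : 0 < G.σ₁ := div_pos (by linarith [G.r₁_lt, G.r₂_pos]) (by linarith [G.r₂_pos])

lemma σ₂_pos : 0 < G.σ₂ := div_pos (by linarith [G.r₂_pos]) (by linarith [G.r₁_pos, G.r₂_pos])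

lemma σ₂_lt_one : G.σ₂ < 1 := by
  rw [σ₂, div_lt_one (by linarith [G.r₁_pos, G.r₂_pos])]
  linarith [G.r₁_pos, G.r₂_pos]

lemma mul_σ₁ : 3 / 2 * G.σ₁ = 1 + G.b / 2 := by
  have := G.r₂_pos.ne'
  rw [σ₁, b]; field_simp; ring

lemma mul_σ₂ : 2 * (1 + G.pw⁻¹) * G.σ₂ = 3 / 2 := by
  have := G.r₂_pos
  have := G.r₁_pos
  have h : (2 * G.r₂ + G.r₁) ≠ 0 := by positivity
  rw [σ₂, ← G.inv_pw]; field_simp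

end PDGains

/-- Passage from decay in N to decay in V, through (3/2)σ₁ = 1 + b/2 and 2(1+1/p)σ₂ = 3/2. The
minimum allows one formula for both regimes. -/
lemma min_rpow_le {N V K : ℝ} (hN : 0 ≤ N) (hV : 0 ≤ V) (hK : 0 < K)
    (h₁ : N ≤ 1 → V ≤ K * N ^ (3 / 2 : ℝ)) (h₂ : 1 ≤ N → V ≤ K * N ^ (2 * (1 + G.pw⁻¹))) {c Y : ℝ}
    (hc : 0 ≤ c) (g₁ : N ≤ 1 → c * N ^ (1 + G.b / 2) ≤ Y) (g₂ : 1 ≤ N → c * N ^ (3 / 2 : ℝ) ≤ Y) :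
    c * min (V ^ G.σ₁) (V ^ G.σ₂) ≤ max (K ^ G.σ₁) (K ^ G.σ₂) * Y := by
  have hKm : 0 < K ^ G.σ₁ := by positivity
  rcases le_total N 1 with h | h
  · have hY : 0 ≤ Y := (by positivity : 0 ≤ c * N ^ (1 + G.b / 2)).trans (g₁ h)
    have e : V ^ G.σ₁ ≤ K ^ G.σ₁ * N ^ (1 + G.b / 2) := by
      rw [← G.mul_σ₁, Real.rpow_mul hN, ← Real.mul_rpow hK.le (by positivity)]
      exact Real.rpow_le_rpow hV (h₁ h) G.σ₁_pos.le
    calc c * min (V ^ G.σ₁) (V ^ G.σ₂) ≤ c * (K ^ G.σ₁ * N ^ (1 + G.b / 2)) := by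
          gcongr; exact (min_le_left _ _).trans e
      _ = K ^ G.σ₁ * (c * N ^ (1 + G.b / 2)) := by ring
      _ ≤ K ^ G.σ₁ * Y := by gcongr; exact g₁ h
      _ ≤ _ := by gcongr; exact le_max_left _ _
  · have hY : 0 ≤ Y := (by positivity : 0 ≤ c * N ^ (3 / 2 : ℝ)).trans (g₂ h)
    have e : V ^ G.σ₂ ≤ K ^ G.σ₂ * N ^ (3 / 2 : ℝ) := by
      rw [← G.mul_σ₂, Real.rpow_mul hN, ← Real.mul_rpow hK.le (by positivity)]
      exact Real.rpow_le_rpow hV (h₂ h) G.σ₂_pos.le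
    calc c * min (V ^ G.σ₁) (V ^ G.σ₂) ≤ c * (K ^ G.σ₂ * N ^ (3 / 2 : ℝ)) := by
          gcongr; exact (min_le_right _ _).trans e
      _ = K ^ G.σ₂ * (c * N ^ (3 / 2 : ℝ)) := by ring
      _ ≤ K ^ G.σ₂ * Y := by gcongr; exact g₂ h
      _ ≤ _ := by gcongr; exact le_max_right _ _

lemma exists_VFT_decay (hS : S.Standing μm μM Lc)
    (hd : ∀ i, A.d₁ ≤ G.DL i * μm / μM ^ 2)
    (h1 : ∀ i, A.γ₁ * A.d₁ * (μM + Lc * Real.sqrt n) ≤ (A.γ₁ + A.γ₂) * (G.DL i / 2))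
    (h2 : ∀ i, A.γ₁ * A.d₁ * youngConst G i ≤ (A.γ₁ + A.γ₂) * (G.D i / 2)) :
    ∃ d₃ c₃ c K, 0 < d₃ ∧ 0 < c₃ ∧ 0 < c ∧ 0 < K ∧
      (∀ e₁ e₂ θ, c * homSize G e₁ e₂ θ ^ (3 / 2 : ℝ) ≤ VFT S G A qd 1 1 d₃ e₁ e₂ θ) ∧
      (∀ e₁ e₂ θ, (homSize G e₁ e₂ θ ≤ 1 →
          VFT S G A qd 1 1 d₃ e₁ e₂ θ ≤ K * homSize G e₁ e₂ θ ^ (3 / 2 : ℝ)) ∧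
        (1 ≤ homSize G e₁ e₂ θ →
          VFT S G A qd 1 1 d₃ e₁ e₂ θ ≤ K * homSize G e₁ e₂ θ ^ (2 * (1 + G.pw⁻¹)))) ∧
      ∀ (e₁ e₂ : ℝ → Vec n) (θ : ℝ → Vec j) (ζ t : ℝ) (s : Set ℝ), 0 ≤ ζ → ζ ≤ 1 →
        HasDerivWithinAt e₁ (e₂ t) s t →
        HasDerivWithinAt e₂ (velField S G qd (e₁ t) (e₂ t) (θ t)) s t →
        HasDerivWithinAt θ (adaptField S G A qd ζ (e₁ t) (e₂ t) (θ t)) s t →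
        ∃ v', HasDerivWithinAt (fun r => VFT S G A qd 1 1 d₃ (e₁ r) (e₂ r) (θ r)) v' s t ∧
          v' ≤ -(c₃ * ζ * min (VFT S G A qd 1 1 d₃ (e₁ t) (e₂ t) (θ t) ^ G.σ₁)
            (VFT S G A qd 1 1 d₃ (e₁ t) (e₂ t) (θ t) ^ G.σ₂)) := by
  have hM := hS.μM_pos
  obtain ⟨c, hc, hlow⟩ := exists_mul_homSize_le_V1 G A qd hS hd
  obtain ⟨C, hC, hupp⟩ := exists_V1_le_mul_homSize G A qd hS
  obtain ⟨c₁, hc₁, hV1⟩ := exists_V1Deriv_le G A qd hS h1 h2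
  obtain ⟨cQ, CU, hcQ, hCU, hU⟩ := exists_crossDeriv_le (S := S) G qd hS
  obtain ⟨m, hm, hgain⟩ := exists_dissWeight_le_gainOfV1 G A hc
  obtain ⟨c₅, hc₅, hdiss⟩ := exists_le_dissipation (j := j) G
  -- The first bound lets half of the decay of the V₁ part absorb the indefinite terms of the cross
  -- derivative; the second keeps V_FT positive.
  set d₃ := min (m * c₁ / (2 * CU)) (c ^ (3 / 2 : ℝ) / μM) with hd₃def
  have hd₃ : 0 < d₃ := by positivity
  have hd₃a : d₃ * CU ≤ m * c₁ / 2 := by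
    have : d₃ ≤ m * c₁ / (2 * CU) := min_le_left _ _
    rw [le_div_iff₀ (by positivity)] at this
    linarith
  have hd₃b : d₃ * μM ≤ c ^ (3 / 2 : ℝ) := by
    have : d₃ ≤ c ^ (3 / 2 : ℝ) / μM := min_le_right _ _
    rwa [le_div_iff₀ hM] at this
  obtain ⟨K, hK, hVupp⟩ := exists_VFT_le G qd A hS hc hC hd₃.le hlow hupp
  have hVlow := mul_le_VFT G qd A hS hc hd₃.le hd₃b hlow
  -- The remaining half of the weighted dissipation, and the decay that the cross term contributes.
  set c₄ := min (m * c₁ / 2) (d₃ * cQ) with hc₄def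
  have hc₄ : 0 < c₄ := by positivity
  set K' := max (K ^ G.σ₁) (K ^ G.σ₂) with hK'def
  have hK' : 0 < K' := (Real.rpow_pos_of_pos hK _).trans_le (le_max_left _ _)
  refine ⟨d₃, c₄ * c₅ / K', c ^ (3 / 2 : ℝ), K, hd₃, by positivity, by positivity, hK, hVlow, hVupp,
    fun e₁ e₂ θ ζ t s hζ hζ1 d₁ d₂ dθ => ?_⟩
  refine ⟨_, hasDerivWithinAt_VFT G qd A hc hlow (hasDerivWithinAt_V1 G A qd hS d₁ d₂ dθ)
    (hasDerivWithinAt_cross G qd hS d₁ d₂), ?_⟩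
  have a₁ := hV1 ζ (e₁ t) (e₂ t) (θ t) hζ
  have a₂ := hU ζ (e₁ t) (e₂ t) (θ t) hζ
  have hN := homSize_nonneg G (e₁ t) (e₂ t) (θ t)
  have a₃ := hgain _ _ hN (hlow (e₁ t) (e₂ t) (θ t))
  obtain ⟨b₁, b₂⟩ := hdiss ζ (e₁ t) (e₂ t) (θ t) hζ hζ1
  obtain ⟨k₁, k₂⟩ := hVupp (e₁ t) (e₂ t) (θ t)
  have k₀ := hVlow (e₁ t) (e₂ t) (θ t)
  have hZ := dissipation_nonneg G hζ (e₁ t) (e₂ t) (θ t)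
  have hW := dissWeight_nonneg G hN
  set N := homSize G (e₁ t) (e₂ t) (θ t)
  set V := VFT S G A qd 1 1 d₃ (e₁ t) (e₂ t) (θ t)
  set g := gainOfV1 G A (V1 S G A qd (e₁ t) (e₂ t) (θ t))
  set W := dissWeight G N
  set Z := dissipation G ζ (e₁ t) (e₂ t) (θ t)
  set Q := ∑ i, |(e₁ t) i| ^ (G.pw + G.a) with hQdef
  have hQ : 0 ≤ Q := by positivity
  have hV : 0 ≤ V := (by positivity : 0 ≤ c ^ (3 / 2 : ℝ) * N ^ (3 / 2 : ℝ)).trans k₀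
  have key := min_rpow_le G hN hV hK k₁ k₂ (c := c₅ * ζ) (Y := W * Z + Q) (by positivity)
    (fun h => by rw [mul_assoc]; exact b₁ h) (fun h => by rw [mul_assoc]; exact b₂ h)
  have hg : 0 ≤ g := (mul_nonneg hm.le hW).trans a₃
  have s₁ := mul_le_mul_of_nonneg_left a₁ hg
  have s₂ := mul_le_mul_of_nonneg_left a₂ hd₃.le
  have s₃ : m * W * (c₁ * Z) ≤ g * (c₁ * Z) := by gcongr
  have s₄ : d₃ * CU * (W * Z) ≤ m * c₁ / 2 * (W * Z) := by gcongr
  have s₅ : c₄ * (W * Z) ≤ m * c₁ / 2 * (W * Z) := by gcongr; exact min_le_left _ _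
  have s₆ : c₄ * Q ≤ d₃ * cQ * Q := by gcongr; exact min_le_right _ _
  have s₇ : c₄ * c₅ / K' * ζ * min (V ^ G.σ₁) (V ^ G.σ₂) ≤ c₄ * (W * Z + Q) := by
    calc _ = c₄ / K' * (c₅ * ζ * min (V ^ G.σ₁) (V ^ G.σ₂)) := by field_simp
      _ ≤ c₄ / K' * (K' * (W * Z + Q)) := by gcongr
      _ = _ := by field_simp
  linarith

/-! ### The size of the state and its norm -/

lemma stateNorm_nonneg (e₁ e₂ : Vec n) (θ : Vec j) : 0 ≤ stateNorm e₁ e₂ θ := Real.sqrt_nonneg _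

lemma stateNorm_sq (e₁ e₂ : Vec n) (θ : Vec j) :
    stateNorm e₁ e₂ θ ^ 2 = ‖e₁‖ ^ 2 + ‖e₂‖ ^ 2 + ‖θ‖ ^ 2 := by
  rw [stateNorm, Real.sq_sqrt (by positivity)]

/-- An upper bound of the size of the state in terms of its norm. -/
noncomputable def sizeBound (s : ℝ) : ℝ := ((n : ℝ) + 1) * s ^ G.pw + s ^ (2 : ℝ)

/-- The coefficient n + 1 instead of n is positive also for n = 0, so `IsClassKInf.const_mul`
applies. -/
lemma isClassKInf_sizeBound : IsClassKInf (sizeBound G) :=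
  ((isClassKInf_rpow G.pw_pos).const_mul (by positivity)).add (isClassKInf_rpow (by norm_num))

lemma homSize_le_sizeBound (e₁ e₂ : Vec n) (θ : Vec j) :
    homSize G e₁ e₂ θ ≤ sizeBound G (stateNorm e₁ e₂ θ) := by
  have hs := stateNorm_nonneg e₁ e₂ θ
  have hsq := stateNorm_sq e₁ e₂ θ
  set s := stateNorm e₁ e₂ θ
  rw [homSize, sizeBound, Real.rpow_two]
  have h1 : ∀ i, |e₁ i| ≤ s := fun i => (abs_apply_le_norm e₁ i).trans
    (le_of_sq_le_sq (by nlinarith [sq_nonneg ‖e₂‖, sq_nonneg ‖θ‖]) hs)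
  have h2 : ∑ i, |e₁ i| ^ G.pw ≤ n * s ^ G.pw := by
    calc ∑ i, |e₁ i| ^ G.pw ≤ ∑ _i : Fin n, s ^ G.pw :=
          Finset.sum_le_sum fun i _ => Real.rpow_le_rpow (abs_nonneg _) (h1 i) G.pw_pos.le
      _ = _ := by simp
  have h3 : 0 ≤ s ^ G.pw := by positivity
  nlinarith [sq_nonneg ‖e₁‖]

lemma stateNorm_sq_le (e₁ e₂ : Vec n) (θ : Vec j) :
    stateNorm e₁ e₂ θ ^ 2 ≤
      ((n : ℝ) + 1) * homSize G e₁ e₂ θ ^ (2 * G.pw⁻¹) + homSize G e₁ e₂ θ := by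
  have hN := homSize_nonneg G e₁ e₂ θ
  rw [stateNorm_sq]
  have h1 : ‖e₁‖ ^ 2 ≤ n * homSize G e₁ e₂ θ ^ (2 * G.pw⁻¹) := by
    rw [EuclideanSpace.real_norm_sq_eq]
    calc ∑ i, e₁ i ^ 2 ≤ ∑ _i : Fin n, homSize G e₁ e₂ θ ^ (2 * G.pw⁻¹) := by
          refine Finset.sum_le_sum fun i _ => ?_
          rw [mul_comm, Real.rpow_mul hN, Real.rpow_two, ← sq_abs]
          gcongr
          exact abs_le_homSize_rpow G e₁ e₂ θ i
      _ = _ := by simp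
  have h2 : ‖e₂‖ ^ 2 + ‖θ‖ ^ 2 ≤ homSize G e₁ e₂ θ := by
    rw [homSize]
    have : 0 ≤ ∑ i, |e₁ i| ^ G.pw := by positivity
    linarith
  have h3 : 0 ≤ homSize G e₁ e₂ θ ^ (2 * G.pw⁻¹) := by positivity
  linarith

/-- A lower bound of the size of the state in terms of its norm. -/
noncomputable def sizeLower (s : ℝ) : ℝ :=
  min ((((n : ℝ) + 2)⁻¹ * s ^ (2 : ℝ)) ^ (G.pw / 2)) (((n : ℝ) + 2)⁻¹ * s ^ (2 : ℝ))

lemma isClassKInf_sizeLower : IsClassKInf (sizeLower G) := by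
  have h := (isClassKInf_rpow (q := 2) (by norm_num)).const_mul
    (show 0 < ((n : ℝ) + 2)⁻¹ by positivity)
  exact (h.rpow (half_pos G.pw_pos)).min h

/-- ‖x‖² is at most n + 2 times the larger of N^(2/p) and N; the two branches of the minimum invert
these two powers. -/
lemma sizeLower_le_homSize (e₁ e₂ : Vec n) (θ : Vec j) :
    sizeLower G (stateNorm e₁ e₂ θ) ≤ homSize G e₁ e₂ θ := by
  have hN := homSize_nonneg G e₁ e₂ θ
  have h := stateNorm_sq_le G e₁ e₂ θ
  rw [sizeLower, Real.rpow_two]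
  set N := homSize G e₁ e₂ θ
  set s := stateNorm e₁ e₂ θ
  have hp := G.pw_pos
  have hn : (0 : ℝ) < (n : ℝ) + 2 := by positivity
  rcases le_total (N ^ (2 * G.pw⁻¹)) N with h1 | h1
  · refine (min_le_right _ _).trans ?_
    rw [inv_mul_le_iff₀ hn]
    have := mul_le_mul_of_nonneg_left h1 (show 0 ≤ (n : ℝ) + 1 by positivity)
    linarith
  · refine (min_le_left _ _).trans ?_
    have h2 : ((n : ℝ) + 2)⁻¹ * s ^ 2 ≤ N ^ (2 * G.pw⁻¹) := by
      rw [inv_mul_le_iff₀ hn]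
      linarith
    refine (Real.rpow_le_rpow (by positivity) h2 (half_pos hp).le).trans_eq ?_
    rw [← Real.rpow_mul hN, show 2 * G.pw⁻¹ * (G.pw / 2) = 1 by field_simp, Real.rpow_one]

/-! ### Uniform global stability -/

lemma uniformlyGloballyStable (hS : S.Standing μm μM Lc) (L : DREGains) (p : Parameterization)
    (hd : ∀ i, A.d₁ ≤ G.DL i * μm / μM ^ 2)
    (h1 : ∀ i, A.γ₁ * A.d₁ * (μM + Lc * Real.sqrt n) ≤ (A.γ₁ + A.γ₂) * (G.DL i / 2))
    (h2 : ∀ i, A.γ₁ * A.d₁ * youngConst G i ≤ (A.γ₁ + A.γ₂) * (G.D i / 2)) :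
    UniformlyGloballyStable S G A L qd p := by
  obtain ⟨c, hc, hlow⟩ := exists_mul_homSize_le_V1 G A qd hS hd
  obtain ⟨C, hC, hupp⟩ := exists_V1_le_mul_homSize G A qd hS
  obtain ⟨c₁, hc₁, hV1⟩ := exists_V1Deriv_le G A qd hS h1 h2
  have hp := inv_pos.2 G.pw_pos
  have hν := (isClassKInf_sizeBound G).const_mul (div_pos hC hc)
  refine ⟨fun s => (((n : ℝ) + 1) * (C / c * sizeBound G s) ^ (2 * G.pw⁻¹)
    + C / c * sizeBound G s) ^ (1 / 2 : ℝ),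
    (((hν.rpow (by positivity)).const_mul (by positivity)).add hν).rpow (by norm_num), ?_⟩
  intro τ X hX t ht htτ
  have hmono : V1 S G A qd (X.e₁ t) (X.e₂ t) (X.θ t) ≤ V1 S G A qd (X.e₁ 0) (X.e₂ 0) (X.θ 0) := by
    refine le_of_hasDerivWithinAt_nonpos
      (f := fun r => V1 S G A qd (X.e₁ r) (X.e₂ r) (X.θ r)) le_rfl ht fun r hr => ?_
    have hr' : (r : EReal) < τ := (EReal.coe_le_coe_iff.2 hr.2).trans_lt htτ
    refine ⟨_, hasDerivWithinAt_V1 G A qd hS (hX.deriv_e₁ r hr.1 hr') (hX.deriv_e₂ r hr.1 hr')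
      (hX.deriv_θ r hr.1 hr'), ?_⟩
    have hζ := zeta1_nonneg G.b A.d (X.Δ L r) G.b_pos A.d_pos
    refine (hV1 _ _ _ _ hζ).trans ?_
    have := mul_nonneg hc₁.le (dissipation_nonneg G hζ (X.e₁ r) (X.e₂ r) (X.θ r))
    linarith
  have hN : homSize G (X.e₁ t) (X.e₂ t) (X.θ t) ≤ C / c * sizeBound G (X.normAt 0) := by
    rw [div_mul_eq_mul_div, le_div_iff₀ hc, mul_comm]
    refine ((hlow _ _ _).trans (hmono.trans (hupp _ _ _))).trans ?_
    gcongr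
    exact homSize_le_sizeBound G _ _ _
  have hN0 := homSize_nonneg G (X.e₁ t) (X.e₂ t) (X.θ t)
  refine le_rpow_half_of_sq_le ((stateNorm_sq_le G _ _ _).trans ?_)
  gcongr

end

/-! ### Linear differential equations -/

lemma eq_of_hasDerivWithinAt_zero {f : ℝ → ℝ}
    (h : ∀ t, 0 ≤ t → HasDerivWithinAt f 0 (Ici 0) t) {t : ℝ} (ht : 0 ≤ t) : f t = f 0 := by
  apply le_antisymm
  · exact le_of_hasDerivWithinAt_nonpos le_rfl ht fun s hs => ⟨0, h s hs.1, le_rfl⟩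
  · have := le_of_hasDerivWithinAt_nonpos (f := fun s => -f s) le_rfl ht
      fun s hs => ⟨-0, (h s hs.1).neg, by simp⟩
    linarith

/-- Grönwall's inequality, by the integrating factor e^(-Kt). -/
lemma nonpos_of_hasDerivWithinAt_le {f : ℝ → ℝ} {K τ : ℝ} (h0 : f 0 ≤ 0)
    (h : ∀ t ∈ Icc 0 τ, ∃ f', HasDerivWithinAt f f' (Ici 0) t ∧ f' ≤ K * f t) (hτ : 0 ≤ τ) :
    f τ ≤ 0 := by
  have key := le_of_hasDerivWithinAt_nonpos (f := fun t => Real.exp (-K * t) * f t) le_rfl hτ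
    fun t ht => by
      obtain ⟨f', hf, hle⟩ := h t ht
      refine ⟨_, ((((hasDerivAt_id t).const_mul (-K)).exp).hasDerivWithinAt).mul hf, ?_⟩
      have he := Real.exp_pos (-K * t)
      have := mul_le_mul_of_nonneg_left hle he.le
      simp only [id, mul_one]
      linarith
  simp only [mul_zero, Real.exp_zero, one_mul] at key
  have he := Real.exp_pos (-K * τ)
  by_contra hc
  push Not at hc
  have := mul_pos he hc
  linarith

/-- Signals are controlled on [0, ∞) only. Freezing them at their value at 0 for negative times
gives integrands that are continuous on the whole line. -/
lemma continuous_comp_max {f : ℝ → ℝ} (hf : ContinuousOn f (Ici 0)) :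
    Continuous fun s => f (max s 0) :=
  hf.comp_continuous (continuous_id.max continuous_const) fun _ => mem_Ici.2 (le_max_right _ _)

lemma hasDerivWithinAt_integral {f : ℝ → ℝ} (hf : ContinuousOn f (Ici 0)) {t : ℝ} (ht : 0 ≤ t) :
    HasDerivWithinAt (fun u => ∫ s in (0 : ℝ)..u, f (max s 0)) (f t) (Ici 0) t := by
  have := ((continuous_comp_max hf).integral_hasStrictDerivAt 0 t).hasDerivAt
  rw [max_eq_left ht] at this
  exact this.hasDerivWithinAt

lemma intervalIntegrable_sum {ι : Type*} [Fintype ι] {f : ι → ℝ → ℝ} {a b : ℝ}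
    (h : ∀ i, IntervalIntegrable (f i) MeasureTheory.volume a b) :
    IntervalIntegrable (fun s => ∑ i, f i s) MeasureTheory.volume a b := by
  have := IntervalIntegrable.sum Finset.univ fun i _ => h i
  rwa [Finset.sum_fn] at this

/-- The product of z and exp ∫β is constant. -/
lemma pos_of_linear_ode {z β : ℝ → ℝ} (hβ : ContinuousOn β (Ici 0)) (h0 : 0 < z 0)
    (hz : ∀ t, 0 ≤ t → HasDerivWithinAt z (-(β t) * z t) (Ici 0) t) {t : ℝ} (ht : 0 ≤ t) :
    0 < z t := by
  have h := eq_of_hasDerivWithinAt_zero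
    (f := fun u => Real.exp (∫ s in (0 : ℝ)..u, β (max s 0)) * z u) (fun u hu => by
      have := ((hasDerivWithinAt_integral hβ hu).exp).mul (hz u hu)
      refine HasDerivWithinAt.congr_deriv this ?_
      ring) ht
  simp only [intervalIntegral.integral_same, Real.exp_zero, one_mul] at h
  have he := Real.exp_pos (∫ s in (0 : ℝ)..t, β (max s 0))
  by_contra hc
  push Not at hc
  have := mul_nonpos_of_nonneg_of_nonpos he.le hc
  linarith

section MatrixODE

variable {κ : Type} [Fintype κ]

lemma sum_mul_mul_le (A Y : Matrix κ κ ℝ) {B : ℝ} (hA : ∀ a c, |A a c| ≤ B) :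
    ∑ a, ∑ b, Y a b * (A * Y) a b ≤ B * Fintype.card κ * ∑ a, ∑ b, Y a b ^ 2 := by
  have h1 : ∀ a b c, Y a b * (A a c * Y c b) ≤ B / 2 * (Y a b ^ 2 + Y c b ^ 2) := by
    intro a b c
    have hB : 0 ≤ B := (abs_nonneg _).trans (hA a c)
    have h2 := abs_le.1 (hA a c)
    rcases le_total 0 (Y a b * Y c b) with h | h
    · nlinarith [sq_nonneg (Y a b - Y c b), mul_le_mul_of_nonneg_right h2.2 h]
    · nlinarith [sq_nonneg (Y a b + Y c b), mul_le_mul_of_nonpos_right h2.1 h]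
  calc ∑ a, ∑ b, Y a b * (A * Y) a b = ∑ a, ∑ b, ∑ c, Y a b * (A a c * Y c b) := by
        simp only [Matrix.mul_apply, Finset.mul_sum]
    _ ≤ ∑ a, ∑ b, ∑ c, B / 2 * (Y a b ^ 2 + Y c b ^ 2) :=
        Finset.sum_le_sum fun a _ => Finset.sum_le_sum fun b _ => Finset.sum_le_sum fun c _ =>
          h1 a b c
    _ = B / 2 * (∑ a, ∑ b, ∑ _c : κ, Y a b ^ 2 + ∑ _a : κ, ∑ b, ∑ c, Y c b ^ 2) := by
        simp only [← Finset.mul_sum, Finset.sum_add_distrib]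
    _ = B * Fintype.card κ * ∑ a, ∑ b, Y a b ^ 2 := by
        have : ∑ b, ∑ c, Y c b ^ 2 = ∑ a, ∑ b, Y a b ^ 2 := Finset.sum_comm
        rw [this]
        simp only [Finset.sum_const, Finset.card_univ, nsmul_eq_mul, ← Finset.mul_sum]
        ring

/-- Grönwall for the squared Frobenius norm, with the entries of A bounded on the compact interval
[0, t]. -/
lemma eq_zero_of_matrix_linear_ode {A Y : ℝ → Matrix κ κ ℝ}
    (hA : ∀ a b, ContinuousOn (fun t => A t a b) (Ici 0))
    (hY : ∀ t, 0 ≤ t → ∀ a b, HasDerivWithinAt (fun s => Y s a b) ((A t * Y t) a b) (Ici 0) t)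
    (h0 : Y 0 = 0) {t : ℝ} (ht : 0 ≤ t) : Y t = 0 := by
  have hB : ∃ B, ∀ s ∈ Icc 0 t, ∀ a b, |A s a b| ≤ B := by
    have := fun ab : κ × κ => isCompact_Icc.exists_bound_of_continuousOn
      ((hA ab.1 ab.2).mono (fun s (hs : s ∈ Icc 0 t) => mem_Ici.2 hs.1))
    choose C hC using this
    obtain ⟨B, -, hB⟩ := exists_ge_of_finite C
    exact ⟨B, fun s hs a b => (hC (a, b) s hs).trans (hB (a, b))⟩
  obtain ⟨B, hB⟩ := hB
  have key := nonpos_of_hasDerivWithinAt_le (f := fun s => ∑ a, ∑ b, Y s a b ^ 2)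
    (K := 2 * (B * Fintype.card κ)) (τ := t) (by simp [h0]) (fun s hs => by
      refine ⟨_, HasDerivWithinAt.fun_sum fun a _ => HasDerivWithinAt.fun_sum fun b _ =>
        (hY s hs.1 a b).fun_pow 2, ?_⟩
      have := sum_mul_mul_le (A s) (Y s) (hB s hs)
      simp only [Nat.cast_ofNat, Nat.reduceSub, pow_one, mul_assoc, ← Finset.mul_sum] at this ⊢
      linarith) ht
  have hz : ∑ a, ∑ b, Y t a b ^ 2 = 0 := le_antisymm key (by positivity)
  ext a b
  have h1 := (Finset.sum_eq_zero_iff_of_nonneg (fun a _ => by positivity)).1 hz a (Finset.mem_univ a)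
  have h2 := (Finset.sum_eq_zero_iff_of_nonneg (fun b _ => by positivity)).1 h1 b (Finset.mem_univ b)
  simpa using h2

lemma hasDerivWithinAt_matrix_mul {P R : ℝ → Matrix κ κ ℝ} {P' R' : Matrix κ κ ℝ} {s : Set ℝ}
    {t : ℝ} (hP : ∀ a b, HasDerivWithinAt (fun r => P r a b) (P' a b) s t)
    (hR : ∀ a b, HasDerivWithinAt (fun r => R r a b) (R' a b) s t) (a b : κ) :
    HasDerivWithinAt (fun r => (P r * R r) a b) ((P' * R t + P t * R') a b) s t := by
  simp only [Matrix.mul_apply, Matrix.add_apply, ← Finset.sum_add_distrib]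
  exact HasDerivWithinAt.fun_sum fun c _ => (hP a c).fun_mul (hR c b)

lemma continuousOn_matrix_mul {P R : ℝ → Matrix κ κ ℝ} {s : Set ℝ}
    (hP : ∀ a b, ContinuousOn (fun r => P r a b) s)
    (hR : ∀ a b, ContinuousOn (fun r => R r a b) s) (a b : κ) :
    ContinuousOn (fun r => (P r * R r) a b) s := by
  simp only [Matrix.mul_apply]
  exact continuousOn_finsetSum _ fun c _ => (hP a c).mul (hR c b)

variable [DecidableEq κ]

lemma continuousOn_specNorm {P : ℝ → Matrix κ κ ℝ} {s : Set ℝ}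
    (hP : ∀ a b, ContinuousOn (fun r => P r a b) s) : ContinuousOn (fun r => specNorm (P r)) s := by
  have h : Continuous (Matrix.toEuclideanCLM (n := κ) (𝕜 := ℝ)) :=
    LinearMap.continuous_of_finiteDimensional
      (Matrix.toEuclideanCLM (n := κ) (𝕜 := ℝ)).toAlgEquiv.toLinearMap
  exact (h.comp_continuousOn (continuousOn_pi.2 fun a => continuousOn_pi.2 fun b => hP a b)).norm

/-! ### Least squares with forgetting factor -/

/-- The signals of the least-squares estimator with forgetting factor, for the matrix
`R = ΩᵀΩ`. -/
structure IsLeastSquares (α f₀ β₀ ξ : ℝ) (R F : ℝ → Matrix κ κ ℝ) (z : ℝ → ℝ) : Prop where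
  α_pos : 0 < α
  f₀_pos : 0 < f₀
  β₀_pos : 0 < β₀
  ξ_ge : 1 / f₀ ≤ ξ
  cont : ∀ a b, ContinuousOn (fun t => R t a b) (Ici 0)
  symm : ∀ t, (R t)ᵀ = R t
  nonneg : ∀ t (v : κ → ℝ), 0 ≤ v ⬝ᵥ (R t *ᵥ v)
  F_zero : F 0 = (1 / f₀) • (1 : Matrix κ κ ℝ)
  z_zero : z 0 = 1
  deriv_F : ∀ t, 0 ≤ t → ∀ a b, HasDerivWithinAt (fun s => F s a b)
    ((-α • (F t * R t * F t) + (β₀ * (1 - specNorm (F t) / ξ)) • F t) a b) (Ici 0) t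
  deriv_z : ∀ t, 0 ≤ t → HasDerivWithinAt z (-(β₀ * (1 - specNorm (F t) / ξ)) * z t) (Ici 0) t

/-- The information matrix `f₀ I + ∫ α z⁻¹ R`. -/
noncomputable def infoMatrix (α f₀ : ℝ) (R : ℝ → Matrix κ κ ℝ) (z : ℝ → ℝ) (t : ℝ) :
    Matrix κ κ ℝ :=
  f₀ • 1 + Matrix.of fun a b => ∫ s in (0 : ℝ)..t, α * (z (max s 0))⁻¹ * R (max s 0) a b

namespace IsLeastSquares

variable {α f₀ β₀ ξ : ℝ} {R F : ℝ → Matrix κ κ ℝ} {z : ℝ → ℝ}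
  (h : IsLeastSquares α f₀ β₀ ξ R F z)

include h

lemma z_pos {t : ℝ} (ht : 0 ≤ t) : 0 < z t := by
  refine pos_of_linear_ode (β := fun t => β₀ * (1 - specNorm (F t) / ξ)) ?_ (by simp [h.z_zero])
    h.deriv_z ht
  have : ContinuousOn (fun t => specNorm (F t)) (Ici 0) :=
    continuousOn_specNorm fun a b t ht => (h.deriv_F t ht a b).continuousWithinAt
  exact continuousOn_const.mul (continuousOn_const.sub (this.div_const ξ))

lemma cont_z : ContinuousOn z (Ici 0) := fun t ht => (h.deriv_z t ht).continuousWithinAt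

lemma cont_integrand (a b : κ) : ContinuousOn (fun t => α * (z t)⁻¹ * R t a b) (Ici 0) :=
  (continuousOn_const.mul (h.cont_z.inv₀ fun _ ht => (h.z_pos ht).ne')).mul (h.cont a b)

lemma deriv_infoMatrix {t : ℝ} (ht : 0 ≤ t) (a b : κ) :
    HasDerivWithinAt (fun s => infoMatrix α f₀ R z s a b) (((α * (z t)⁻¹) • R t) a b) (Ici 0) t := by
  have := hasDerivWithinAt_integral (h.cont_integrand a b) ht
  exact this.const_add ((f₀ • (1 : Matrix κ κ ℝ)) a b)

/-- In zF the forgetting factor cancels: (zF)' = -αz⁻¹(zF)R(zF), the equation of the inverse of the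
information matrix H. -/
lemma smul_F_mul_infoMatrix {t : ℝ} (ht : 0 ≤ t) : (z t • F t) * infoMatrix α f₀ R z t = 1 := by
  have hf := h.f₀_pos.ne'
  have hG : ∀ t, 0 ≤ t → ∀ a b, HasDerivWithinAt (fun s => (z s • F s) a b)
      ((-(α * (z t)⁻¹) • ((z t • F t) * R t * (z t • F t))) a b) (Ici 0) t := by
    intro t ht a b
    have hz := (h.z_pos ht).ne'
    refine HasDerivWithinAt.congr_deriv ((h.deriv_z t ht).mul (h.deriv_F t ht a b)) ?_
    simp only [Matrix.smul_mul, Matrix.mul_smul, Matrix.smul_apply, Matrix.add_apply, smul_eq_mul]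
    field_simp
    ring
  -- The defect Y = (zF)H - I solves Y' = -αz⁻¹(zF)R Y with Y(0) = 0, which avoids assuming that F
  -- is invertible.
  have key := eq_zero_of_matrix_linear_ode
    (A := fun t => -(α * (z t)⁻¹) • ((z t • F t) * R t))
    (Y := fun t => (z t • F t) * infoMatrix α f₀ R z t - 1) ?_ ?_ ?_ ht
  · exact sub_eq_zero.1 key
  · intro a b
    have c1 : ∀ a b, ContinuousOn (fun t => (z t • F t) a b) (Ici 0) :=
      fun a b t ht => (hG t ht a b).continuousWithinAt
    exact ((continuousOn_const.mul (h.cont_z.inv₀ fun _ ht => (h.z_pos ht).ne')).neg).mul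
      (continuousOn_matrix_mul c1 h.cont a b)
  · intro t ht a b
    have := hasDerivWithinAt_matrix_mul (hG t ht) (fun a b => h.deriv_infoMatrix ht a b) a b
    refine HasDerivWithinAt.congr_deriv (this.sub_const ((1 : Matrix κ κ ℝ) a b)) ?_
    refine congrFun (congrFun ?_ a) b
    rw [Matrix.mul_sub, Matrix.mul_one]
    generalize z t • F t = P
    simp only [Matrix.smul_mul, Matrix.mul_smul, Matrix.mul_assoc, neg_smul, neg_mul,
      sub_neg_eq_add]
    rfl
  · rw [h.z_zero, h.F_zero, infoMatrix]
    ext a b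
    simp [hf]

lemma infoMatrix_mul_smul_F {t : ℝ} (ht : 0 ≤ t) : infoMatrix α f₀ R z t * (z t • F t) = 1 :=
  mul_eq_one_comm.1 (h.smul_F_mul_infoMatrix ht)

lemma dotProduct_infoMatrix (t : ℝ) (v : κ → ℝ) :
    v ⬝ᵥ (infoMatrix α f₀ R z t *ᵥ v) = f₀ * (v ⬝ᵥ v)
      + ∫ s in (0 : ℝ)..t, α * (z (max s 0))⁻¹ * (v ⬝ᵥ (R (max s 0) *ᵥ v)) := by
  have hint : ∀ a b, IntervalIntegrable (fun s => α * (z (max s 0))⁻¹ * R (max s 0) a b)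
      MeasureTheory.volume 0 t := fun a b =>
    (continuous_comp_max (h.cont_integrand a b)).intervalIntegrable 0 t
  have e : ∀ s, α * (z (max s 0))⁻¹ * (v ⬝ᵥ (R (max s 0) *ᵥ v))
      = ∑ a, ∑ b, v a * v b * (α * (z (max s 0))⁻¹ * R (max s 0) a b) := by
    intro s
    simp only [dotProduct, Matrix.mulVec, Finset.mul_sum]
    exact Finset.sum_congr rfl fun a _ => Finset.sum_congr rfl fun b _ => by ring
  simp only [e]
  rw [intervalIntegral.integral_finsetSum fun a _ =>
    intervalIntegrable_sum fun b => (hint a b).const_mul _]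
  rw [infoMatrix, Matrix.add_mulVec, dotProduct_add, Matrix.smul_mulVec, Matrix.one_mulVec,
    dotProduct_smul, smul_eq_mul]
  congr 1
  simp only [dotProduct, Matrix.mulVec, Finset.mul_sum, Matrix.of_apply]
  refine Finset.sum_congr rfl fun a _ => ?_
  rw [intervalIntegral.integral_finsetSum fun b _ => (hint a b).const_mul _]
  refine Finset.sum_congr rfl fun b _ => ?_
  rw [intervalIntegral.integral_const_mul]
  ring

lemma integrand_nonneg (v : κ → ℝ) (s : ℝ) :
    0 ≤ α * (z (max s 0))⁻¹ * (v ⬝ᵥ (R (max s 0) *ᵥ v)) := by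
  have := h.z_pos (le_max_right s 0)
  have := h.α_pos
  have := h.nonneg (max s 0) v
  positivity

lemma f₀_mul_le {t : ℝ} (ht : 0 ≤ t) (v : κ → ℝ) :
    f₀ * (v ⬝ᵥ v) ≤ v ⬝ᵥ (infoMatrix α f₀ R z t *ᵥ v) := by
  rw [h.dotProduct_infoMatrix]
  have := intervalIntegral.integral_nonneg (μ := MeasureTheory.volume) ht
    (fun s _ => h.integrand_nonneg v s)
  linarith

/-- With y = zFx one has Hy = x, and H ≥ f₀I gives f₀‖y‖² ≤ yᵀx. -/
lemma specNorm_smul_F_le {t : ℝ} (ht : 0 ≤ t) : z t * specNorm (F t) ≤ 1 / f₀ := by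
  have hf := h.f₀_pos
  have hz := h.z_pos ht
  have e : z t * specNorm (F t) = specNorm (z t • F t) := by
    rw [specNorm, specNorm, map_smul, norm_smul, Real.norm_of_nonneg hz.le]
  rw [e, specNorm]
  refine ContinuousLinearMap.opNorm_le_bound _ (by positivity) fun x => ?_
  set y := Matrix.toEuclideanCLM (n := κ) (𝕜 := ℝ) (z t • F t) x with hy
  have hxy : infoMatrix α f₀ R z t *ᵥ y.ofLp = x.ofLp := by
    rw [hy, Matrix.ofLp_toEuclideanCLM, Matrix.mulVec_mulVec, h.infoMatrix_mul_smul_F ht,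
      Matrix.one_mulVec]
  have h1 := h.f₀_mul_le ht y.ofLp
  rw [hxy] at h1
  have h2 : y.ofLp ⬝ᵥ y.ofLp = ‖y‖ ^ 2 := by
    rw [EuclideanSpace.real_norm_sq_eq, dotProduct]
    exact Finset.sum_congr rfl fun i _ => by ring
  have h3 : y.ofLp ⬝ᵥ x.ofLp ≤ ‖y‖ * ‖x‖ := by
    have := real_inner_le_norm x y
    rw [EuclideanSpace.inner_eq_star_dotProduct, star_trivial] at this
    linarith
  rw [h2] at h1
  rw [one_div, ← div_eq_inv_mul, le_div_iff₀ hf]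
  rcases (norm_nonneg y).eq_or_lt with h0 | h0
  · rw [← h0]; simp
  · nlinarith

/-- Although β itself is not known to be nonnegative, z‖F‖ ≤ 1/f₀ ≤ ξ yields (z - 1)' ≤ -β₀(z - 1).
-/
lemma z_le_one {t : ℝ} (ht : 0 ≤ t) : z t ≤ 1 := by
  have key := nonpos_of_hasDerivWithinAt_le (f := fun s => z s - 1) (K := -β₀) (τ := t)
    (by simp [h.z_zero]) (fun s hs => by
      refine ⟨_, (h.deriv_z s hs.1).sub_const 1, ?_⟩
      have hβ := h.β₀_pos
      have hξ : 0 < ξ := (one_div_pos.2 h.f₀_pos).trans_le h.ξ_ge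
      have h1 := (h.specNorm_smul_F_le hs.1).trans h.ξ_ge
      have h2 : z s * specNorm (F s) / ξ ≤ 1 := (div_le_one hξ).2 h1
      have h3 : -(β₀ * (1 - specNorm (F s) / ξ)) * z s
          = -β₀ * z s + β₀ * (z s * specNorm (F s) / ξ) := by ring
      rw [h3]
      nlinarith) ht
  linarith

lemma infoMatrix_symm (t : ℝ) : (infoMatrix α f₀ R z t)ᵀ = infoMatrix α f₀ R z t := by
  rw [infoMatrix, Matrix.transpose_add, Matrix.transpose_smul, Matrix.transpose_one]
  congr 1
  ext a b
  simp only [Matrix.transpose_apply, Matrix.of_apply]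
  congr 1
  funext s
  rw [← Matrix.transpose_apply (R (max s 0)) a b, h.symm]

/-- The integrand is nonnegative, so the exciting interval alone bounds the integral from below and
the bound persists; z ≤ 1 makes the weight z⁻¹ harmless. -/
lemma excited_infoMatrix {t₁ T μ t : ℝ} (ht₁ : 0 ≤ t₁) (hT : 0 < T)
    (hexc : (Matrix.of (fun a b => ∫ s in t₁..(t₁ + T), R s a b)
      - μ • (1 : Matrix κ κ ℝ)).PosSemidef) (ht : t₁ + T ≤ t) (v : κ → ℝ) :
    (f₀ + α * μ) * (v ⬝ᵥ v) ≤ v ⬝ᵥ (infoMatrix α f₀ R z t *ᵥ v) := by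
  have hα := h.α_pos
  have hint : ∀ a b, IntervalIntegrable (fun s => R s a b) MeasureTheory.volume t₁ (t₁ + T) := by
    intro a b
    apply ContinuousOn.intervalIntegrable_of_Icc (by linarith)
    exact (h.cont a b).mono fun s hs => ht₁.trans hs.1
  have h1 := hexc.dotProduct_mulVec_nonneg v
  rw [star_trivial, Matrix.sub_mulVec, dotProduct_sub, Matrix.smul_mulVec, Matrix.one_mulVec,
    dotProduct_smul, smul_eq_mul] at h1
  have e : v ⬝ᵥ (Matrix.of (fun a b => ∫ s in t₁..(t₁ + T), R s a b) *ᵥ v)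
      = ∫ s in t₁..(t₁ + T), v ⬝ᵥ (R s *ᵥ v) := by
    have e' : ∀ s, v ⬝ᵥ (R s *ᵥ v) = ∑ a, ∑ b, v a * v b * R s a b := by
      intro s
      simp only [dotProduct, Matrix.mulVec, Finset.mul_sum]
      exact Finset.sum_congr rfl fun a _ => Finset.sum_congr rfl fun b _ => by ring
    simp only [e']
    rw [intervalIntegral.integral_finsetSum fun a _ =>
      intervalIntegrable_sum fun b => (hint a b).const_mul _]
    simp only [dotProduct, Matrix.mulVec, Finset.mul_sum, Matrix.of_apply]
    refine Finset.sum_congr rfl fun a _ => ?_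
    rw [intervalIntegral.integral_finsetSum fun b _ => (hint a b).const_mul _]
    refine Finset.sum_congr rfl fun b _ => ?_
    rw [intervalIntegral.integral_const_mul]
    ring
  rw [e] at h1
  have cR : ContinuousOn (fun s => v ⬝ᵥ (R s *ᵥ v)) (Ici 0) := by
    simp only [dotProduct, Matrix.mulVec]
    exact continuousOn_finsetSum _ fun a _ => continuousOn_const.mul
      (continuousOn_finsetSum _ fun b _ => (h.cont a b).mul continuousOn_const)
  have cI : Continuous fun s => α * (z (max s 0))⁻¹ * (v ⬝ᵥ (R (max s 0) *ᵥ v)) :=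
    continuous_comp_max ((continuousOn_const.mul
      (h.cont_z.inv₀ fun _ ht => (h.z_pos ht).ne')).mul cR)
  have h2 : ∫ s in t₁..(t₁ + T), α * (z (max s 0))⁻¹ * (v ⬝ᵥ (R (max s 0) *ᵥ v)) ≤
      ∫ s in (0 : ℝ)..t, α * (z (max s 0))⁻¹ * (v ⬝ᵥ (R (max s 0) *ᵥ v)) :=
    intervalIntegral.integral_mono_interval ht₁ (by linarith) ht
      (Eventually.of_forall fun s => h.integrand_nonneg v s) (cI.intervalIntegrable _ _)
  have h3 : ∫ s in t₁..(t₁ + T), α * (v ⬝ᵥ (R s *ᵥ v)) ≤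
      ∫ s in t₁..(t₁ + T), α * (z (max s 0))⁻¹ * (v ⬝ᵥ (R (max s 0) *ᵥ v)) := by
    apply intervalIntegral.integral_mono_on (by linarith) _ (cI.intervalIntegrable _ _)
    · intro s hs
      have hs0 : 0 ≤ s := ht₁.trans hs.1
      rw [max_eq_left hs0]
      have hz := h.z_pos hs0
      have hz1 : 1 ≤ (z s)⁻¹ := (one_le_inv₀ hz).2 (h.z_le_one hs0)
      have hR := h.nonneg s v
      gcongr
      exact le_mul_of_one_le_right hα.le hz1
    · apply ContinuousOn.intervalIntegrable_of_Icc (by linarith)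
      exact (continuousOn_const.mul cR).mono fun s hs => ht₁.trans hs.1
  rw [intervalIntegral.integral_const_mul] at h3
  rw [h.dotProduct_infoMatrix]
  have h4 := mul_nonneg hα.le h1
  linarith

/-- I - f₀H⁻¹ is symmetric, so its determinant is the product of its eigenvalues, and each of them
is bounded below. -/
lemma pow_le_det {t₁ T μ t : ℝ} (ht₁ : 0 ≤ t₁) (hT : 0 < T) (hμ : 0 < μ)
    (hexc : (Matrix.of (fun a b => ∫ s in t₁..(t₁ + T), R s a b)
      - μ • (1 : Matrix κ κ ℝ)).PosSemidef) (ht : t₁ + T ≤ t) :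
    (α * μ / (f₀ + α * μ)) ^ Fintype.card κ ≤ (1 - (z t * f₀) • F t).det := by
  have hα := h.α_pos
  have hf := h.f₀_pos
  have ht0 : 0 ≤ t := by linarith
  have hG := h.smul_F_mul_infoMatrix ht0
  have hG' := h.infoMatrix_mul_smul_F ht0
  set H := infoMatrix α f₀ R z t
  set P := z t • F t with hP
  have hPs : Pᵀ = P := by
    have h1 : Pᵀ * H = 1 := by
      have := congrArg Matrix.transpose hG'
      rwa [Matrix.transpose_mul, h.infoMatrix_symm, Matrix.transpose_one] at this
    exact left_inv_eq_right_inv h1 hG'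
  have eΦ : 1 - (z t * f₀) • F t = 1 - f₀ • P := by rw [hP, smul_smul, mul_comm]
  rw [eΦ]
  have hΦ : (1 - f₀ • P).IsHermitian := by
    rw [Matrix.IsHermitian, Matrix.conjTranspose_eq_transpose_of_trivial, Matrix.transpose_sub,
      Matrix.transpose_one, Matrix.transpose_smul, hPs]
  rw [hΦ.det_eq_prod_eigenvalues, ← Finset.card_univ, ← Finset.prod_const]
  refine Finset.prod_le_prod (fun _ _ => by positivity) fun i _ => ?_
  change _ ≤ hΦ.eigenvalues i
  set l := hΦ.eigenvalues i
  set v := (hΦ.eigenvectorBasis i).ofLp with hv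
  have hev := hΦ.mulVec_eigenvectorBasis i
  rw [← hv, Matrix.sub_mulVec, Matrix.one_mulVec, Matrix.smul_mulVec] at hev
  have hPv : f₀ • (P *ᵥ v) = (1 - l) • v := by
    rw [sub_smul, one_smul, ← hev]; abel
  have hvv : v ⬝ᵥ v = 1 := by
    have h1 : ‖hΦ.eigenvectorBasis i‖ = 1 := hΦ.eigenvectorBasis.norm_eq_one i
    have h2 : v ⬝ᵥ v = ‖hΦ.eigenvectorBasis i‖ ^ 2 := by
      rw [EuclideanSpace.real_norm_sq_eq, dotProduct]
      exact Finset.sum_congr rfl fun i _ => by ring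
    rw [h2, h1, one_pow]
  -- A unit eigenvector v of I - f₀H⁻¹ for l satisfies (1 - l)Hv = f₀v; testing with v relates l to
  -- the lower bound of H.
  have hHv : f₀ = (1 - l) * (v ⬝ᵥ (H *ᵥ v)) := by
    have h1 : H *ᵥ (f₀ • (P *ᵥ v)) = f₀ • v := by
      rw [Matrix.mulVec_smul, Matrix.mulVec_mulVec, hG', Matrix.one_mulVec]
    rw [hPv, Matrix.mulVec_smul] at h1
    have h2 := congrArg (fun w => v ⬝ᵥ w) h1
    simp only [dotProduct_smul, smul_eq_mul, hvv] at h2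
    linarith
  have hlow := h.excited_infoMatrix ht₁ hT hexc ht v
  rw [hvv, mul_one] at hlow
  have hden : 0 < f₀ + α * μ := by positivity
  have hl : 0 < 1 - l := by
    by_contra hc
    push Not at hc
    have := mul_nonpos_of_nonpos_of_nonneg hc (hden.le.trans hlow)
    linarith
  rw [div_le_iff₀ hden]
  have := mul_le_mul_of_nonneg_left hlow hl.le
  linarith

end IsLeastSquares

end MatrixODE

section

variable {n k j : ℕ} {S : Plant n k j} {G : PDGains n} {A : AdaptGains j} {L : DREGains}
  {qd : Vec n} {p : Parameterization} {μm μM Lc : ℝ}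

/-! ### Excitation bounds `ζ₁(Δ)` from below -/

lemma continuousOn_apply {m : ℕ} {f : ℝ → Vec m} {s : Set ℝ} (hf : ContinuousOn f s) (i : Fin m) :
    ContinuousOn (fun t => f t i) s :=
  (EuclideanSpace.proj (𝕜 := ℝ) i).continuous.comp_continuousOn hf

lemma continuousOn_Ω (hS : S.Standing μm μM Lc) {X : Trajectory n k j p}
    (hX : IsSolution S G A L qd ⊤ X) (i : Fin (p.rows n)) (c : Col k j) :
    ContinuousOn (fun t => X.Ω S L qd t i c) (Ici 0) := by
  have h₁ : ContinuousOn X.e₁ (Ici 0) := fun t ht =>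
    (hX.deriv_e₁ t ht (EReal.coe_lt_top t)).continuousWithinAt
  have h₂ : ContinuousOn X.e₂ (Ici 0) := fun t ht =>
    (hX.deriv_e₂ t ht (EReal.coe_lt_top t)).continuousWithinAt
  have hw : ∀ i c, ContinuousOn (fun t => X.w t i c) (Ici 0) := fun i c t ht =>
    (hX.deriv_w t ht (EReal.coe_lt_top t) i c).continuousWithinAt
  have hq : ContinuousOn (fun t => X.e₁ t + qd) (Ici 0) := h₁.add continuousOn_const
  have hM : ∀ m a b, ContinuousOn (fun t => S.Mpart m (X.e₁ t + qd) a b) (Ici 0) := fun m a b =>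
    (hS.smooth_M m a b).continuous.comp_continuousOn hq
  have hU : ∀ m, ContinuousOn (fun t => S.Upart m (X.e₁ t + qd)) (Ici 0) := fun m =>
    (hS.smooth_U m).continuous.comp_continuousOn hq
  have hMv : ∀ m a, ContinuousOn
      (fun t => (S.Mpart m (X.e₁ t + qd) *ᵥ (X.e₂ t).ofLp) a) (Ici 0) := by
    intro m a
    simp only [Matrix.mulVec, dotProduct]
    exact continuousOn_finsetSum _ fun b _ => (hM m a b).mul (continuousOn_apply h₂ b)
  cases p with
  | powerBalance =>
    refine (hw i c).add (continuousOn_const.mul ?_)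
    cases c with
    | inl m =>
      exact continuousOn_const.mul
        (continuousOn_finsetSum _ fun a _ => (continuousOn_apply h₂ a).mul (hMv m a))
    | inr m => exact hU m
  | forceBalance =>
    cases c with
    | inl m => exact (hw i _).add (continuousOn_const.mul (hMv m i))
    | inr m => exact hw i _

lemma IsSolution.isLeastSquares (hS : S.Standing μm μM Lc) {X : Trajectory n k j p}
    (hX : IsSolution S G A L qd ⊤ X) :
    IsLeastSquares L.α L.f₀ L.β₀ L.ξ (fun t => (X.Ω S L qd t)ᵀ * X.Ω S L qd t) X.F X.z where
  α_pos := L.α_pos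
  f₀_pos := L.f₀_pos
  β₀_pos := L.β₀_pos
  ξ_ge := L.ξ_ge
  cont a b := by
    simp only [Matrix.mul_apply, Matrix.transpose_apply]
    exact continuousOn_finsetSum _ fun i _ =>
      (continuousOn_Ω hS hX i a).mul (continuousOn_Ω hS hX i b)
  symm t := by rw [Matrix.transpose_mul, Matrix.transpose_transpose]
  nonneg t v := by
    rw [← Matrix.mulVec_mulVec, Matrix.dotProduct_mulVec, Matrix.vecMul_transpose]
    exact Finset.sum_nonneg fun i _ => mul_self_nonneg _
  F_zero := hX.F_zero
  z_zero := hX.z_zero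
  deriv_F t ht a b := by
    have := hX.deriv_F t ht (EReal.coe_lt_top t) a b
    rw [Matrix.mul_assoc (X.F t)] at this
    exact this
  deriv_z t ht := hX.deriv_z t ht (EReal.coe_lt_top t)

/-- The determinant bound depends on the excitation level and the design constants only, so one
value of φm serves all solutions considered. -/
lemma exists_zetaLowerBound (hS : S.Standing μm μM Lc) {Ξ : Set (InitState n k j p)}
    {R t₁ T μ : ℝ} (ht₁ : 0 ≤ t₁) (hT : 0 < T) (hμ : 0 < μ)
    (hexc : ExcitingOn S G A L qd Ξ R t₁ T μ) :
    ∃ φm, 0 < φm ∧ ZetaLowerBound S G A L qd Ξ R (t₁ + T) φm := by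
  have hα := L.α_pos
  have hf := L.f₀_pos
  set ε := (L.α * μ / (L.f₀ + L.α * μ)) ^ Fintype.card (Col k j) with hε
  have hε0 : 0 < ε := by positivity
  refine ⟨zeta1 G.b A.d ε, zeta1_pos _ _ _ G.b_pos A.d_pos hε0, fun X hX t ht => ?_⟩
  exact zeta1_mono _ _ _ _ G.b_pos A.d_pos hε0.le
    ((hX.1.isLeastSquares hS).pow_le_det ht₁ hT hμ (hexc X hX) ht)

/-! ### Settling time -/

lemma stateNorm_le_initNorm (X : Trajectory n k j p) : X.normAt 0 ≤ initNorm X.init := by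
  have : 0 ≤ ∑ i, ∑ c, (X.w 0 i c) ^ 2 := by positivity
  exact Real.sqrt_le_sqrt (le_add_of_nonneg_right this)

lemma atOrigin_of_homSize_nonpos {X : Trajectory n k j p} {t : ℝ}
    (h : homSize G (X.e₁ t) (X.e₂ t) (X.θ t) ≤ 0) : X.AtOrigin t := by
  have hN := le_antisymm h (homSize_nonneg G _ _ _)
  have hs := stateNorm_sq_le G (X.e₁ t) (X.e₂ t) (X.θ t)
  rw [hN, Real.zero_rpow (mul_pos two_pos (inv_pos.2 G.pw_pos)).ne', mul_zero, add_zero,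
    stateNorm_sq] at hs
  refine ⟨norm_eq_zero.1 ?_, norm_eq_zero.1 ?_, norm_eq_zero.1 ?_⟩ <;>
    refine pow_eq_zero_iff (two_ne_zero) |>.1 (le_antisymm ?_ (sq_nonneg _)) <;>
    nlinarith [sq_nonneg ‖X.e₁ t‖, sq_nonneg ‖X.e₂ t‖, sq_nonneg ‖X.θ t‖]

variable (G) in
/-- An upper bound that absorbs the time spent where `V_FT` decays with the exponent `σ₂`. -/
noncomputable def settlingBound (ν : ℝ → ℝ) (s : ℝ) : ℝ :=
  ν s + (ν s ^ (1 - G.σ₁) + (1 - G.σ₁) / (1 - G.σ₂) * ν s ^ (1 - G.σ₂)) ^ (1 / (1 - G.σ₁))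

lemma isClassKInf_settlingBound {ν : ℝ → ℝ} (hν : IsClassKInf ν) :
    IsClassKInf (settlingBound G ν) := by
  have h₁ : 0 < 1 - G.σ₁ := by linarith [G.σ₁_lt_one]
  have h₂ : 0 < 1 - G.σ₂ := by linarith [G.σ₂_lt_one]
  exact hν.add (((hν.rpow h₁).add ((hν.rpow h₂).const_mul (div_pos h₁ h₂))).rpow
    (one_div_pos.2 h₁))

lemma le_settlingBound {ν : ℝ → ℝ} {s : ℝ} (hν : 0 ≤ ν s) : ν s ≤ settlingBound G ν s := by
  have h₁ : 0 < 1 - G.σ₁ := by linarith [G.σ₁_lt_one]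
  have h₂ : 0 < 1 - G.σ₂ := by linarith [G.σ₂_lt_one]
  rw [settlingBound]
  apply le_add_of_nonneg_right
  positivity

/-- The second summand of `settlingBound` is the number whose power 1 - σ₁, divided by 1 - σ₁,
equals the sum of both settling terms for the bound ν. -/
lemma le_settlingBound_rpow {ν : ℝ → ℝ} {s V : ℝ} (hV : 0 ≤ V) (hVν : V ≤ ν s) :
    V ^ (1 - G.σ₁) / (1 - G.σ₁) + V ^ (1 - G.σ₂) / (1 - G.σ₂) ≤
      settlingBound G ν s ^ (1 - G.σ₁) / (1 - G.σ₁) := by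
  have h₁ : 0 < 1 - G.σ₁ := by linarith [G.σ₁_lt_one]
  have h₂ : 0 < 1 - G.σ₂ := by linarith [G.σ₂_lt_one]
  have hν : 0 ≤ ν s := hV.trans hVν
  set g := ν s ^ (1 - G.σ₁) + (1 - G.σ₁) / (1 - G.σ₂) * ν s ^ (1 - G.σ₂) with hg
  have hg0 : 0 ≤ g := by positivity
  have h3 : g ≤ settlingBound G ν s ^ (1 - G.σ₁) := by
    have h4 : g ^ (1 / (1 - G.σ₁)) ≤ settlingBound G ν s := by
      rw [settlingBound, ← hg]; linarith
    have h5 := Real.rpow_le_rpow (by positivity) h4 h₁.le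
    rwa [← Real.rpow_mul hg0, one_div_mul_cancel h₁.ne', Real.rpow_one] at h5
  have e1 := Real.rpow_le_rpow hV hVν h₁.le
  have e2 := Real.rpow_le_rpow hV hVν h₂.le
  calc V ^ (1 - G.σ₁) / (1 - G.σ₁) + V ^ (1 - G.σ₂) / (1 - G.σ₂)
      ≤ ν s ^ (1 - G.σ₁) / (1 - G.σ₁) + ν s ^ (1 - G.σ₂) / (1 - G.σ₂) := by gcongr
    _ = g / (1 - G.σ₁) := by rw [hg]; field_simp
    _ ≤ _ := by gcongr

/-- V_FT does not increase before T₀, so V_FT(T₀) ≤ ν(R); from then on it decays at rate at least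
c₃φm. The factors in the formula are 1 - σ₁ = (r₁-r₂)/(3r₂). -/
lemma atOrigin_of_settled {c c₃ d₃ : ℝ} {ν : ℝ → ℝ} (hν : IsClassKInf ν) (hc : 0 < c)
    (hc₃ : 0 < c₃)
    (hlow : ∀ e₁ e₂ θ, c * homSize G e₁ e₂ θ ^ (3 / 2 : ℝ) ≤ VFT S G A qd 1 1 d₃ e₁ e₂ θ)
    (hupp : ∀ e₁ e₂ θ, VFT S G A qd 1 1 d₃ e₁ e₂ θ ≤ ν (stateNorm e₁ e₂ θ))
    (hdec : VFTDecay S G A qd L p 1 1 d₃ c₃) {Ξ : Set (InitState n k j p)} {R T₀ φm t : ℝ}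
    (hT₀ : 0 ≤ T₀) (hφ : 0 < φm) (hζ : ZetaLowerBound S G A L qd Ξ R T₀ φm)
    {X : Trajectory n k j p} (hX : StartsIn S G A L qd Ξ R X)
    (ht : T₀ + 3 * G.r₂ * settlingBound G ν R ^ ((G.r₁ - G.r₂) / (3 * G.r₂)) /
      ((G.r₁ - G.r₂) * 1 * c₃ * φm) ≤ t) : X.AtOrigin t := by
  have hN := fun s => homSize_nonneg G (X.e₁ s) (X.e₂ s) (X.θ s)
  set V : ℝ → ℝ := fun s => VFT S G A qd 1 1 d₃ (X.e₁ s) (X.e₂ s) (X.θ s) with hVdef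
  have hV : ∀ s, 0 ≤ V s := fun s =>
    (mul_nonneg hc.le (Real.rpow_nonneg (hN s) _)).trans (hlow _ _ _)
  have hmin : ∀ s, 0 ≤ min (V s ^ G.σ₁) (V s ^ G.σ₂) := fun s =>
    le_min (Real.rpow_nonneg (hV s) _) (Real.rpow_nonneg (hV s) _)
  have hdec' : ∀ s, 0 ≤ s → ∃ v', HasDerivWithinAt V v' (Ici 0) s ∧
      v' ≤ -(c₃ * zeta1 G.b A.d (X.Δ L s) * min (V s ^ G.σ₁) (V s ^ G.σ₂)) := fun s hs => by
    obtain ⟨v', hv, hle⟩ := hdec ⊤ X hX.1 s hs (EReal.coe_lt_top s)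
    rw [one_mul] at hle
    exact ⟨v', hv, hle⟩
  have hVT : V T₀ ≤ ν R := by
    have h0 : V T₀ ≤ V 0 := le_of_hasDerivWithinAt_nonpos le_rfl hT₀ fun s hs => by
      obtain ⟨v', hv, hle⟩ := hdec' s hs.1
      refine ⟨v', hv, hle.trans (neg_nonpos.2 ?_)⟩
      exact mul_nonneg (mul_nonneg hc₃.le (zeta1_nonneg _ _ _ G.b_pos A.d_pos)) (hmin s)
    exact h0.trans ((hupp _ _ _).trans (hν.le (stateNorm_nonneg _ _ _)
      ((stateNorm_le_initNorm X).trans hX.2.2)))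
  have hVt : V t = 0 := by
    refine eq_zero_of_finite_time_decay (c := c₃ * φm) (by positivity) G.σ₁_lt_one G.σ₂_lt_one
      hT₀ hV (fun s hs => ?_) (le_trans ?_ ht)
    · obtain ⟨v', hv, hle⟩ := hdec' s (hT₀.trans hs)
      refine ⟨v', hv, hle.trans (neg_le_neg ?_)⟩
      have := hζ X hX s hs
      have := hmin s
      gcongr
    · have h1 := le_settlingBound_rpow (G := G) (hV T₀) hVT
      have hr : G.r₁ - G.r₂ ≠ 0 := by linarith [G.r₂_lt] |> fun h : 0 < G.r₁ - G.r₂ => h.ne'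
      have hr₂ := G.r₂_pos.ne'
      rw [G.one_sub_σ₁] at h1
      rw [G.one_sub_σ₁]
      have e : 3 * G.r₂ * settlingBound G ν R ^ ((G.r₁ - G.r₂) / (3 * G.r₂)) /
          ((G.r₁ - G.r₂) * 1 * c₃ * φm)
          = settlingBound G ν R ^ ((G.r₁ - G.r₂) / (3 * G.r₂)) / ((G.r₁ - G.r₂) / (3 * G.r₂))
            / (c₃ * φm) := by
        field_simp
      rw [e]
      gcongr
  refine atOrigin_of_homSize_nonpos (G := G) ?_
  have h1 := hlow (X.e₁ t) (X.e₂ t) (X.θ t)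
  have h2 : VFT S G A qd 1 1 d₃ (X.e₁ t) (X.e₂ t) (X.θ t) = 0 := hVt
  rw [h2] at h1
  by_contra hcon
  push Not at hcon
  have := mul_pos hc (Real.rpow_pos_of_pos hcon (3 / 2))
  linarith

-- Once d₁ is replaced by its upper bound D_{Li}μm/μM², both requirements bound γ₁/(γ₁+γ₂) by
-- quantities free of the adaptation gains. This is what makes the threshold depend only on the
-- plant and on the controller.
variable (G) in
lemma exists_gain_ratio (hS : S.Standing μm μM Lc) :
    ∃ γ, 0 < γ ∧ ∀ A : AdaptGains j, A.γ₁ / (A.γ₁ + A.γ₂) ≤ γ →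
      (∀ i, A.d₁ ≤ G.DL i * μm / μM ^ 2) →
      (∀ i, A.γ₁ * A.d₁ * (μM + Lc * Real.sqrt n) ≤ (A.γ₁ + A.γ₂) * (G.DL i / 2)) ∧
      (∀ i, A.γ₁ * A.d₁ * youngConst G i ≤ (A.γ₁ + A.γ₂) * (G.D i / 2)) := by
  have hm := hS.μm_pos
  have hM := hS.μM_pos
  have hL := hS.Lc_pos
  set Y := μM + Lc * Real.sqrt n with hY
  have hY0 : 0 < Y := by positivity
  have hpos : ∀ i, 0 < min (G.DL i / 2 / (G.DL i * μm / μM ^ 2 * Y))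
      (G.D i / 2 / (G.DL i * μm / μM ^ 2 * youngConst G i)) := fun i => by
    have := G.DL_pos i
    have := G.D_pos i
    have := youngConst_pos G i
    positivity
  obtain ⟨γ, hγ, hle⟩ := exists_pos_le_of_finite _ hpos
  refine ⟨γ, hγ, fun A hA hd => ?_⟩
  have hγ₁ := A.γ₁_pos
  have hγ₂ := A.γ₂_pos
  have hd₁ := A.d₁_pos
  rw [div_le_iff₀ (by positivity)] at hA
  have main : ∀ {i : Fin n} {C B : ℝ}, 0 < C → γ ≤ B / (G.DL i * μm / μM ^ 2 * C) →
      A.γ₁ * A.d₁ * C ≤ (A.γ₁ + A.γ₂) * B := by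
    intro i C B hC h
    have hDL := G.DL_pos i
    rw [le_div_iff₀ (by positivity)] at h
    calc A.γ₁ * A.d₁ * C ≤ γ * (A.γ₁ + A.γ₂) * (G.DL i * μm / μM ^ 2) * C := by
          gcongr
          exact hd i
      _ = (A.γ₁ + A.γ₂) * (γ * (G.DL i * μm / μM ^ 2 * C)) := by ring
      _ ≤ _ := by gcongr
  exact ⟨fun i => main hY0 ((hle i).trans (min_le_left _ _)),
    fun i => main (youngConst_pos G i) ((hle i).trans (min_le_right _ _))⟩

end

end ELControl

/-! ### Assembly of the stability, attractivity and settling-time claims -/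

theorem proposition4 {n k j : ℕ} (S : Plant n k j) (μm μM Lc : ℝ)
    (hS : S.Standing μm μM Lc) (G : PDGains n) :
    ∃ γbar : ℝ, 0 < γbar ∧
      ∀ (A : AdaptGains j) (L : DREGains) (p : Parameterization) (qd : Vec n),
        A.γ₁ / (A.γ₁ + A.γ₂) ≤ γbar →
        (∀ i, A.d₁ ≤ G.DL i * μm / μM ^ 2) →
        UniformlyGloballyStable S G A L qd p ∧
        (∀ Ξ : Set (InitState n k j p),
          (∀ R : ℝ, 0 < R → ∃ t₁ T μ : ℝ, 0 ≤ t₁ ∧ 0 < T ∧ 0 < μ ∧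
            ExcitingOn S G A L qd Ξ R t₁ T μ) →
          UniformlyAttractiveInFiniteTime S G A L qd Ξ) ∧
        ∃ (γ₃ γ₄ d₃ c₃ : ℝ) (α₁ α₂ : ℝ → ℝ),
          0 < γ₃ ∧ 0 < γ₄ ∧ 0 < d₃ ∧ 0 < c₃ ∧ IsClassKInf α₁ ∧ IsClassKInf α₂ ∧
          VFTBounds S G A qd γ₃ γ₄ d₃ α₁ α₂ ∧
          VFTDecay S G A qd L p γ₃ γ₄ d₃ c₃ ∧
          ∀ (Ξ : Set (InitState n k j p)) (R t₁ T μ : ℝ),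
            0 < R → 0 ≤ t₁ → 0 < T → 0 < μ → ExcitingOn S G A L qd Ξ R t₁ T μ →
            (∃ φm : ℝ, 0 < φm ∧ ZetaLowerBound S G A L qd Ξ R (t₁ + T) φm) ∧
            ∀ φm : ℝ, 0 < φm → ZetaLowerBound S G A L qd Ξ R (t₁ + T) φm →
              ∀ X : Trajectory n k j p, StartsIn S G A L qd Ξ R X →
                ∀ t : ℝ, (t₁ + T) + 3 * G.r₂ * α₂ R ^ ((G.r₁ - G.r₂) / (3 * G.r₂)) /
                  ((G.r₁ - G.r₂) * γ₃ * c₃ * φm) ≤ t →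
                X.AtOrigin t := by
  obtain ⟨γbar, hγbar, hγ⟩ := exists_gain_ratio (j := j) G hS
  refine ⟨γbar, hγbar, fun A L p qd hA hd => ?_⟩
  obtain ⟨h1, h2⟩ := hγ A hA hd
  obtain ⟨d₃, c₃, c, K, hd₃, hc₃, hc, hK, hlow, hupp, hdec⟩ :=
    exists_VFT_decay G qd A hS hd h1 h2
  have hdecay : VFTDecay S G A qd L p 1 1 d₃ c₃ := by
    intro τ X hX t ht htτ
    obtain ⟨v', hv, hle⟩ := hdec X.e₁ X.e₂ X.θ (zeta1 G.b A.d (X.Δ L t)) t (Ici 0)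
      (zeta1_nonneg _ _ _ G.b_pos A.d_pos) (zeta1_le_one _ _ _ G.b_pos A.d_pos)
      (hX.deriv_e₁ t ht htτ) (hX.deriv_e₂ t ht htτ) (hX.deriv_θ t ht htτ)
    exact ⟨v', hv, by rw [one_mul]; exact hle⟩
  have hp := inv_pos.2 G.pw_pos
  have hsize := isClassKInf_sizeBound G
  -- The sum of the two powers dominates V_FT in both regimes N ≤ 1 and N ≥ 1.
  set ν : ℝ → ℝ := fun s =>
    K * (sizeBound G s ^ (3 / 2 : ℝ) + sizeBound G s ^ (2 * (1 + G.pw⁻¹)))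
  have hν : IsClassKInf ν :=
    ((hsize.rpow (by norm_num)).add (hsize.rpow (by positivity))).const_mul hK
  have hVν : ∀ e₁ e₂ θ, VFT S G A qd 1 1 d₃ e₁ e₂ θ ≤ ν (stateNorm e₁ e₂ θ) := by
    intro e₁ e₂ θ
    have hN := homSize_nonneg G e₁ e₂ θ
    have hs := homSize_le_sizeBound G e₁ e₂ θ
    have hs0 := hN.trans hs
    have g1 := Real.rpow_le_rpow hN hs (show (0 : ℝ) ≤ 3 / 2 by norm_num)
    have g2 := Real.rpow_le_rpow hN hs (show 0 ≤ 2 * (1 + G.pw⁻¹) by positivity)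
    have g3 := Real.rpow_nonneg hs0 (3 / 2)
    have g4 := Real.rpow_nonneg hs0 (2 * (1 + G.pw⁻¹))
    rcases le_total (homSize G e₁ e₂ θ) 1 with h | h
    · exact ((hupp e₁ e₂ θ).1 h).trans (mul_le_mul_of_nonneg_left (by linarith) hK.le)
    · exact ((hupp e₁ e₂ θ).2 h).trans (mul_le_mul_of_nonneg_left (by linarith) hK.le)
  have hsettle : ∀ (Ξ : Set (InitState n k j p)) (R t₁ T φm : ℝ), 0 ≤ t₁ → 0 < T → 0 < φm →
      ZetaLowerBound S G A L qd Ξ R (t₁ + T) φm →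
      ∀ X : Trajectory n k j p, StartsIn S G A L qd Ξ R X →
        ∀ t : ℝ, (t₁ + T) + 3 * G.r₂ * settlingBound G ν R ^ ((G.r₁ - G.r₂) / (3 * G.r₂)) /
          ((G.r₁ - G.r₂) * 1 * c₃ * φm) ≤ t → X.AtOrigin t :=
    fun Ξ R t₁ T φm ht₁ hT hφ hζ X hX t ht =>
      atOrigin_of_settled hν hc hc₃ hlow hVν hdecay (by linarith) hφ hζ hX ht
  -- γ₃ = γ₄ = 1 suffice, since d₃ is free. For α₂ the enlarged bound is taken in place of ν, as the
  -- settling time demands.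
  refine ⟨uniformlyGloballyStable G qd A hS L p hd h1 h2, fun Ξ hΞ R hR => ?_, 1, 1, d₃, c₃,
    fun s => c * sizeLower G s ^ (3 / 2 : ℝ), settlingBound G ν, one_pos, one_pos, hd₃, hc₃,
    ((isClassKInf_sizeLower G).rpow (by norm_num)).const_mul hc, isClassKInf_settlingBound hν,
    fun e₁ e₂ θ => ⟨?_, ?_⟩, hdecay, fun Ξ R t₁ T μ hR ht₁ hT hμ hexc => ⟨?_, ?_⟩⟩
  · obtain ⟨t₁, T, μ, ht₁, hT, hμ, hexc⟩ := hΞ R hR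
    obtain ⟨φm, hφ, hζ⟩ := exists_zetaLowerBound hS ht₁ hT hμ hexc
    -- The maximum with 1 makes the attraction time positive.
    exact ⟨max 1 _, by positivity, fun X hX t ht =>
      hsettle Ξ R t₁ T φm ht₁ hT hφ hζ X hX t ((le_max_right _ _).trans ht)⟩
  · refine le_trans ?_ (hlow e₁ e₂ θ)
    have := (isClassKInf_sizeLower G).nonneg (stateNorm_nonneg e₁ e₂ θ)
    exact mul_le_mul_of_nonneg_left
      (Real.rpow_le_rpow this (sizeLower_le_homSize G e₁ e₂ θ) (by norm_num)) hc.le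
  · exact (hVν e₁ e₂ θ).trans (le_settlingBound (hν.nonneg (stateNorm_nonneg _ _ _)))
  · exact exists_zetaLowerBound hS ht₁ hT hμ hexc
  · exact fun φm hφ hζ X hX t ht => hsettle Ξ R t₁ T φm ht₁ hT hφ hζ X hX t ht
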